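/- Let $q\in\mathbb C^*$ be not a root of unity. Let $U_q(\widehat{\mathfrak{sl}}_2)$ be the quantum affine algebra in Drinfeld's current realization: it is generated by the coefficients of $e(z)=\sum_{k\in\mathbb Z}e_kz^{-k}$, $f(z)=\sum_{k\in\mathbb Z}f_kz^{-k}$, $K^{+}(z)=\sum_{n\ge0}K^+_nz^{-n}$, $K^-(z)=\sum_{n\ge 0}K^-_nz^{n}$ with $K^{\pm}_0=k^{\pm1}$, by a central invertible element $q^{c/2}$ and by the grading element $d=-z\frac{d}{dz}$ (that is, $[d,x_n]=n\,x_n$ for the coefficient $x_n$ of $z^{-n}$ in a current), subject to $$(z-q^{2}w)e(z)e(w)=(q^{2}z-w)e(w)e(z),\qquad (z-q^{-2}w)f(z)f(w)=(q^{-2}z-w)f(w)f(z),$$ $$(q^{\pm c/2}z-q^{2}w)K^{\pm}(z)e(w)=(q^{2\pm c/2}z-w)e(w)K^{\pm}(z),$$ $$(q^{\mp c/2}z-q^{-2}w)K^{\pm}(z)f(w)=(q^{-2\mp c/2}z-w)f(w)K^{\pm}(z),$$ $$(z-q^{2-c}w)(z-q^{-2+c}w)K^+(z)K^-(w)=(q^{2+c}z-w)(q^{-2-c}z-w)K^-(w)K^+(z),\qquad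 K^\pm(z)K^\pm(w)=K^\pm(w)K^\pm(z),$$ $$[e(z),f(w)]=\tfrac1{q-q^{-1}}\bigl(\delta(z/q^cw)K^+(zq^{-c/2})-\delta(zq^c/w)K^-(wq^{-c/2})\bigr),\qquad \delta(x)=\sum_{k\in\mathbb Z}x^k .$$ Let $V$ and $W$ be representations in the category of highest weight representations: each is the sum of its weight spaces (joint eigenspaces of $k$ and $d$), and its weights lie in finitely many cones $\lambda-\mathbb N\alpha_0-\mathbb N\alpha_1$, where $\alpha_1$ multiplies the eigenvalue of $k$ by $q^2$ and fixes that of $d$, and $\alpha_0$ multiplies the eigenvalue of $k$ by $q^{-2}$ and raises that of $d$ by $1$. On $V\otimes W$ the ordered infinite product (the factor with the smaller $n$ to the left) $$\overline{\mathcal R}=\overrightarrow{\prod_{n\in\mathbb Z}}\exp_{q^2}\bigl(-(q-q^{-1})f_{-n}\otimes e_n\bigr),\qquad \exp_p(x)=\sum_{m\ge0}\frac{x^m}{(m)_p!},\quad (m)_p!=\prod_{j=1}^m(1+p+\dots+p^{j-1}),$$ is well defined (on each vector the exponential series are finite and the partial products over $a\le n\le b$ are eventually constant as $a\to-\infty$,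 $b\to\infty$), and it is equal to the ordered $q$-exponential integral $$\overline{\mathcal R}=1+\sum_{n>0}\frac{(q^{-1}-q)^n}{n!\,(2\pi i)^n}\oint_{C_n}\frac{dz_n}{z_n}\oint_{C_{n-1}}\frac{dz_{n-1}}{z_{n-1}}\cdots\oint_{C_1}\frac{dz_1}{z_1}\;f(z_1)f(z_2)\cdots f(z_n)\otimes e(z_1)e(z_2)\cdots e(z_n),$$ where the sum is finite on each vector. The integrals are taken in matrix coefficients: for $v\in V$, $w\in W$ and functionals $\varphi\in V^*$, $\psi\in W^*$ that vanish on all but finitely many weight spaces, the Laurent series $\langle\varphi\otimes\psi,\,f(z_1)\cdots f(z_n)v\otimes e(z_1)\cdots e(z_n)w\rangle$ converges for $|z_1|\gg|z_2|\gg\dots\gg|z_n|>0$ and continues analytically to $\{z\in(\mathbb C^*)^n: z_i\ne q^{2}z_j\ (i\neq j)\}$, and this continuation is integrated. The contours $C_1,\dots,C_n$ are nested: $C_i$ is a cycle (an integer combination of closed $C^1$ curves) that may depend on the outer variables $z_j\in C_j$, $j>i$. It encloses the origin (winding number $1$), and for every $j>i$ the points $z_i=q^{2}z_j$ are outside $C_i$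 (winding number $0$) and the points $z_i=q^{-2}z_j$ are inside $C_i$ (winding number $1$); the further points $z_i=q^{2m}z_j$ and $z_i=q^{-2m}z_j$ with $2\le m\le 2^{i-1}$, where the inner integrals may have poles, are likewise outside and inside $C_i$, respectively. Such contours exist for every $n$, and the equality holds for every choice of them. (If $|q|>1$, circles in the region $|q^{-2}z_j|<|z_i|<|q^2z_j|$, $i\ne j$, are such contours.) -/

import Mathlib

open scoped TensorProduct

noncomputable section

namespace QuantumAffine

/-! ### The algebra in the current realization -/

/-- Generators: the modes `e k`, `f k` of `e(z) = ∑ e_k z^{-k}`, `f(z) = ∑ f_k z^{-k}`, the modes of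
`K⁺(z) = ∑_{n ≥ 0} K⁺_n z^{-n}` and `K⁻(z) = ∑_{n ≥ 0} K⁻_n z^n`, the element `c = q^{c/2}` with
its inverse, and the grading element `d`. -/
inductive Gen : Type
  | e (k : ℤ)
  | f (k : ℤ)
  | Kplus (n : ℕ)
  | Kminus (n : ℕ)
  | c
  | cInv
  | d

abbrev Free : Type := FreeAlgebra ℂ Gen

namespace Free

def e (k : ℤ) : Free := FreeAlgebra.ι ℂ (Gen.e k)
def f (k : ℤ) : Free := FreeAlgebra.ι ℂ (Gen.f k)
def c : Free := FreeAlgebra.ι ℂ Gen.c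
def cInv : Free := FreeAlgebra.ι ℂ Gen.cInv
def d : Free := FreeAlgebra.ι ℂ Gen.d

/-- The coefficient of `z^{-a}` in `K⁺(z)`. -/
def kp (a : ℤ) : Free := if 0 ≤ a then FreeAlgebra.ι ℂ (Gen.Kplus a.toNat) else 0

/-- The coefficient of `z^{-a}` in `K⁻(z)`. -/
def km (a : ℤ) : Free := if a ≤ 0 then FreeAlgebra.ι ℂ (Gen.Kminus (-a).toNat) else 0

/-- `q^{a c / 2}`. -/
def cPow (a : ℤ) : Free := if 0 ≤ a then c ^ a.toNat else cInv ^ (-a).toNat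

end Free

open Free in
/-- The defining relations of `U_q(ŝl₂)`, written for the coefficients of `z^{-a} w^{-b}` after
clearing denominators. -/
inductive Rel (q : ℂ) : Free → Free → Prop
  /- `q^{c/2}` is invertible and central -/
  | c_inv : Rel q (c * cInv) 1
  | inv_c : Rel q (cInv * c) 1
  | c_central (g : Gen) : Rel q (c * FreeAlgebra.ι ℂ g) (FreeAlgebra.ι ℂ g * c)
  /- the leading coefficients `k`, `k⁻¹` of `K⁺`, `K⁻` are inverse to each other -/
  | k_inv : Rel q (kp 0 * km 0) 1
  | inv_k : Rel q (km 0 * kp 0) 1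
  /- `d` is the operator `-z d/dz` -/
  | d_e (a : ℤ) : Rel q (d * e a - e a * d) ((a : ℂ) • e a)
  | d_f (a : ℤ) : Rel q (d * f a - f a * d) ((a : ℂ) • f a)
  | d_kp (a : ℤ) : Rel q (d * kp a - kp a * d) ((a : ℂ) • kp a)
  | d_km (a : ℤ) : Rel q (d * km a - km a * d) ((a : ℂ) • km a)
  /- `(z - q²w) e(z) e(w) = (q²z - w) e(w) e(z)` -/
  | e_e (a b : ℤ) : Rel q (e (a + 1) * e b - q ^ 2 • (e a * e (b + 1)))
      (q ^ 2 • (e b * e (a + 1)) - e (b + 1) * e a)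
  /- `(z - q⁻²w) f(z) f(w) = (q⁻²z - w) f(w) f(z)` -/
  | f_f (a b : ℤ) : Rel q (f (a + 1) * f b - (q ^ 2)⁻¹ • (f a * f (b + 1)))
      ((q ^ 2)⁻¹ • (f b * f (a + 1)) - f (b + 1) * f a)
  /- `(q^{c/2}z - q²w) K⁺(z) e(w) = (q^{2+c/2}z - w) e(w) K⁺(z)` -/
  | kp_e (a b : ℤ) : Rel q (c * (kp (a + 1) * e b) - q ^ 2 • (kp a * e (b + 1)))
      (q ^ 2 • (c * (e b * kp (a + 1))) - e (b + 1) * kp a)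
  /- `(q^{-c/2}z - q²w) K⁻(z) e(w) = (q^{2-c/2}z - w) e(w) K⁻(z)` -/
  | km_e (a b : ℤ) : Rel q (cInv * (km (a + 1) * e b) - q ^ 2 • (km a * e (b + 1)))
      (q ^ 2 • (cInv * (e b * km (a + 1))) - e (b + 1) * km a)
  /- `(q^{-c/2}z - q⁻²w) K⁺(z) f(w) = (q^{-2-c/2}z - w) f(w) K⁺(z)` -/
  | kp_f (a b : ℤ) : Rel q (cInv * (kp (a + 1) * f b) - (q ^ 2)⁻¹ • (kp a * f (b + 1)))
      ((q ^ 2)⁻¹ • (cInv * (f b * kp (a + 1))) - f (b + 1) * kp a)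
  /- `(q^{c/2}z - q⁻²w) K⁻(z) f(w) = (q^{-2+c/2}z - w) f(w) K⁻(z)` -/
  | km_f (a b : ℤ) : Rel q (c * (km (a + 1) * f b) - (q ^ 2)⁻¹ • (km a * f (b + 1)))
      ((q ^ 2)⁻¹ • (c * (f b * km (a + 1))) - f (b + 1) * km a)
  /- `(z - q^{2-c}w)(z - q^{-2+c}w) K⁺(z) K⁻(w) = (q^{2+c}z - w)(q^{-2-c}z - w) K⁻(w) K⁺(z)` -/
  | kp_km (a b : ℤ) : Rel q
      (kp (a + 2) * km b
        - (q ^ 2 • cPow (-2) + (q ^ 2)⁻¹ • cPow 2) * (kp (a + 1) * km (b + 1))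
        + kp a * km (b + 2))
      (km b * kp (a + 2)
        - (q ^ 2 • cPow 2 + (q ^ 2)⁻¹ • cPow (-2)) * (km (b + 1) * kp (a + 1))
        + km (b + 2) * kp a)
  | kp_kp (a b : ℤ) : Rel q (kp a * kp b) (kp b * kp a)
  | km_km (a b : ℤ) : Rel q (km a * km b) (km b * km a)
  /- `[e(z), f(w)] = (q - q⁻¹)⁻¹ (δ(z/q^c w) K⁺(zq^{-c/2}) - δ(zq^c/w) K⁻(wq^{-c/2}))` -/
  | e_f (a b : ℤ) : Rel q (e a * f b - f b * e a)
      ((q - q⁻¹)⁻¹ • (cPow (a - b) * kp (a + b) - cPow (b - a) * km (a + b)))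

/-- The algebra `U_q(ŝl₂)` in its current realization. -/
abbrev Uq (q : ℂ) : Type := RingQuot (Rel q)

def toUq (q : ℂ) : Free →ₐ[ℂ] Uq q := RingQuot.mkAlgHom ℂ (Rel q)

def e (q : ℂ) (k : ℤ) : Uq q := toUq q (Free.e k)
def f (q : ℂ) (k : ℤ) : Uq q := toUq q (Free.f k)
def k (q : ℂ) : Uq q := toUq q (Free.kp 0)
def d (q : ℂ) : Uq q := toUq q Free.d

/-! ### Highest weight representations -/

section Rep

variable {q : ℂ} {V W : Type*} [AddCommGroup V] [Module ℂ V] [AddCommGroup W] [Module ℂ W]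

/-- Joint eigenvectors of `k` and `d`. -/
def weightSpace (ρ : Uq q →ₐ[ℂ] Module.End ℂ V) (μ : ℂ × ℂ) : Submodule ℂ V :=
  Module.End.eigenspace (ρ (k q)) μ.1 ⊓ Module.End.eigenspace (ρ (d q)) μ.2

/-- The category of highest weight representations: `V` is the sum of its weight spaces, and
all weights lie in finitely many cones `λ - ℕ α₀ - ℕ α₁`. On `(k, d)`-eigenvalues the simple root
`α₁` acts as `(q², 0)` and `α₀ = δ - α₁` as `(q⁻², 1)`. -/
def IsHighestWeight (ρ : Uq q →ₐ[ℂ] Module.End ℂ V) : Prop :=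
  (⨆ μ, weightSpace ρ μ = ⊤) ∧
  ∃ S : Finset (ℂ × ℂ), ∀ μ, weightSpace ρ μ ≠ ⊥ →
    ∃ l ∈ S, ∃ a b : ℕ, μ = (q ^ (2 * ((a : ℤ) - (b : ℤ))) * l.1, l.2 - (a : ℂ))

/-- Functionals in the restricted dual: those living on finitely many weight spaces. -/
def IsRestricted (ρ : Uq q →ₐ[ℂ] Module.End ℂ V) (φ : Module.Dual ℂ V) : Prop :=
  ∃ S : Finset (ℂ × ℂ), ∀ μ ∉ S, ∀ v ∈ weightSpace ρ μ, φ v = 0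

/-! ### The infinite product -/

/-- `(n)_p! = ∏_{j=1}^n (1 + p + ⋯ + p^{j-1})`. -/
def qFactorial (p : ℂ) (n : ℕ) : ℂ :=
  ∏ j ∈ Finset.range n, ∑ i ∈ Finset.range (j + 1), p ^ i

/-- `E = exp_p(X) = ∑_n Xⁿ / (n)_p!`, where the series is finite on every vector. -/
def IsQExp (p : ℂ) (X E : Module.End ℂ V) : Prop :=
  ∀ u, ∀ᶠ N in Filter.atTop, ∑ n ∈ Finset.range N, (qFactorial p n)⁻¹ • (X ^ n) u = E u

/-- `E_a E_{a+1} ⋯ E_b` (the factor `E_b` acts first). -/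
def orderedProd (E : ℤ → Module.End ℂ V) (a b : ℤ) : Module.End ℂ V :=
  ((List.range (b + 1 - a).toNat).map fun i => E (a + (i : ℤ))).prod

/-- `R = ∏_{n ∈ ℤ} exp_{q²}(-(q - q⁻¹) f_{-n} ⊗ e_n)` on `V ⊗ W`, with `n` increasing from left to
right; on every vector the finite partial products are eventually constant. -/
def IsRbar (ρ : Uq q →ₐ[ℂ] Module.End ℂ V) (σ : Uq q →ₐ[ℂ] Module.End ℂ W)
    (R : Module.End ℂ (V ⊗[ℂ] W)) : Prop :=
  ∃ E : ℤ → Module.End ℂ (V ⊗[ℂ] W),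
    (∀ n, IsQExp (q ^ 2) (-(q - q⁻¹) • TensorProduct.map (ρ (f q (-n))) (σ (e q n))) (E n)) ∧
    ∀ u, ∀ᶠ ab : ℤ × ℤ in Filter.atBot ×ˢ Filter.atTop, orderedProd E ab.1 ab.2 u = R u

/-! ### Matrix coefficients of products of currents and their analytic continuation -/

/-- The matrix coefficient `⟨φ ⊗ ψ, f(z₁)⋯f(zₙ) v ⊗ e(z₁)⋯e(zₙ) w⟩` as a Laurent series; the term
with the modes `f_{a₁}⋯f_{aₙ} ⊗ e_{b₁}⋯e_{bₙ}`. -/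
def currentTerm (ρ : Uq q →ₐ[ℂ] Module.End ℂ V) (σ : Uq q →ₐ[ℂ] Module.End ℂ W)
    (φ : Module.Dual ℂ V) (ψ : Module.Dual ℂ W) (v : V) (w : W) {n : ℕ} (z : Fin n → ℂ)
    (ab : (Fin n → ℤ) × (Fin n → ℤ)) : ℂ :=
  φ ((List.ofFn fun i => ρ (f q (ab.1 i))).prod v) *
    ψ ((List.ofFn fun i => σ (e q (ab.2 i))).prod w) * ∏ i, z i ^ (-ab.1 i - ab.2 i)

/-- `(ℂ*)ⁿ` without the shifted diagonals `z_i = q^{±2} z_j`. -/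
def polesComplement (q : ℂ) (n : ℕ) : Set (Fin n → ℂ) :=
  {z | (∀ i, z i ≠ 0) ∧ ∀ i j, i ≠ j → z i ≠ q ^ 2 * z j}

/-- `G` is the analytic continuation of `⟨φ ⊗ ψ, f(z₁)⋯f(zₙ) v ⊗ e(z₁)⋯e(zₙ) w⟩` from the region
`|z₁| ≫ |z₂| ≫ ⋯ ≫ |zₙ| > 0`. -/
def IsContinuation (ρ : Uq q →ₐ[ℂ] Module.End ℂ V) (σ : Uq q →ₐ[ℂ] Module.End ℂ W)
    (φ : Module.Dual ℂ V) (ψ : Module.Dual ℂ W) (v : V) (w : W) (n : ℕ)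
    (G : (Fin n → ℂ) → ℂ) : Prop :=
  AnalyticOnNhd ℂ G (polesComplement q n) ∧
  ∃ r : ℝ, 0 < r ∧ ∀ z : Fin n → ℂ, (∀ i, z i ≠ 0) → (∀ i j, i < j → r * ‖z j‖ < ‖z i‖) →
    HasSum (currentTerm ρ σ φ ψ v w z) (G z)

end Rep

/-! ### Contours -/

/-- A closed continuously differentiable curve, parametrized by `[0, 1]`. -/
structure ClosedCurve where
  toFun : ℝ → ℂ
  contDiff : ContDiff ℝ 1 toFun
  closed : toFun 0 = toFun 1

/-- Contours are 1-cycles: integer combinations of closed curves. -/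
abbrev Contour : Type := ClosedCurve →₀ ℤ

namespace Contour

def support (C : Contour) : Set ℂ :=
  {z | ∃ γ ∈ Finsupp.support C, ∃ t ∈ Set.Icc (0 : ℝ) 1, γ.toFun t = z}

def integral (C : Contour) (F : ℂ → ℂ) : ℂ :=
  C.sum fun γ m => (m : ℂ) * ∫ t in (0 : ℝ)..1, F (γ.toFun t) * deriv γ.toFun t

/-- The winding number around a point off the contour. -/
def winding (C : Contour) (p : ℂ) : ℂ :=
  (2 * (Real.pi : ℂ) * Complex.I)⁻¹ * integral C fun z => (z - p)⁻¹

/-- `p` lies inside the contour. -/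
def Inside (C : Contour) (p : ℂ) : Prop := p ∉ support C ∧ winding C p = 1

/-- `p` lies outside the contour. -/
def Outside (C : Contour) (p : ℂ) : Prop := p ∉ support C ∧ winding C p = 0

end Contour

/-- Nested contours `C_1, …, C_n` (indexed by `Fin n`), where `C_i` may depend on the variables
`z_j` with `j > i`. -/
abbrev ContourSystem (n : ℕ) : Type := (i : Fin n) → ({j : Fin n // i < j} → ℂ) → Contour

namespace ContourSystem

variable {n : ℕ}

/-- The contour for `z_i` at the point `z` (only the coordinates `j > i` matter). -/
def at' (C : ContourSystem n) (i : Fin n) (z : Fin n → ℂ) : Contour := C i fun j => z j.1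

/-- For all outer variables on their contours, `C_i` encloses the origin and the points `q^{-2} z_j`,
and leaves the points `q² z_j` outside (`j > i`). The integral over the inner variables can have
further poles in `z_i`, where poles on the two sides of an inner contour meet; they are among
`q^{±2m} z_j` with `m ≤ 2^i` (counting `i` from `0`), and have to be on the same side
as `q^{±2} z_j`. -/
def Admissible (q : ℂ) (C : ContourSystem n) : Prop :=
  ∀ (i : Fin n) (z : Fin n → ℂ), (∀ j, i < j → z j ∈ (C.at' j z).support) →
    (C.at' i z).Inside 0 ∧
    ∀ j, i < j → ∀ m : ℕ, 1 ≤ m → m ≤ 2 ^ (i : ℕ) →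
      (C.at' i z).Inside ((q ^ (2 * m))⁻¹ * z j) ∧ (C.at' i z).Outside (q ^ (2 * m) * z j)

/-- The integral over the first `m` variables, the first one innermost:
`∮_{C_m} dz_m/z_m ⋯ ∮_{C_1} dz_1/z_1 G(z)`. -/
def partialIntegral (C : ContourSystem n) (G : (Fin n → ℂ) → ℂ) : ℕ → (Fin n → ℂ) → ℂ
  | 0, z => G z
  | m + 1, z =>
    if h : m < n then
      (C.at' ⟨m, h⟩ z).integral fun ζ =>
        partialIntegral C G m (Function.update z ⟨m, h⟩ ζ) * ζ⁻¹
    else partialIntegral C G m z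

/-- `∮_{C_n} dz_n/z_n ⋯ ∮_{C_1} dz_1/z_1 G(z_1, …, z_n)`. -/
def nestedIntegral (C : ContourSystem n) (G : (Fin n → ℂ) → ℂ) : ℂ :=
  C.partialIntegral G n 0

end ContourSystem

/-! ### The ordered exponential integral -/

section OrderedExp

variable {q : ℂ} {V W : Type*} [AddCommGroup V] [Module ℂ V] [AddCommGroup W] [Module ℂ W]

/-- `T = ∮_{C_n} dz_n/z_n ⋯ ∮_{C_1} dz_1/z_1 f(z_1)⋯f(z_n) ⊗ e(z_1)⋯e(z_n)` as an operator on `V ⊗ W`: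
admissible contours exist, the matrix coefficients of the integrand can be continued analytically,
and their integrals over any admissible contours are the matrix coefficients of `T`. -/
def IsCurrentIntegral (ρ : Uq q →ₐ[ℂ] Module.End ℂ V) (σ : Uq q →ₐ[ℂ] Module.End ℂ W)
    (n : ℕ) (T : Module.End ℂ (V ⊗[ℂ] W)) : Prop :=
  (∃ C : ContourSystem n, C.Admissible q) ∧
  ∀ (φ : Module.Dual ℂ V) (ψ : Module.Dual ℂ W), IsRestricted ρ φ → IsRestricted σ ψ →
    ∀ (v : V) (w : W),
      (∃ G, IsContinuation ρ σ φ ψ v w n G) ∧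
      ∀ G, IsContinuation ρ σ φ ψ v w n G → ∀ C : ContourSystem n, C.Admissible q →
        C.nestedIntegral G = TensorProduct.dualDistrib ℂ V W (φ ⊗ₜ ψ) (T (v ⊗ₜ w))

/-- `R = 1 + ∑_{n > 0} (q⁻¹ - q)ⁿ / (n! (2πi)ⁿ) ∮⋯∮ f(z_1)⋯f(z_n) ⊗ e(z_1)⋯e(z_n) ∏ dz_i/z_i` on `V ⊗ W`,
where the series is finite on every vector. -/
def IsOrderedExpIntegral (ρ : Uq q →ₐ[ℂ] Module.End ℂ V) (σ : Uq q →ₐ[ℂ] Module.End ℂ W)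
    (R : Module.End ℂ (V ⊗[ℂ] W)) : Prop :=
  ∃ T : ℕ → Module.End ℂ (V ⊗[ℂ] W), (∀ n, 0 < n → IsCurrentIntegral ρ σ n (T n)) ∧
    ∀ u, ∀ᶠ N in Filter.atTop,
      u + ∑ n ∈ Finset.Icc 1 N,
        ((q⁻¹ - q) ^ n / ((n.factorial : ℂ) * (2 * (Real.pi : ℂ) * Complex.I) ^ n)) • T n u = R u

end OrderedExp

end QuantumAffine

end

/-! Expanding the ordered product of q-exponentials gives a sum over finite multisets of modes. Its
part of degree n is the sum over weakly increasing m of f_{-m_1}⋯f_{-m_n} ⊗ e_{m_1}⋯e_{m_n}, divided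
by the product of the q²-factorials of the multiplicities in m (`orderedProd_expOf_apply`,
`degreePart_apply`). The point is that the n-fold integral equals (2πi)^n n! times this sum
(`isCurrentIntegral_degreePart`).

Fix a matrix coefficient. By the exchange relations and the weight bounds, the generating series of
the words in f is F / ∏_{i<j} (z_i - q⁻² z_j), and that of the words in e is H / ∏_{i<j} (z_i - q²
z_j), with antisymmetric Laurent polynomials F and H (`exists_antisymm_of_words`). So the
continuation is a rational function, and the product of its two denominators is symmetric
(`isContinuation_quotFun`, `IsContinuation.eqOn`, `vand_mul_vand_comp`).

H is a combination of the Hall–Littlewood type antisymmetrizations `hl` of z^{-m} ∏_{i<j} (z_i - q²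
z_j) with m weakly increasing. Divided by ∏_{i<j} (z_i - q² z_j) and expanded for |z_1| ≫ ⋯ ≫ |z_n|,
such a polynomial has exactly one weakly increasing exponent that can occur, namely m. Its
coefficient is ∑ q^{2 inv(w)} over the stabilizer of m, which is the product of the q²-factorials
above (`coeff_hl_div_vand`, `kappa_eq`). Hence the coefficient of `hl` at m in H is the matrix
coefficient of the word e_{m_1}⋯e_{m_n} divided by that product (`LPoly.IsAntisymm.eq_sum_hl`).

After multiplication by F the antisymmetrization becomes the sum over all permutations of the
variables of F z^{-m} / ∏_{i<j} (z_i - q⁻² z_j) (`ev_mul_ev_hl`). The contours treat these summands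
alike: the pole z_i = q⁻² z_j is inside if z_i is integrated first, and the same pole, read as z_j =
q² z_i, is outside if z_j is integrated first. Either way the result is that of the expansion for
|z_i| ≫ |z_j|, so each summand integrates to (2πi)^n times the constant coefficient of its expansion
in its own order of the variables (`Term.nestedIntegral_permSum`). That constant coefficient is the
matrix coefficient of f_{-m_1}⋯f_{-m_n}, the same for all n! permutations. -/

noncomputable section

namespace QuantumAffine

/-! ### Laurent series expanded in `|z₁| ≫ |z₂| ≫ ⋯ ≫ |zₙ|` -/

/-- Series in `z₁, …, zₙ`, expanded for `|z₁| ≫ |z₂| ≫ ⋯ ≫ |zₙ|`; the index `a` stands for the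
monomial `∏ z_i ^ (-a_i)`. -/
abbrev Ser (n : ℕ) : Type := HahnSeries (Lex (Fin n → ℤ)) ℂ

/-- Laurent polynomials; the index `a` stands for the monomial `∏ z_i ^ (-a_i)`. -/
abbrev LPoly (n : ℕ) : Type := AddMonoidAlgebra ℂ (Fin n → ℤ)

variable {n : ℕ}

/-- The monomial `∏ z_i ^ (-a_i)`. -/
def Ser.mono (a : Fin n → ℤ) : Ser n := HahnSeries.single (toLex a) 1

/-- The variable `z_i`. -/
def Ser.Z (i : Fin n) : Ser n := Ser.mono (-Pi.single i 1)

theorem Ser.mono_mul (a b : Fin n → ℤ) : Ser.mono a * Ser.mono b = Ser.mono (a + b) := by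
  simp [Ser.mono, HahnSeries.single_mul_single]

theorem Ser.mono_zero : Ser.mono (0 : Fin n → ℤ) = 1 := rfl

theorem Ser.mono_ne_zero (a : Fin n → ℤ) : Ser.mono a ≠ 0 :=
  HahnSeries.single_ne_zero one_ne_zero

theorem Ser.mono_inv (a : Fin n → ℤ) : (Ser.mono a)⁻¹ = Ser.mono (-a) := by
  refine inv_eq_of_mul_eq_one_left ?_
  rw [Ser.mono_mul, neg_add_cancel, Ser.mono_zero]

theorem Ser.mono_zpow (a : Fin n → ℤ) (k : ℤ) : Ser.mono a ^ k = Ser.mono (k • a) := by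
  have hnat : ∀ m : ℕ, Ser.mono a ^ m = Ser.mono ((m : ℤ) • a) := by
    intro m
    induction m with
    | zero => simp [Ser.mono_zero]
    | succ m ih => rw [pow_succ, ih, Ser.mono_mul]; congr 1; push_cast; rw [add_smul, one_smul]
  obtain ⟨m, rfl | rfl⟩ := k.eq_nat_or_neg
  · rw [zpow_natCast, hnat]
  · rw [zpow_neg, zpow_natCast, hnat, Ser.mono_inv, neg_smul]

theorem Ser.coeff_mono_mul (a b : Fin n → ℤ) (x : Ser n) :
    (Ser.mono a * x).coeff (toLex b) = x.coeff (toLex (b - a)) := by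
  rw [Ser.mono, HahnSeries.coeff_single_mul, one_mul]; rfl

theorem Ser.coeff_mono (a b : Fin n → ℤ) :
    (Ser.mono a).coeff (toLex b) = if b = a then 1 else 0 := by
  rw [Ser.mono, HahnSeries.coeff_single]; simp

theorem Ser.coeff_C_mul (c : ℂ) (x : Ser n) (a : Lex (Fin n → ℤ)) :
    (algebraMap ℂ (Ser n) c * x).coeff a = c * x.coeff a := by
  rw [HahnSeries.algebraMap_apply, HahnSeries.C_mul_eq_smul, HahnSeries.coeff_smul]; simp

theorem Ser.Z_ne_zero (i : Fin n) : Ser.Z i ≠ 0 := Ser.mono_ne_zero _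

theorem Ser.coeff_Z_mul (i : Fin n) (x : Ser n) (a : Fin n → ℤ) :
    (Ser.Z i * x).coeff (toLex a) = x.coeff (toLex (a + Pi.single i 1)) := by
  rw [Ser.Z, Ser.coeff_mono_mul, sub_neg_eq_add]

/-! ### Evaluation of Laurent polynomials and the action of permutations -/

section Eval

variable {K : Type*} [Field K]

/-- The monomial `∏ z_i ^ (-a_i)` at a point of a field extension. -/
def monoAt (z : Fin n → K) (a : Fin n → ℤ) : K := ∏ i, z i ^ (-a i)

theorem monoAt_zero (z : Fin n → K) : monoAt z 0 = 1 := by simp [monoAt]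

theorem monoAt_add {z : Fin n → K} (hz : ∀ i, z i ≠ 0) (a b : Fin n → ℤ) :
    monoAt z (a + b) = monoAt z a * monoAt z b := by
  rw [monoAt, monoAt, monoAt, ← Finset.prod_mul_distrib]
  refine Finset.prod_congr rfl fun i _ => ?_
  rw [← zpow_add₀ (hz i)]; congr 1; simp; ring

theorem monoAt_comp_perm (z : Fin n → K) (w : Equiv.Perm (Fin n)) (a : Fin n → ℤ) :
    monoAt (z ∘ w) a = monoAt z (a ∘ w.symm) := by
  rw [monoAt, monoAt, ← Equiv.prod_comp w (fun i => z i ^ (-(a ∘ w.symm) i))]; simp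

variable [Algebra ℂ K]

/-- Evaluation of a Laurent polynomial at a point with nonzero coordinates. -/
def ev (z : Fin n → K) (hz : ∀ i, z i ≠ 0) : LPoly n →ₐ[ℂ] K :=
  AddMonoidAlgebra.lift ℂ K (Fin n → ℤ)
    { toFun := fun a => monoAt z a.toAdd
      map_one' := monoAt_zero z
      map_mul' := fun a b => monoAt_add hz a.toAdd b.toAdd }

theorem ev_single (z : Fin n → K) (hz : ∀ i, z i ≠ 0) (a : Fin n → ℤ) (c : ℂ) :
    ev z hz (AddMonoidAlgebra.single a c) = algebraMap ℂ K c * monoAt z a := by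
  simp [ev, AddMonoidAlgebra.lift_single, Algebra.smul_def]

theorem ev_smul (z : Fin n → K) (hz : ∀ i, z i ≠ 0) (c : ℂ) (P : LPoly n) :
    ev z hz (c • P) = algebraMap ℂ K c * ev z hz P := by
  rw [map_smul, Algebra.smul_def]

theorem ev_eq_sum (z : Fin n → K) (hz : ∀ i, z i ≠ 0) (P : LPoly n) :
    ev z hz P = P.coeff.sum fun a c => algebraMap ℂ K c * monoAt z a := by
  conv_lhs => rw [← AddMonoidAlgebra.sum_coeff_single P]
  rw [Finsupp.sum, map_sum]; simp only [ev_single]; rfl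

/-- The action of permutations on Laurent polynomials. -/
def LPoly.perm (w : Equiv.Perm (Fin n)) : LPoly n ≃ₐ[ℂ] LPoly n :=
  AddMonoidAlgebra.domCongr ℂ ℂ
    { toFun := fun a => a ∘ w.symm
      invFun := fun a => a ∘ w
      left_inv := fun a => by ext; simp
      right_inv := fun a => by ext; simp
      map_add' := fun a b => rfl }

theorem LPoly.perm_single (w : Equiv.Perm (Fin n)) (a : Fin n → ℤ) (c : ℂ) :
    LPoly.perm w (AddMonoidAlgebra.single a c) = AddMonoidAlgebra.single (a ∘ w.symm) c := by
  simp [LPoly.perm, AddMonoidAlgebra.domCongr_single]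

theorem LPoly.coeff_perm (w : Equiv.Perm (Fin n)) (P : LPoly n) (a : Fin n → ℤ) :
    (LPoly.perm w P).coeff a = P.coeff (a ∘ w) := by
  induction P using AddMonoidAlgebra.induction_linear with
  | zero => simp
  | add f g hf hg => simp [hf, hg]
  | single b c =>
    rw [LPoly.perm_single]
    simp only [AddMonoidAlgebra.coeff_single, Finsupp.single_apply]
    refine if_congr ⟨?_, ?_⟩ rfl rfl
    · rintro rfl; ext; simp
    · rintro rfl; ext; simp

theorem ev_perm (z : Fin n → K) (hz : ∀ i, z i ≠ 0) (w : Equiv.Perm (Fin n)) (P : LPoly n) :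
    ev z hz (LPoly.perm w P) = ev (z ∘ w) (fun _ => hz _) P := by
  induction P using AddMonoidAlgebra.induction_linear with
  | zero => simp
  | add f g hf hg => simp [hf, hg]
  | single b c => rw [LPoly.perm_single, ev_single, ev_single, monoAt_comp_perm]

/-- The pairs `i < j`. -/
def pairs (n : ℕ) : Finset (Fin n × Fin n) := Finset.univ.filter fun ij => ij.1 < ij.2

theorem mem_pairs {ij : Fin n × Fin n} : ij ∈ pairs n ↔ ij.1 < ij.2 := by simp [pairs]

/-- `∏_{i < j} (z_i - p z_j)`. -/
def vand (p : ℂ) (z : Fin n → K) : K := ∏ ij ∈ pairs n, (z ij.1 - algebraMap ℂ K p * z ij.2)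

/-- `∏_{i < j} (z_i - p z_j)` as a Laurent polynomial. -/
def vandPoly (p : ℂ) : LPoly n :=
  ∏ ij ∈ pairs n, (AddMonoidAlgebra.single (-Pi.single ij.1 1) 1
    - p • AddMonoidAlgebra.single (-Pi.single ij.2 1) 1)

theorem monoAt_neg_single {K : Type*} [Field K] (z : Fin n → K) (i : Fin n) :
    monoAt z (-Pi.single i 1) = z i := by
  rw [monoAt, Finset.prod_eq_single i]
  · simp
  · intro j _ hj; simp [Pi.single_eq_of_ne hj]
  · simp

theorem ev_vand (p : ℂ) (z : Fin n → K) (hz : ∀ i, z i ≠ 0) :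
    ev z hz (vandPoly p) = vand p z := by
  rw [vandPoly, map_prod, vand]
  refine Finset.prod_congr rfl fun ij _ => ?_
  rw [map_sub, map_smul, ev_single, ev_single, map_one, one_mul, one_mul, monoAt_neg_single,
    monoAt_neg_single, Algebra.smul_def]

end Eval

theorem Ser.monoAt_Z (a : Fin n → ℤ) : monoAt (Ser.Z (n := n)) a = Ser.mono a := by
  have h : ∀ s : Finset (Fin n), ∏ i ∈ s, (Ser.Z i) ^ (-a i)
      = Ser.mono (∑ i ∈ s, Pi.single i (a i)) := by
    intro s
    induction s using Finset.induction_on with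
    | empty => simp [Ser.mono_zero]
    | insert i s hi ih =>
      rw [Finset.prod_insert hi, Finset.sum_insert hi, ih, Ser.Z, Ser.mono_zpow, Ser.mono_mul]
      congr 2; ext j; by_cases hj : j = i
      · subst hj; simp
      · simp [Pi.single_eq_of_ne hj]
  rw [monoAt, h, Finset.univ_sum_single]

/-- A Laurent polynomial as a series. -/
abbrev LPoly.ser (P : LPoly n) : Ser n := ev Ser.Z Ser.Z_ne_zero P

theorem LPoly.coeff_ser (P : LPoly n) (a : Fin n → ℤ) :
    P.ser.coeff (toLex a) = P.coeff a := by
  induction P using AddMonoidAlgebra.induction_linear with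
  | zero => simp
  | add f g hf hg =>
    rw [LPoly.ser, map_add, HahnSeries.coeff_add, hf, hg]; simp
  | single b c =>
    rw [LPoly.ser, ev_single, Ser.monoAt_Z, Ser.coeff_C_mul, Ser.coeff_mono]
    simp [Finsupp.single_apply, eq_comm]

theorem LPoly.ser_injective : Function.Injective (LPoly.ser (n := n)) := by
  intro P Q h
  refine AddMonoidAlgebra.coeff_injective (Finsupp.ext fun a => ?_)
  rw [← LPoly.coeff_ser, ← LPoly.coeff_ser, h]

/-! ### The geometric series -/

/-- This is where the region |z_i| ≫ |z_j| enters: in the lexicographic order the exponent of z_j /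
z_i is positive, so power series in z_j / z_i are Hahn series. -/
theorem lex_pos_of_lt {i j : Fin n} (h : i < j) :
    (0 : Lex (Fin n → ℤ)) < toLex (Pi.single i 1 - Pi.single j 1) := by
  refine ⟨i, fun k hk => ?_, ?_⟩
  · have h1 : k ≠ i := hk.ne
    have h2 : k ≠ j := (hk.trans h).ne
    change (0 : ℤ) = (Pi.single i 1 - Pi.single j 1 : Fin n → ℤ) k
    simp [Pi.single_eq_of_ne h1, Pi.single_eq_of_ne h2]
  · change (0 : ℤ) < (Pi.single i 1 - Pi.single j 1 : Fin n → ℤ) i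
    simp [Pi.single_eq_of_ne h.ne]

theorem lex_smul_le_iff {g : Lex (Fin n → ℤ)} (hg : 0 < g) (k l : ℕ) :
    k • g ≤ l • g ↔ k ≤ l := by
  constructor
  · intro h; by_contra! hlt
    exact absurd (nsmul_lt_nsmul_left hg hlt) (not_lt.mpr h)
  · intro h; exact nsmul_le_nsmul_left hg.le h

/-- The order embedding `k ↦ k (e_i - e_j)`. -/
def rootEmb (i j : Fin n) (h : i < j) : ℕ ↪o Lex (Fin n → ℤ) :=
  OrderEmbedding.ofMapLEIff (fun k => k • toLex (Pi.single i 1 - Pi.single j 1))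
    (fun k l => lex_smul_le_iff (lex_pos_of_lt h) k l)

/-- The ring homomorphism that substitutes `z_j / z_i` in a power series, `i < j`. -/
def rootHom (i j : Fin n) (h : i < j) : PowerSeries ℂ →+* Ser n :=
  (HahnSeries.embDomainRingHom
    (multiplesHom _ (toLex (Pi.single i 1 - Pi.single j 1 : Fin n → ℤ)))
    (fun _ _ hkl => (rootEmb i j h).injective hkl)
    (fun k l => lex_smul_le_iff (lex_pos_of_lt h) k l)).comp
    (HahnSeries.toPowerSeries (R := ℂ)).symm.toRingHom

theorem rootHom_eq (i j : Fin n) (h : i < j) (x : PowerSeries ℂ) :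
    rootHom i j h x = HahnSeries.embDomain (rootEmb i j h) (HahnSeries.toPowerSeries.symm x) := rfl

theorem coeff_rootHom (i j : Fin n) (h : i < j) (x : PowerSeries ℂ) (k : ℕ) :
    (rootHom i j h x).coeff (toLex (k • (Pi.single i 1 - Pi.single j 1))) = x.coeff k := by
  rw [rootHom_eq]
  exact HahnSeries.embDomain_coeff (f := rootEmb i j h) (a := k)

theorem coeff_rootHom_ne_zero (i j : Fin n) (h : i < j) (x : PowerSeries ℂ) {a : Fin n → ℤ}
    (ha : (rootHom i j h x).coeff (toLex a) ≠ 0) :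
    ∃ k : ℕ, a = k • (Pi.single i 1 - Pi.single j 1) := by
  by_contra hne
  refine ha ?_
  rw [rootHom_eq]
  refine HahnSeries.embDomain_of_notMem_range ?_
  rintro ⟨k, hk⟩
  exact hne ⟨k, (toLex.injective hk).symm⟩

theorem rootHom_X (i j : Fin n) (h : i < j) :
    rootHom i j h PowerSeries.X = Ser.mono (Pi.single i 1 - Pi.single j 1) := by
  have : (HahnSeries.toPowerSeries (R := ℂ)).symm PowerSeries.X = HahnSeries.single 1 1 := by
    ext k; simp [PowerSeries.coeff_X, HahnSeries.coeff_single]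
  rw [rootHom_eq, this, HahnSeries.embDomain_single]
  simp [Ser.mono, rootEmb]

theorem rootHom_C (i j : Fin n) (h : i < j) (c : ℂ) :
    rootHom i j h (PowerSeries.C c) = algebraMap ℂ (Ser n) c := by
  have : (HahnSeries.toPowerSeries (R := ℂ)).symm (PowerSeries.C c) = HahnSeries.single 0 c := by
    ext k; simp [PowerSeries.coeff_C, HahnSeries.coeff_single]
  rw [rootHom_eq, this, HahnSeries.embDomain_single]
  simp [rootEmb, HahnSeries.algebraMap_apply, HahnSeries.C_apply]

/-- `∑ c ^ k (z_j / z_i) ^ k`. -/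
def geom (c : ℂ) (i j : Fin n) (h : i < j) : Ser n :=
  rootHom i j h (PowerSeries.mk fun k => c ^ k)

theorem geom_mul (c : ℂ) (i j : Fin n) (h : i < j) :
    geom c i j h * (1 - algebraMap ℂ (Ser n) c * Ser.mono (Pi.single i 1 - Pi.single j 1)) = 1 := by
  have h1 : (PowerSeries.mk fun k => c ^ k) * (1 - PowerSeries.C c * PowerSeries.X) = 1 := by
    ext k
    cases k with
    | zero => simp [mul_sub]
    | succ k =>
      rw [mul_sub, mul_one, mul_comm (PowerSeries.C c), ← mul_assoc, map_sub]
      simp [PowerSeries.coeff_succ_mul_X, PowerSeries.coeff_one, pow_succ]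
  have := congrArg (rootHom i j h) h1
  rw [map_mul, map_sub, map_mul, rootHom_X, rootHom_C, map_one] at this
  exact this

theorem Z_sub_C_Z_eq (c : ℂ) (i j : Fin n) :
    (Ser.Z i - algebraMap ℂ (Ser n) c * Ser.Z j : Ser n)
      = Ser.Z i * (1 - algebraMap ℂ (Ser n) c * Ser.mono (Pi.single i 1 - Pi.single j 1)) := by
  rw [mul_sub, mul_one, mul_left_comm, Ser.Z, Ser.mono_mul, Ser.Z]; congr 3; abel

theorem Z_sub_C_Z_ne_zero (c : ℂ) {i j : Fin n} (h : i < j) :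
    (Ser.Z i - algebraMap ℂ (Ser n) c * Ser.Z j : Ser n) ≠ 0 := by
  rw [Z_sub_C_Z_eq]
  exact mul_ne_zero (Ser.Z_ne_zero i) (right_ne_zero_of_mul (geom_mul c i j h ▸ one_ne_zero))

/-- Inverses in the field `Ser n` are thereby identified with the geometric expansions in |z_i| ≫
|z_j|. Identities of rational functions can be proved by field arithmetic and read off
coefficientwise. -/
theorem inv_Z_sub_C_Z (c : ℂ) {i j : Fin n} (h : i < j) :
    (Ser.Z i - algebraMap ℂ (Ser n) c * Ser.Z j : Ser n)⁻¹ =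
      Ser.mono (Pi.single i 1) * geom c i j h := by
  refine inv_eq_of_mul_eq_one_left ?_
  have h1 : Ser.mono (Pi.single i 1) * Ser.Z i = (1 : Ser n) := by
    rw [Ser.Z, Ser.mono_mul]; simp [Ser.mono_zero]
  rw [Z_sub_C_Z_eq, mul_mul_mul_comm, h1, geom_mul, one_mul]

theorem vand_Z_ne_zero (p : ℂ) : vand p (Ser.Z (n := n)) ≠ 0 :=
  Finset.prod_ne_zero_iff.mpr fun _ h => Z_sub_C_Z_ne_zero p (mem_pairs.mp h)

end QuantumAffine

end

noncomputable section

namespace QuantumAffine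

variable {n : ℕ}

/-! ### Series with exchange relations -/

/-- A set of exponents with bounded below partial sums is well ordered lexicographically. -/
theorem isPWO_of_prefix_bound (N : ℤ) :
    {a : Lex (Fin n → ℤ) | ∀ k, -N ≤ ∑ i ∈ Finset.Iic k, ofLex a i}.IsPWO := by
  -- `D` recovers an exponent from its partial sums. It is monotone from the product order to the
  -- lexicographic order, since at the first index where two sequences of partial sums differ so do
  -- their differences, in the same direction.
  let D : (Fin n → ℤ) → Lex (Fin n → ℤ) := fun s =>
    toLex fun k => s k - if h : 0 < (k : ℕ) then s ⟨k - 1, by omega⟩ else 0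
  have hD : Monotone D := by
    intro s s' h
    rcases eq_or_ne s s' with rfl | hne
    · exact le_rfl
    · refine le_of_lt ?_
      have hex : ∃ k, s k ≠ s' k := Function.ne_iff.mp hne
      have hS : (Finset.univ.filter fun k => s k ≠ s' k).Nonempty := by
        obtain ⟨k, hk⟩ := hex; exact ⟨k, by simpa using hk⟩
      set k := (Finset.univ.filter fun k => s k ≠ s' k).min' hS with hk
      have hk1 : s k ≠ s' k := by
        have := Finset.min'_mem _ hS; rw [← hk] at this; simpa using this
      have hk2 : ∀ j < k, s j = s' j := by
        intro j hj; by_contra hne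
        exact absurd (Finset.min'_le _ j (by simpa using hne)) (not_le.mpr hj)
      refine ⟨k, fun j hj => ?_, ?_⟩
      · change s j - _ = s' j - _
        rw [hk2 j hj]
        split_ifs with h0
        · rw [hk2 _ (lt_trans (Fin.mk_lt_of_lt_val (by omega)) hj)]
        · rfl
      · change s k - _ < s' k - _
        have := lt_of_le_of_ne (h k) hk1
        split_ifs with h0
        · rw [hk2 ⟨k - 1, by omega⟩ (Fin.mk_lt_of_lt_val (Nat.sub_lt h0 one_pos))]
          linarith
        · linarith
  -- Dickson's lemma for the partial sums; the image under `D` stays partially well ordered.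
  have hpwo : ({s : Fin n → ℤ | ∀ k, -N ≤ s k}).IsPWO := by
    have : {s : Fin n → ℤ | ∀ k, -N ≤ s k} = Set.univ.pi fun _ => Set.Ici (-N) := by
      ext s; simp [Pi.le_def]
    rw [this]
    exact Set.IsPWO.pi fun _ => (BddBelow.isWF bddBelow_Ici).isPWO
  refine (hpwo.image_of_monotone hD).mono ?_
  intro a ha
  refine ⟨fun k => ∑ i ∈ Finset.Iic k, ofLex a i, ha, ?_⟩
  refine ofLex.injective ?_
  funext k
  change (∑ i ∈ Finset.Iic k, ofLex a i) - _ = ofLex a k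
  split_ifs with h0
  · have : Finset.Iic k = insert k (Finset.Iic (⟨k - 1, by omega⟩ : Fin n)) := by
      ext j; simp only [Finset.mem_Iic, Finset.mem_insert, Fin.le_def, Fin.ext_iff]; omega
    rw [this, Finset.sum_insert (by simp [Fin.le_def]; omega)]; ring
  · have : Finset.Iic k = {k} := by
      ext j; simp only [Finset.mem_Iic, Finset.mem_singleton, Fin.le_def, Fin.ext_iff]; omega
    rw [this]; exact (sub_zero _).trans (Finset.sum_singleton _ _)

/-- All tail sums are at most `M` and the total sum is at least `-N`. -/
def TailBound (M N : ℤ) (a : Fin n → ℤ) : Prop :=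
  (∀ k, ∑ i ∈ Finset.Ici k, a i ≤ M) ∧ -N ≤ ∑ i, a i

/-- An initial sum is the total minus a tail. The assumption `0 ≤ M` covers the empty tail. -/
theorem TailBound.prefix_bound {M N : ℤ} (hM : 0 ≤ M) {a : Fin n → ℤ} (h : TailBound M N a)
    (k : Fin n) : -(M + N) ≤ ∑ i ∈ Finset.Iic k, a i := by
  have hsum : ∑ i ∈ Finset.Iic k, a i + ∑ i ∈ Finset.Ioi k, a i = ∑ i, a i := by
    rw [← Finset.sum_union (Finset.disjoint_left.mpr fun i hi hj => by
      simp at hi hj; exact absurd hi (not_le.mpr hj))]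
    congr 1; ext i; simp [le_or_gt]
  have htail : ∑ i ∈ Finset.Ioi k, a i ≤ M := by
    by_cases hk : (k : ℕ) + 1 < n
    · have : Finset.Ioi k = Finset.Ici (⟨k + 1, hk⟩ : Fin n) := by
        ext j; simp only [Finset.mem_Ioi, Finset.mem_Ici, Fin.le_def, Fin.lt_def]; omega
      rw [this]; exact h.1 _
    · have : Finset.Ioi k = ∅ := by
        ext j; simp only [Finset.mem_Ioi, Fin.lt_def, Finset.notMem_empty, iff_false]; omega
      rw [this]; simpa using hM
  have := h.2
  omega

/-- Multiplication by a variable lowers one exponent by one, so the upper bounds persist and only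
the bound on the total moves. -/
theorem TailBound.of_add_single {M N : ℤ} {a : Fin n → ℤ} {i : Fin n}
    (h : TailBound M N (a + Pi.single i 1)) : TailBound M (N + 1) a := by
  refine ⟨fun k => ?_, ?_⟩
  · refine le_trans (Finset.sum_le_sum fun j _ => ?_) (h.1 k)
    by_cases hj : j = i
    · subst hj; simp
    · simp [Pi.single_eq_of_ne hj]
  · have := h.2
    simp only [Pi.add_apply, Finset.sum_add_distrib, Finset.sum_pi_single', Finset.mem_univ,
      if_true] at this
    omega

/-- The series with the given coefficients. -/
def serOf (M N : ℤ) (hM : 0 ≤ M) (c : (Fin n → ℤ) → ℂ) (hc : ∀ a, c a ≠ 0 → TailBound M N a) :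
    Ser n where
  coeff a := c (ofLex a)
  isPWO_support' := (isPWO_of_prefix_bound (M + N)).mono fun a ha =>
    (hc (ofLex a) ha).prefix_bound hM

/-- `y` is obtained from `x` by the permutation `w` of the variables. -/
def PermRel (w : Equiv.Perm (Fin n)) (x y : Ser n) : Prop :=
  ∀ a : Fin n → ℤ, y.coeff (toLex (a ∘ w.symm)) = x.coeff (toLex a)

theorem coeff_Z_sub_mul (p : ℂ) (i j : Fin n) (x : Ser n) (a : Fin n → ℤ) :
    ((Ser.Z i - algebraMap ℂ (Ser n) p * Ser.Z j) * x).coeff (toLex a) =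
      x.coeff (toLex (a + Pi.single i 1)) - p * x.coeff (toLex (a + Pi.single j 1)) := by
  rw [sub_mul, mul_assoc, HahnSeries.coeff_sub, Ser.coeff_C_mul, Ser.coeff_Z_mul, Ser.coeff_Z_mul]

/-- Permutations do not act on `Ser n`, because they do not respect the lexicographic order. They
are therefore treated as a relation between series, which survives multiplication by linear factors.
-/
theorem PermRel.mul {w : Equiv.Perm (Fin n)} {x y : Ser n} (h : PermRel w x y) (p : ℂ)
    (i j : Fin n) :
    PermRel w ((Ser.Z i - algebraMap ℂ (Ser n) p * Ser.Z j) * x)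
      ((Ser.Z (w i) - algebraMap ℂ (Ser n) p * Ser.Z (w j)) * y) := by
  intro a
  have key : ∀ i, (a ∘ w.symm : Fin n → ℤ) + Pi.single (w i) 1
      = (a + Pi.single i 1) ∘ w.symm := by
    intro i; ext k
    simp only [Pi.add_apply, Function.comp_apply, Pi.single_apply, Equiv.symm_apply_eq]
  rw [coeff_Z_sub_mul, coeff_Z_sub_mul, key, key, h, h]

theorem PermRel.prod_mul {w : Equiv.Perm (Fin n)} {x y : Ser n} (h : PermRel w x y) (p : ℂ)
    (S : Finset (Fin n × Fin n)) :
    PermRel w ((∏ ij ∈ S, (Ser.Z ij.1 - algebraMap ℂ (Ser n) p * Ser.Z ij.2)) * x)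
      ((∏ ij ∈ S, (Ser.Z (w ij.1) - algebraMap ℂ (Ser n) p * Ser.Z (w ij.2))) * y) := by
  induction S using Finset.induction_on with
  | empty => simpa using h
  | insert ij S hij ih =>
    rw [Finset.prod_insert hij, Finset.prod_insert hij, mul_assoc, mul_assoc]
    exact ih.mul p _ _

theorem pairs_eq_insert (i : Fin n) (h : (i : ℕ) + 1 < n) :
    pairs n = insert (i, ⟨i + 1, h⟩) ((pairs n).erase (i, ⟨i + 1, h⟩)) :=
  (Finset.insert_erase (mem_pairs.mpr (by simp [Fin.lt_def]))).symm

/-- A simple transposition permutes all pairs `i < j` but one. -/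
theorem prod_erase_pairs_swap {R : Type*} [CommMonoid R] (g : Fin n → Fin n → R) (i : Fin n)
    (h : (i : ℕ) + 1 < n) :
    ∏ ij ∈ (pairs n).erase (i, ⟨i + 1, h⟩),
      g (Equiv.swap i ⟨i + 1, h⟩ ij.1) (Equiv.swap i ⟨i + 1, h⟩ ij.2) =
    ∏ ij ∈ (pairs n).erase (i, ⟨i + 1, h⟩), g ij.1 ij.2 := by
  set s := Equiv.swap i (⟨i + 1, h⟩ : Fin n) with hs
  have hmem : ∀ ij ∈ (pairs n).erase (i, ⟨i + 1, h⟩),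
      (s ij.1, s ij.2) ∈ (pairs n).erase (i, ⟨i + 1, h⟩) := by
    rintro ⟨a, b⟩ hab
    rw [Finset.mem_erase, mem_pairs] at hab ⊢
    simp only [ne_eq, Prod.mk.injEq, Fin.ext_iff, Fin.lt_def, hs, Equiv.swap_apply_def] at hab ⊢
    split_ifs <;> simp_all <;> omega
  refine Finset.prod_nbij' (fun ij => (s ij.1, s ij.2)) (fun ij => (s ij.1, s ij.2))
    hmem hmem ?_ ?_ ?_ <;> intros <;> simp [hs]

/-- Antisymmetric Laurent polynomials. -/
def LPoly.IsAntisymm (P : LPoly n) : Prop :=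
  ∀ w : Equiv.Perm (Fin n), LPoly.perm w P = ((Equiv.Perm.sign w : ℤ) : ℂ) • P

theorem exists_of_succ_lt {m : ℕ} (i : Fin m) :
    Equiv.swap i.castSucc i.succ
      = Equiv.swap i.castSucc (⟨(i.castSucc : ℕ) + 1, by simp⟩ : Fin (m + 1)) := rfl

/-- Antisymmetry needs to be checked for simple transpositions only. -/
theorem coeff_perm_of_simple {c : (Fin n → ℤ) → ℂ}
    (hc : ∀ (i : Fin n) (h : (i : ℕ) + 1 < n) (a : Fin n → ℤ),
      c (a ∘ Equiv.swap i ⟨i + 1, h⟩) = -c a) (w : Equiv.Perm (Fin n)) (a : Fin n → ℤ) :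
    c (a ∘ w) = ((Equiv.Perm.sign w : ℤ) : ℂ) * c a := by
  cases n with
  | zero =>
    have : w = 1 := Subsingleton.elim _ _
    subst this; simp
  | succ m =>
    have hw : w ∈ Submonoid.closure
        (Set.range fun i : Fin m ↦ Equiv.swap i.castSucc i.succ) := by
      rw [Equiv.Perm.mclosure_swap_castSucc_succ]; trivial
    induction hw using Submonoid.closure_induction generalizing a with
    | mem x hx =>
      obtain ⟨i, rfl⟩ := hx
      have h1 := hc i.castSucc (by simp) a
      have h2 : Equiv.Perm.sign (Equiv.swap i.castSucc i.succ) = -1 :=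
        Equiv.Perm.sign_swap (Fin.castSucc_lt_succ).ne
      simp only [h2]
      rw [exists_of_succ_lt, h1]; simp
    | one => simp
    | mul x y _ _ hx hy =>
      have : a ∘ (x * y : Equiv.Perm _) = (a ∘ x) ∘ y := rfl
      rw [this, hy, hx, Equiv.Perm.sign_mul]; push_cast; ring

/-- If `x` satisfies the exchange relations with parameter `p`, then `∏_{i < j} (z_i - p z_j) x` is
an antisymmetric Laurent polynomial. -/
theorem exists_antisymm_of_exchange {M N : ℤ} (hM : 0 ≤ M) {c : (Fin n → ℤ) → ℂ}
    (hc : ∀ a, c a ≠ 0 → TailBound M N a) (p : ℂ)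
    (hex : ∀ (i : Fin n) (h : (i : ℕ) + 1 < n) (a : Fin n → ℤ),
      c (a ∘ Equiv.swap i ⟨i + 1, h⟩ + Pi.single i 1)
        - p * c (a ∘ Equiv.swap i ⟨i + 1, h⟩ + Pi.single ⟨i + 1, h⟩ 1) =
      -(c (a + Pi.single i 1) - p * c (a + Pi.single ⟨i + 1, h⟩ 1))) :
    ∃ P : LPoly n, P.IsAntisymm ∧ P.ser = vand p Ser.Z * serOf M N hM c hc := by
  set X := serOf M N hM c hc with hX
  set F := vand p Ser.Z * X with hF
  -- The exchange relation says that the single factor z_i - p z_{i+1} already makes the series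
  -- antisymmetric under the transposition of i and i+1. The remaining factors are permuted among
  -- themselves.
  have hsimple : ∀ (i : Fin n) (h : (i : ℕ) + 1 < n) (a : Fin n → ℤ),
      F.coeff (toLex (a ∘ Equiv.swap i ⟨i + 1, h⟩)) = -F.coeff (toLex a) := by
    intro i h a
    set s := Equiv.swap i (⟨i + 1, h⟩ : Fin n) with hs
    set Y := (Ser.Z i - algebraMap ℂ (Ser n) p * Ser.Z (⟨i + 1, h⟩ : Fin n)) * X with hY
    have hFY : F = (∏ ij ∈ (pairs n).erase (i, ⟨i + 1, h⟩),
        (Ser.Z ij.1 - algebraMap ℂ (Ser n) p * Ser.Z ij.2)) * Y := by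
      rw [hF, vand, pairs_eq_insert i h, Finset.prod_insert (Finset.notMem_erase _ _),
        Finset.erase_insert (Finset.notMem_erase _ _), hY]
      ring
    have hrel : PermRel s Y (-Y) := by
      intro a
      rw [HahnSeries.coeff_neg, hY, coeff_Z_sub_mul, coeff_Z_sub_mul, hs, Equiv.symm_swap]
      exact neg_eq_iff_eq_neg.mpr (hex i h a)
    have hprod := hrel.prod_mul p ((pairs n).erase (i, ⟨i + 1, h⟩))
    rw [prod_erase_pairs_swap
      (fun a b => Ser.Z a - algebraMap ℂ (Ser n) p * Ser.Z b) i h, ← hFY,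
      show _ * -Y = -F from (mul_neg _ Y).trans (congrArg Neg.neg hFY.symm)] at hprod
    have := hprod a
    rw [HahnSeries.coeff_neg, hs, Equiv.symm_swap] at this
    rw [← this, neg_neg]
  have hanti := coeff_perm_of_simple (c := fun a => F.coeff (toLex a)) hsimple
  -- The tail bound M is kept for every number of factors; each factor costs one in the lower bound
  -- of the total.
  have hbound : ∀ S : Finset (Fin n × Fin n), ∃ N', ∀ a : Fin n → ℤ,
      ((∏ ij ∈ S, (Ser.Z ij.1 - algebraMap ℂ (Ser n) p * Ser.Z ij.2)) * X).coeff (toLex a) ≠ 0 →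
        TailBound M N' a := by
    intro S
    induction S using Finset.induction_on with
    | empty => exact ⟨N, fun a ha => hc a (by rwa [Finset.prod_empty, one_mul] at ha)⟩
    | insert ij S hij ih =>
      obtain ⟨N', hN'⟩ := ih
      refine ⟨N' + 1, fun a ha => ?_⟩
      rw [Finset.prod_insert hij, mul_assoc, coeff_Z_sub_mul] at ha
      by_cases h1 : ((∏ ij ∈ S, (Ser.Z ij.1 - algebraMap ℂ (Ser n) p * Ser.Z ij.2)) * X).coeff
          (toLex (a + Pi.single ij.1 1)) = 0
      · refine (hN' _ fun h2 => ha ?_).of_add_single (i := ij.2)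
        rw [h1, h2]; simp
      · exact (hN' _ h1).of_add_single
  obtain ⟨N', hN'⟩ := hbound (pairs n)
  -- Antisymmetry moves any coordinate to the last position, where it is itself a tail sum.
  have hle : ∀ a : Fin n → ℤ, F.coeff (toLex a) ≠ 0 → ∀ i, a i ≤ M := by
    intro a ha i
    have hn : 0 < n := i.pos
    let l : Fin n := ⟨n - 1, by omega⟩
    have h1 : F.coeff (toLex (a ∘ Equiv.swap i l)) ≠ 0 := by
      have := hanti (Equiv.swap i l) a
      rw [this]
      exact mul_ne_zero (by simp) ha
    have h2 := (hN' _ h1).1 l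
    have : Finset.Ici l = {l} := by
      ext j; simp only [Finset.mem_Ici, Finset.mem_singleton, Fin.le_def, Fin.ext_iff, l]; omega
    rw [this] at h2
    simpa using h2
  have hfin : (Function.support fun a : Fin n → ℤ => F.coeff (toLex a)).Finite := by
    -- A coordinate is the total minus the n - 1 others, each at most M, so it is also bounded below
    -- and the support is finite.
    refine (Set.finite_Icc (fun _ => -N' - n * M : Fin n → ℤ) (fun _ => M)).subset ?_
    intro a ha
    have h1 := hle a ha
    refine ⟨fun i => ?_, h1⟩
    have h2 := (hN' a ha).2
    rw [← Finset.add_sum_erase _ _ (Finset.mem_univ i)] at h2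
    have h3 : ∑ j ∈ Finset.univ.erase i, a j ≤ ∑ j ∈ Finset.univ.erase i, M :=
      Finset.sum_le_sum fun j _ => h1 j
    rw [Finset.sum_const, Finset.card_erase_of_mem (Finset.mem_univ i), Finset.card_univ,
      Fintype.card_fin, nsmul_eq_mul] at h3
    have h4 : ((n - 1 : ℕ) : ℤ) * M ≤ n * M := by gcongr; omega
    change -N' - n * M ≤ a i
    linarith
  refine ⟨AddMonoidAlgebra.ofCoeff (Finsupp.ofSupportFinite _ hfin), fun w => ?_, ?_⟩
  · refine AddMonoidAlgebra.coeff_injective (Finsupp.ext fun a => ?_)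
    rw [LPoly.coeff_perm, AddMonoidAlgebra.coeff_smul]
    exact hanti w a
  · refine HahnSeries.ext (funext fun a => ?_)
    exact LPoly.coeff_ser _ (ofLex a)

end QuantumAffine

end

noncomputable section

namespace QuantumAffine

variable {n : ℕ}

/-! ### Antisymmetrized monomials and their expansion coefficients -/

theorem LPoly.perm_perm (u w : Equiv.Perm (Fin n)) (P : LPoly n) :
    LPoly.perm u (LPoly.perm w P) = LPoly.perm (u * w) P := by
  refine AddMonoidAlgebra.coeff_injective (Finsupp.ext fun a => ?_)
  rw [LPoly.coeff_perm, LPoly.coeff_perm, LPoly.coeff_perm]; rfl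

/-- `∑_w sgn(w) w(z^{-m} ∏_{i < j} (z_i - p z_j))`. -/
def hl (p : ℂ) (m : Fin n → ℤ) : LPoly n :=
  ∑ w : Equiv.Perm (Fin n), ((Equiv.Perm.sign w : ℤ) : ℂ) •
    LPoly.perm w (AddMonoidAlgebra.single m 1 * vandPoly p)

theorem sign_mul_self (w : Equiv.Perm (Fin n)) :
    ((Equiv.Perm.sign w : ℤ) : ℂ) * ((Equiv.Perm.sign w : ℤ) : ℂ) = 1 := by
  rcases Int.units_eq_one_or (Equiv.Perm.sign w) with h | h <;> simp [h]

theorem hl_isAntisymm (p : ℂ) (m : Fin n → ℤ) : (hl p m).IsAntisymm := by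
  intro u
  rw [hl, map_sum, Finset.smul_sum]
  rw [← Equiv.sum_comp (Equiv.mulLeft u) fun w => ((Equiv.Perm.sign u : ℤ) : ℂ) •
    ((Equiv.Perm.sign w : ℤ) : ℂ) • LPoly.perm w (AddMonoidAlgebra.single m 1 * vandPoly p)]
  refine Finset.sum_congr rfl fun w _ => ?_
  rw [map_smul, LPoly.perm_perm, smul_smul]
  congr 1
  simp only [Equiv.coe_mulLeft, Equiv.Perm.sign_mul, Units.val_mul, Int.cast_mul, ← mul_assoc,
    sign_mul_self, one_mul]

theorem prod_pairs_eq {R : Type*} [CommMonoid R] (g : Fin n → Fin n → R) :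
    ∏ i, ∏ j ∈ Finset.Ioi i, g i j = ∏ ij ∈ pairs n, g ij.1 ij.2 := by
  rw [Finset.prod_sigma']
  refine Finset.prod_nbij' (fun x => (x.1, x.2)) (fun x => ⟨x.1, x.2⟩) ?_ ?_ ?_ ?_ ?_ <;>
    simp [mem_pairs]

theorem sign_eq_prod_pairs (w : Equiv.Perm (Fin n)) :
    Equiv.Perm.sign w = ∏ ij ∈ pairs n, if w ij.1 < w ij.2 then 1 else -1 := by
  rw [Equiv.Perm.sign_eq_prod_prod_Ioi]
  exact prod_pairs_eq fun i j => if w i < w j then (1 : ℤˣ) else -1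

/-- Reindexing of unordered pairs by a permutation. -/
theorem prod_pairs_perm {R : Type*} [CommMonoid R] (w : Equiv.Perm (Fin n))
    (g : Fin n → Fin n → R) (hg : ∀ i j, g i j = g j i) :
    ∏ ij ∈ pairs n, g (w ij.1) (w ij.2) = ∏ ij ∈ pairs n, g ij.1 ij.2 := by
  have key : ∀ (w : Equiv.Perm (Fin n)) (ij : Fin n × Fin n), ij ∈ pairs n →
      (min (w ij.1) (w ij.2), max (w ij.1) (w ij.2)) ∈ pairs n := by
    intro w ij h
    rw [mem_pairs] at h ⊢
    exact min_lt_max.mpr (fun he => h.ne (w.injective he))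
  refine Finset.prod_nbij' (fun ij => (min (w ij.1) (w ij.2), max (w ij.1) (w ij.2)))
    (fun ij => (min (w.symm ij.1) (w.symm ij.2), max (w.symm ij.1) (w.symm ij.2)))
    (key w) (key w.symm) ?_ ?_ ?_
  · rintro ⟨i, j⟩ h
    rw [mem_pairs] at h
    rcases le_total (w i) (w j) with h1 | h1 <;> simp [h1, le_of_lt h]
  · rintro ⟨i, j⟩ h
    rw [mem_pairs] at h
    rcases le_total (w.symm i) (w.symm j) with h1 | h1 <;> simp [h1, le_of_lt h]
  · rintro ⟨i, j⟩ h
    rcases le_total (w i) (w j) with h1 | h1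
    · simp [h1]
    · simp [h1, hg (w i) (w j)]

/-- The sign is -1 to the number of reversed pairs. Distributed over these pairs it turns z_j - p
z_i into p z_i - z_j, so the permuted product is again indexed by the pairs i < j. -/
theorem sign_mul_vand_comp {K : Type*} [Field K] [Algebra ℂ K] (p : ℂ) (z : Fin n → K)
    (w : Equiv.Perm (Fin n)) :
    algebraMap ℂ K ((Equiv.Perm.sign w : ℤ) : ℂ) * vand p (z ∘ w) =
      ∏ ij ∈ pairs n, (if w.symm ij.1 < w.symm ij.2 then z ij.1 - algebraMap ℂ K p * z ij.2
        else algebraMap ℂ K p * z ij.1 - z ij.2) := by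
  -- A symmetric function of the unordered pair, so that `prod_pairs_perm` applies.
  let g : Fin n → Fin n → K := fun a b =>
    if (a < b ∧ w.symm a < w.symm b) then z a - algebraMap ℂ K p * z b
    else if (b < a ∧ w.symm b < w.symm a) then z b - algebraMap ℂ K p * z a
    else if a < b then algebraMap ℂ K p * z a - z b
    else if b < a then algebraMap ℂ K p * z b - z a else 0
  have hg : ∀ a b, g a b = g b a := by
    intro a b
    simp only [g]
    rcases lt_trichotomy a b with h | h | h
    · simp [h, h.not_gt]
    · subst h; simp
    · simp [h, h.not_gt]
  have h1 : ∏ ij ∈ pairs n, (if w.symm ij.1 < w.symm ij.2 then z ij.1 - algebraMap ℂ K p * z ij.2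
        else algebraMap ℂ K p * z ij.1 - z ij.2) = ∏ ij ∈ pairs n, g ij.1 ij.2 := by
    refine Finset.prod_congr rfl fun ij h => ?_
    rw [mem_pairs] at h
    simp [g, h, h.not_gt]
  rw [h1, ← prod_pairs_perm w g hg, sign_eq_prod_pairs, vand]
  push_cast
  rw [← Finset.prod_mul_distrib]
  refine Finset.prod_congr rfl fun ij h => ?_
  rw [mem_pairs] at h
  rcases lt_trichotomy (w ij.1) (w ij.2) with h2 | h2 | h2
  · simp [g, h2, h]
  · exact absurd (w.injective h2) h.ne
  · simp [g, h2, h.not_gt, h2.not_gt]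

/-! ### Supports -/

/-- All exponents of `x` lie in `S`. -/
def SuppIn (S : Set (Fin n → ℤ)) (x : Ser n) : Prop :=
  ∀ a : Fin n → ℤ, x.coeff (toLex a) ≠ 0 → a ∈ S

theorem SuppIn.one (S : AddSubmonoid (Fin n → ℤ)) : SuppIn (S : Set (Fin n → ℤ)) 1 := by
  intro a ha
  rw [← Ser.mono_zero, Ser.coeff_mono] at ha
  have : a = 0 := by by_contra h; exact ha (if_neg h)
  subst this; exact S.zero_mem

theorem SuppIn.mul_set {S T U : Set (Fin n → ℤ)} (hU : ∀ a ∈ S, ∀ b ∈ T, a + b ∈ U) {x y : Ser n}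
    (hx : SuppIn S x) (hy : SuppIn T y) : SuppIn U (x * y) := by
  intro a ha
  obtain ⟨b, hb, c, hc, h⟩ := Set.mem_add.mp (HahnSeries.support_mul_subset
    ((HahnSeries.mem_support _ _).mpr ha))
  have := hU _ (hx (ofLex b) hb) _ (hy (ofLex c) hc)
  have h2 : ofLex b + ofLex c = a := congrArg ofLex h
  rwa [h2] at this

theorem SuppIn.mul {S : AddSubmonoid (Fin n → ℤ)} {x y : Ser n}
    (hx : SuppIn (S : Set (Fin n → ℤ)) x) (hy : SuppIn (S : Set (Fin n → ℤ)) y) :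
    SuppIn (S : Set (Fin n → ℤ)) (x * y) :=
  hx.mul_set (fun _ ha _ hb => S.add_mem ha hb) hy

/-- In a pointed cone the exponent 0 arises only as 0 + 0. -/
theorem SuppIn.coeff_zero_mul {S : AddSubmonoid (Fin n → ℤ)}
    (hS : ∀ a ∈ S, ∀ b ∈ S, a + b = 0 → a = 0) {x y : Ser n}
    (hx : SuppIn (S : Set (Fin n → ℤ)) x) (hy : SuppIn (S : Set (Fin n → ℤ)) y) :
    (x * y).coeff 0 = x.coeff 0 * y.coeff 0 := by
  rw [HahnSeries.coeff_mul]
  rw [Finset.sum_eq_single ((0 : Lex (Fin n → ℤ)), (0 : Lex (Fin n → ℤ)))]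
  · rintro ⟨a, b⟩ hab hne
    by_contra h
    have ha := hx (ofLex a) (left_ne_zero_of_mul h)
    have hb := hy (ofLex b) (right_ne_zero_of_mul h)
    have hab' : ofLex a + ofLex b = 0 := congrArg ofLex (Finset.mem_antidiagonal.mp hab).2.2
    have ha0 := hS _ ha _ hb hab'
    have hb0 : ofLex b = 0 := by rw [ha0, zero_add] at hab'; exact hab'
    exact hne (Prod.ext (ofLex.injective ha0) (ofLex.injective hb0))
  · intro h
    by_contra hne
    refine h (Finset.mem_antidiagonal.mpr ⟨left_ne_zero_of_mul hne, right_ne_zero_of_mul hne, ?_⟩)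
    exact add_zero _

/-- Exponents with nonnegative partial sums whose partial sums in the order of `w` are
nonpositive. -/
def invCone (w : Equiv.Perm (Fin n)) : AddSubmonoid (Fin n → ℤ) where
  carrier := {x | (∀ k, 0 ≤ ∑ i ∈ Finset.Iic k, x i) ∧ ∀ k, ∑ i ∈ Finset.Iic k, x (w i) ≤ 0}
  zero_mem' := by simp
  add_mem' := by
    rintro a b ⟨ha, ha'⟩ ⟨hb, hb'⟩
    refine ⟨fun k => ?_, fun k => ?_⟩
    · simp only [Pi.add_apply, Finset.sum_add_distrib]; exact add_nonneg (ha k) (hb k)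
    · simp only [Pi.add_apply, Finset.sum_add_distrib]; exact add_nonpos (ha' k) (hb' k)

theorem eq_of_prefix_eq {a b : Fin n → ℤ}
    (h : ∀ k, ∑ i ∈ Finset.Iic k, a i = ∑ i ∈ Finset.Iic k, b i) : a = b := by
  funext k
  have hk := h k
  by_cases h0 : 0 < (k : ℕ)
  · have hI : Finset.Iic k = insert k (Finset.Iic (⟨k - 1, by omega⟩ : Fin n)) := by
      ext j; simp only [Finset.mem_Iic, Finset.mem_insert, Fin.le_def, Fin.ext_iff]; omega
    have hnot : k ∉ Finset.Iic (⟨k - 1, by omega⟩ : Fin n) := by simp [Fin.le_def]; omega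
    rw [hI, Finset.sum_insert hnot, Finset.sum_insert hnot, h] at hk
    omega
  · have hI : Finset.Iic k = {k} := by
      ext j; simp only [Finset.mem_Iic, Finset.mem_singleton, Fin.le_def, Fin.ext_iff]; omega
    rw [hI] at hk; simpa using hk

theorem invCone_pointed (w : Equiv.Perm (Fin n)) :
    ∀ a ∈ invCone w, ∀ b ∈ invCone w, a + b = 0 → a = 0 := by
  intro a ha b hb hab
  refine eq_of_prefix_eq fun k => ?_
  have h1 := ha.1 k
  have h2 := hb.1 k
  have h3 : ∑ i ∈ Finset.Iic k, a i + ∑ i ∈ Finset.Iic k, b i = 0 := by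
    rw [← Finset.sum_add_distrib]
    exact Finset.sum_eq_zero fun i _ => congrFun hab i
  simp only [Pi.zero_apply, Finset.sum_const_zero]; omega

/-- In the natural order the entry +1 at i comes before the entry -1 at j; in the order given by `w`
it comes after. This is what makes the two families of partial sums have opposite signs. -/
theorem root_mem_invCone {w : Equiv.Perm (Fin n)} {i j : Fin n} (h : i < j)
    (hw : w.symm j < w.symm i) : (Pi.single i 1 - Pi.single j 1 : Fin n → ℤ) ∈ invCone w := by
  have hw' : ∀ a b : Fin n, w a = b ↔ a = w.symm b := fun a b => (Equiv.eq_symm_apply w).symm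
  refine ⟨fun k => ?_, fun k => ?_⟩
  · simp only [Pi.sub_apply, Finset.sum_sub_distrib, Pi.single_apply, Finset.sum_ite_eq',
      Finset.mem_Iic]
    split_ifs with h1 h2 h2 <;> omega
  · simp only [Pi.sub_apply, Finset.sum_sub_distrib, Pi.single_apply, hw', Finset.sum_ite_eq',
      Finset.mem_Iic]
    split_ifs with h1 h2 h2 <;> omega

/-- `(p z_i - z_j) / (z_i - p z_j)` as a series. -/
theorem exchange_factor_eq (p : ℂ) {i j : Fin n} (h : i < j) :
    (algebraMap ℂ (Ser n) p * Ser.Z i - Ser.Z j) * (Ser.Z i - algebraMap ℂ (Ser n) p * Ser.Z j)⁻¹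
      = rootHom i j h ((PowerSeries.C p - PowerSeries.X) * PowerSeries.mk fun k => p ^ k) := by
  have h1 : algebraMap ℂ (Ser n) p * Ser.Z i - Ser.Z j
      = Ser.Z i * (algebraMap ℂ (Ser n) p - Ser.mono (Pi.single i 1 - Pi.single j 1)) := by
    rw [mul_sub, mul_comm (Ser.Z i), Ser.Z, Ser.mono_mul, Ser.Z]; congr 2; abel
  have h2 : Ser.Z i * Ser.mono (Pi.single i 1) = (1 : Ser n) := by
    rw [Ser.Z, Ser.mono_mul, neg_add_cancel, Ser.mono_zero]
  rw [inv_Z_sub_C_Z p h, h1, map_mul, map_sub, rootHom_C, rootHom_X]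
  calc _ = (Ser.Z i * Ser.mono (Pi.single i 1)) *
        ((algebraMap ℂ (Ser n) p - Ser.mono (Pi.single i 1 - Pi.single j 1)) * geom p i j h) := by
        ring
    _ = _ := by rw [h2, one_mul]; rfl

theorem suppIn_rootHom {S : AddSubmonoid (Fin n → ℤ)} {i j : Fin n} (h : i < j)
    (hS : (Pi.single i 1 - Pi.single j 1 : Fin n → ℤ) ∈ S) (x : PowerSeries ℂ) :
    SuppIn (S : Set (Fin n → ℤ)) (rootHom i j h x) := by
  intro a ha
  obtain ⟨k, rfl⟩ := coeff_rootHom_ne_zero i j h x ha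
  exact S.nsmul_mem hS k

theorem coeff_zero_rootHom {i j : Fin n} (h : i < j) (x : PowerSeries ℂ) :
    (rootHom i j h x).coeff 0 = PowerSeries.constantCoeff x := by
  have := coeff_rootHom i j h x 0
  rw [zero_smul] at this
  rw [← PowerSeries.coeff_zero_eq_constantCoeff_apply, ← this]; rfl

/-- Each factor (p z_i - z_j) / (z_i - p z_j) is a power series in z_j / z_i with constant term p,
and only pairs inverted by `w` contribute. The constant term is multiplicative because the cone of
inversions is pointed. For all pairs it is p to the number of inversions. -/
theorem prod_exchange_factors (p : ℂ) (w : Equiv.Perm (Fin n)) (S : Finset (Fin n × Fin n))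
    (hS : S ⊆ pairs n) :
    SuppIn (invCone w : Set (Fin n → ℤ)) (∏ ij ∈ S, if w.symm ij.1 < w.symm ij.2 then (1 : Ser n)
      else (algebraMap ℂ (Ser n) p * Ser.Z ij.1 - Ser.Z ij.2) *
        (Ser.Z ij.1 - algebraMap ℂ (Ser n) p * Ser.Z ij.2)⁻¹) ∧
    (∏ ij ∈ S, if w.symm ij.1 < w.symm ij.2 then (1 : Ser n)
      else (algebraMap ℂ (Ser n) p * Ser.Z ij.1 - Ser.Z ij.2) *
        (Ser.Z ij.1 - algebraMap ℂ (Ser n) p * Ser.Z ij.2)⁻¹).coeff 0 =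
      ∏ ij ∈ S, if w.symm ij.1 < w.symm ij.2 then 1 else p := by
  induction S using Finset.induction_on with
  | empty => exact ⟨by simpa using SuppIn.one _, by simp [HahnSeries.coeff_one]⟩
  | insert ij S hij ih =>
    obtain ⟨ih1, ih2⟩ := ih ((Finset.subset_insert _ _).trans hS)
    have hlt := mem_pairs.mp (hS (Finset.mem_insert_self _ _))
    rw [Finset.prod_insert hij, Finset.prod_insert hij]
    by_cases hw : w.symm ij.1 < w.symm ij.2
    · simp only [hw, if_true, one_mul]; exact ⟨ih1, ih2⟩
    · simp only [hw, if_false]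
      have hw' : w.symm ij.2 < w.symm ij.1 :=
        lt_of_le_of_ne (not_lt.mp hw) fun he => hlt.ne (w.symm.injective he).symm
      rw [exchange_factor_eq p hlt]
      have h1 := suppIn_rootHom hlt (root_mem_invCone hlt hw')
        ((PowerSeries.C p - PowerSeries.X) * PowerSeries.mk fun k => p ^ k)
      refine ⟨h1.mul ih1, ?_⟩
      rw [h1.coeff_zero_mul (invCone_pointed w) ih1, ih2, coeff_zero_rootHom]
      congr 1
      rw [map_mul, map_sub, ← PowerSeries.coeff_zero_eq_constantCoeff_apply (PowerSeries.mk _)]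
      simp [-PowerSeries.coeff_zero_eq_constantCoeff]

/-- The rearrangement inequality, applied to the indicator function of an initial segment. -/
theorem prefix_le_comp_perm {m : Fin n → ℤ} (hm : Monotone m) (w : Equiv.Perm (Fin n)) (k : Fin n) :
    ∑ i ∈ Finset.Iic k, m i ≤ ∑ i ∈ Finset.Iic k, m (w i) := by
  let f : Fin n → ℤ := fun i => if i ≤ k then 1 else 0
  have hf : Antitone f := by
    intro i j hij
    simp only [f]
    split_ifs with h1 h2 h2 <;> omega
  have := (hf.antivary hm).sum_mul_le_sum_mul_comp_perm (σ := w)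
  have key : ∀ g : Fin n → ℤ, ∑ i, f i * g i = ∑ i ∈ Finset.Iic k, g i := by
    intro g
    rw [← Finset.sum_filter_add_sum_filter_not Finset.univ (fun i => i ≤ k)]
    have h2 : ∑ i with ¬ i ≤ k, f i * g i = 0 :=
      Finset.sum_eq_zero fun i hi => by simp [f, (Finset.mem_filter.mp hi).2]
    rw [h2, add_zero]
    refine Finset.sum_congr (by ext; simp) fun i hi => ?_
    simp [f, Finset.mem_Iic.mp hi]
  rw [key, key (fun i => m (w i))] at this
  exact this

/-- A monotone exponent in the cone spanned by the inversions of `w`, based at a rearrangement of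
a monotone exponent, is the base point. -/
theorem eq_of_mem_invCone {m m' : Fin n → ℤ} (hm : Monotone m) (hm' : Monotone m')
    (w : Equiv.Perm (Fin n)) (h : m' - m ∘ w.symm ∈ invCone w) : m' = m ∧ m ∘ w.symm = m := by
  have h1 : ∀ k, ∑ i ∈ Finset.Iic k, (m ∘ w.symm) i ≤ ∑ i ∈ Finset.Iic k, m' i := by
    intro k
    have := h.1 k
    simp only [Pi.sub_apply, Finset.sum_sub_distrib] at this; linarith
  have h2 : ∀ k, ∑ i ∈ Finset.Iic k, m' (w i) ≤ ∑ i ∈ Finset.Iic k, m i := by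
    intro k
    have := h.2 k
    simp only [Pi.sub_apply, Finset.sum_sub_distrib, Function.comp_apply,
      Equiv.symm_apply_apply] at this
    linarith
  have h3 := prefix_le_comp_perm hm w.symm
  have h4 := prefix_le_comp_perm hm' w
  -- The partial sums close up to a cycle m ≤ m ∘ w⁻¹ ≤ m' ≤ m' ∘ w ≤ m, so all of these
  -- inequalities are equalities.
  constructor
  · refine eq_of_prefix_eq fun k => le_antisymm ((h4 k).trans (h2 k)) ((h3 k).trans (h1 k))
  · refine eq_of_prefix_eq fun k =>
      le_antisymm ((h1 k).trans ((h4 k).trans (h2 k))) (h3 k)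

/-- `∑ p ^ inv(w)` over the stabilizer of `m`. -/
def kappa (p : ℂ) (m : Fin n → ℤ) : ℂ :=
  ∑ w : Equiv.Perm (Fin n), if m ∘ w = m then
    ∏ ij ∈ pairs n, (if w ij.1 < w ij.2 then 1 else p) else 0

/-- The summand of w, divided by the product, is z^{-(m ∘ w⁻¹)} times a series supported in the cone
of inversions of w. By `eq_of_mem_invCone` it meets the monotone exponents only at m, and only if w
fixes m; the coefficient there is p to the number of inversions. -/
theorem coeff_hl_div_vand (p : ℂ) {m m' : Fin n → ℤ} (hm : Monotone m) (hm' : Monotone m') :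
    ((hl p m).ser * (vand p Ser.Z)⁻¹).coeff (toLex m') = if m' = m then kappa p m else 0 := by
  have hterm : ∀ w : Equiv.Perm (Fin n),
      (LPoly.ser (((Equiv.Perm.sign w : ℤ) : ℂ) •
        LPoly.perm w (AddMonoidAlgebra.single m 1 * vandPoly p))) * (vand p Ser.Z)⁻¹ =
      Ser.mono (m ∘ w.symm) * ∏ ij ∈ pairs n, if w.symm ij.1 < w.symm ij.2 then (1 : Ser n)
        else (algebraMap ℂ (Ser n) p * Ser.Z ij.1 - Ser.Z ij.2) *
          (Ser.Z ij.1 - algebraMap ℂ (Ser n) p * Ser.Z ij.2)⁻¹ := by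
    intro w
    have h1 : LPoly.ser (LPoly.perm w (AddMonoidAlgebra.single m 1 * vandPoly p))
        = Ser.mono (m ∘ w.symm) * vand p (Ser.Z ∘ w) := by
      rw [LPoly.ser, ev_perm, map_mul, ev_single, ev_vand, map_one, one_mul, monoAt_comp_perm,
        Ser.monoAt_Z]
    have h2 : LPoly.ser (((Equiv.Perm.sign w : ℤ) : ℂ) •
        LPoly.perm w (AddMonoidAlgebra.single m 1 * vandPoly p)) =
        algebraMap ℂ (Ser n) ((Equiv.Perm.sign w : ℤ) : ℂ) *
          (Ser.mono (m ∘ w.symm) * vand p (Ser.Z ∘ w)) := by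
      rw [← h1, LPoly.ser, ev_smul]
    rw [h2, mul_left_comm, sign_mul_vand_comp, mul_assoc, vand, ← Finset.prod_inv_distrib,
      ← Finset.prod_mul_distrib]
    congr 1
    refine Finset.prod_congr rfl fun ij hij => ?_
    split_ifs with h
    · exact mul_inv_cancel₀ (Z_sub_C_Z_ne_zero p (mem_pairs.mp hij))
    · rfl
  have hcoeff : ∀ w : Equiv.Perm (Fin n),
      ((LPoly.ser (((Equiv.Perm.sign w : ℤ) : ℂ) •
        LPoly.perm w (AddMonoidAlgebra.single m 1 * vandPoly p))) * (vand p Ser.Z)⁻¹).coeff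
          (toLex m') = if m' = m then (if m ∘ w.symm = m then
            ∏ ij ∈ pairs n, (if w.symm ij.1 < w.symm ij.2 then 1 else p) else 0) else 0 := by
    intro w
    obtain ⟨hs, h0⟩ := prod_exchange_factors p w (pairs n) subset_rfl
    rw [hterm, Ser.coeff_mono_mul]
    split_ifs with h1 h2
    · rw [h1, h2, sub_self, ← h0]; rfl
    · by_contra hne
      exact h2 (eq_of_mem_invCone hm hm' w (hs _ hne)).2
    · by_contra hne
      exact h1 (eq_of_mem_invCone hm hm' w (hs _ hne)).1
  rw [hl, LPoly.ser, map_sum, Finset.sum_mul, HahnSeries.coeff_sum,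
    Finset.sum_congr rfl fun w _ => hcoeff w]
  split_ifs with h
  · rw [kappa]
    exact Equiv.sum_comp (Equiv.inv (Equiv.Perm (Fin n))) fun w => if m ∘ w = m then
      ∏ ij ∈ pairs n, (if w ij.1 < w ij.2 then 1 else p) else 0
  · simp

/-! ### Expansion of antisymmetric Laurent polynomials -/

theorem order_Z_sub_C_Z (p : ℂ) {i j : Fin n} (h : i < j) :
    (Ser.Z i - algebraMap ℂ (Ser n) p * Ser.Z j).order = toLex (-Pi.single i 1) := by
  have hc : ∀ a : Fin n → ℤ, (Ser.Z i - algebraMap ℂ (Ser n) p * Ser.Z j).coeff (toLex a) =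
      (if a = -Pi.single i 1 then 1 else 0) - p * if a = -Pi.single j 1 then 1 else 0 := by
    intro a
    rw [HahnSeries.coeff_sub, Ser.coeff_C_mul, Ser.Z, Ser.Z, Ser.coeff_mono, Ser.coeff_mono]
  have hij : toLex (-Pi.single i 1 : Fin n → ℤ) < toLex (-Pi.single j 1) := by
    have := lex_pos_of_lt h
    rw [← sub_pos]
    convert this using 1
    rw [← toLex_sub]; congr 1; abel
  have hne : (-Pi.single i 1 : Fin n → ℤ) ≠ -Pi.single j 1 := fun he => hij.ne (congrArg toLex he)
  have h1 : (Ser.Z i - algebraMap ℂ (Ser n) p * Ser.Z j).order ≤ toLex (-Pi.single i 1) :=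
    HahnSeries.order_le_of_coeff_ne_zero (by rw [hc]; simp [hne])
  have h2 : (Ser.Z i - algebraMap ℂ (Ser n) p * Ser.Z j).coeff
      (toLex (ofLex (Ser.Z i - algebraMap ℂ (Ser n) p * Ser.Z j).order)) ≠ 0 :=
    mt HahnSeries.coeff_order_eq_zero.mp (Z_sub_C_Z_ne_zero p h)
  rw [hc] at h2
  by_contra hne'
  by_cases hj : ofLex (Ser.Z i - algebraMap ℂ (Ser n) p * Ser.Z j).order = -Pi.single j 1
  · exact absurd h1 (not_le.mpr (hij.trans_eq (congrArg toLex hj).symm))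
  · have hi : ofLex (Ser.Z i - algebraMap ℂ (Ser n) p * Ser.Z j).order ≠ -Pi.single i 1 :=
      fun he => hne' (congrArg toLex he)
    rw [if_neg hj, if_neg hi] at h2
    simp at h2

/-- The leading monomial of z_i - p z_j is z_i, and k is the smaller index of n - 1 - k pairs. -/
theorem order_vand (p : ℂ) :
    (vand p (Ser.Z (n := n))).order = toLex fun k : Fin n => -((n : ℤ) - 1 - (k : ℕ)) := by
  have h : ∀ S ⊆ pairs n, (∏ ij ∈ S, (Ser.Z ij.1 - algebraMap ℂ (Ser n) p * Ser.Z ij.2)).order =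
      toLex (∑ ij ∈ S, -Pi.single ij.1 1) := by
    intro S hS
    induction S using Finset.induction_on with
    | empty => simp
    | insert ij S hij ih =>
      have hS' := (Finset.subset_insert ij S).trans hS
      have hlt := mem_pairs.mp (hS (Finset.mem_insert_self _ _))
      rw [Finset.prod_insert hij, Finset.sum_insert hij, HahnSeries.order_mul
        (Z_sub_C_Z_ne_zero p hlt) (Finset.prod_ne_zero_iff.mpr fun kl hkl =>
          Z_sub_C_Z_ne_zero p (mem_pairs.mp (hS' hkl))), ih hS', order_Z_sub_C_Z p hlt]
      rfl
  rw [vand, h _ subset_rfl]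
  congr 1
  funext k
  have hcard : ((pairs n).filter fun ij => k = ij.1).card = n - 1 - k := by
    rw [← Fin.card_Ioi k]
    refine Finset.card_nbij' (fun ij => ij.2) (fun j => (k, j)) ?_ ?_ ?_ ?_ <;>
      simp +contextual [mem_pairs, Set.MapsTo, Set.LeftInvOn]
  rw [Finset.sum_apply]
  simp only [Pi.neg_apply, Pi.single_apply, Finset.sum_neg_distrib, Finset.sum_boole, hcard]
  have := k.2
  omega

theorem LPoly.IsAntisymm.coeff_comp {P : LPoly n} (hP : P.IsAntisymm) (w : Equiv.Perm (Fin n))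
    (a : Fin n → ℤ) : P.coeff (a ∘ w) = ((Equiv.Perm.sign w : ℤ) : ℂ) * P.coeff a := by
  rw [← LPoly.coeff_perm, hP w]; rfl

/-- A nonzero antisymmetric Laurent polynomial divided by `∏_{i < j} (z_i - p z_j)` has a nonzero
coefficient at a monotone exponent. -/
theorem LPoly.IsAntisymm.exists_monotone {P : LPoly n} (hP : P.IsAntisymm) (h0 : P ≠ 0) (p : ℂ) :
    ∃ m : Fin n → ℤ, Monotone m ∧ (P.ser * (vand p Ser.Z)⁻¹).coeff (toLex m) ≠ 0 := by
  have hs0 : P.ser ≠ 0 := fun h => h0 (LPoly.ser_injective (by rw [h, LPoly.ser, map_zero]))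
  set a : Fin n → ℤ := ofLex P.ser.order with ha
  have hca : P.coeff a ≠ 0 := by
    rw [← LPoly.coeff_ser]; exact mt HahnSeries.coeff_order_eq_zero.mp hs0
  -- `a` is the smallest exponent of P. Two equal coordinates would make the coefficient vanish by
  -- antisymmetry, and a descent could be swapped to give a smaller exponent.
  have hmono : StrictMono a := by
    intro i j hij
    have hsw := hP.coeff_comp (Equiv.swap i j) a
    rw [Equiv.Perm.sign_swap hij.ne] at hsw
    rcases lt_trichotomy (a i) (a j) with h | h | h
    · exact h
    · have : a ∘ Equiv.swap i j = a := by
        funext k; simp only [Function.comp_apply, Equiv.swap_apply_def]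
        split_ifs with h1 h2
        · rw [h1, h]
        · rw [h2, h]
        · rfl
      rw [this] at hsw
      refine absurd ?_ hca
      push_cast at hsw
      linear_combination hsw / 2
    · have hne : P.ser.coeff (toLex (a ∘ Equiv.swap i j)) ≠ 0 := by
        rw [LPoly.coeff_ser, hsw]; simpa using hca
      have hle := HahnSeries.order_le_of_coeff_ne_zero hne
      refine absurd hle (not_le.mpr ⟨i, fun k hk => ?_, ?_⟩)
      · change a (Equiv.swap i j k) = a k
        rw [Equiv.swap_apply_of_ne_of_ne hk.ne (hk.trans hij).ne]
      · change a (Equiv.swap i j i) < a i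
        rwa [Equiv.swap_apply_left]
  set Y := P.ser * (vand p Ser.Z)⁻¹ with hY
  have hYP : P.ser = Y * vand p Ser.Z := by
    rw [hY, inv_mul_cancel_right₀ (vand_Z_ne_zero p)]
  have hY0 : Y ≠ 0 := mul_ne_zero hs0 (inv_ne_zero (vand_Z_ne_zero p))
  have hord := HahnSeries.order_mul hY0 (vand_Z_ne_zero p)
  rw [← hYP, order_vand] at hord
  refine ⟨ofLex Y.order, ?_, mt HahnSeries.coeff_order_eq_zero.mp hY0⟩
  -- Orders are additive. Strictly increasing integers satisfy a_j - a_i ≥ j - i, so adding the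
  -- decreasing staircase n - 1 - k leaves a weakly increasing sequence.
  have hval : ∀ k, ofLex Y.order k = a k + ((n : ℤ) - 1 - k) := by
    intro k
    have : a k = ofLex Y.order k + -((n : ℤ) - 1 - k) := congrFun (congrArg ofLex hord) k
    linarith
  have hstep : ∀ (d : ℕ) (i j : Fin n), (i : ℕ) + d = j → a i + d ≤ a j := by
    intro d
    induction d with
    | zero => intro i j h; simp [Fin.ext (by simpa using h) (a := i) (b := j)]
    | succ d ih =>
      intro i j h
      have := ih i ⟨i + d, by omega⟩ rfl
      have h2 : a ⟨i + d, by omega⟩ < a j := hmono (Fin.lt_def.mpr (by simp; omega))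
      push_cast; omega
  intro i j hij
  rw [hval, hval]
  have := hstep (j - i) i j (by have := Fin.le_def.mp hij; omega)
  have h2 := Fin.le_def.mp hij
  push_cast [h2] at this
  linarith

/-- The expansion of an antisymmetric Laurent polynomial in the `hl p m`. -/
theorem LPoly.IsAntisymm.eq_sum_hl {P : LPoly n} (hP : P.IsAntisymm) (p : ℂ)
    (S : Finset (Fin n → ℤ)) (hS : ∀ m ∈ S, Monotone m) (hκ : ∀ m ∈ S, kappa p m ≠ 0)
    (hS' : ∀ m, Monotone m → (P.ser * (vand p Ser.Z)⁻¹).coeff (toLex m) ≠ 0 → m ∈ S) :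
    P = ∑ m ∈ S, ((P.ser * (vand p Ser.Z)⁻¹).coeff (toLex m) / kappa p m) • hl p m := by
  set c : (Fin n → ℤ) → ℂ := fun m => (P.ser * (vand p Ser.Z)⁻¹).coeff (toLex m) / kappa p m with hc
  set Q := P - ∑ m ∈ S, c m • hl p m with hQ
  -- The difference is antisymmetric and its quotient by the product has no coefficient at a
  -- monotone exponent, which `exists_monotone` forbids for a nonzero polynomial.
  suffices h : Q = 0 from sub_eq_zero.mp h
  have hQa : Q.IsAntisymm := by
    intro w
    rw [hQ, map_sub, map_sum, hP w, smul_sub, Finset.smul_sum]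
    congr 1
    refine Finset.sum_congr rfl fun m _ => ?_
    rw [map_smul, hl_isAntisymm p m w, smul_comm]
  by_contra hne
  obtain ⟨m, hm, hm0⟩ := hQa.exists_monotone hne p
  refine hm0 ?_
  have hexp : Q.ser * (vand p Ser.Z)⁻¹ = P.ser * (vand p Ser.Z)⁻¹ -
      ∑ m ∈ S, algebraMap ℂ (Ser n) (c m) * ((hl p m).ser * (vand p Ser.Z)⁻¹) := by
    rw [hQ, LPoly.ser, map_sub, map_sum, sub_mul, Finset.sum_mul]
    congr 1
    refine Finset.sum_congr rfl fun m _ => ?_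
    rw [ev_smul, mul_assoc]
  rw [hexp, HahnSeries.coeff_sub, HahnSeries.coeff_sum]
  have hsum : ∑ m' ∈ S, (algebraMap ℂ (Ser n) (c m') *
      ((hl p m').ser * (vand p Ser.Z)⁻¹)).coeff (toLex m) =
      ∑ m' ∈ S, if m = m' then (P.ser * (vand p Ser.Z)⁻¹).coeff (toLex m) else 0 := by
    refine Finset.sum_congr rfl fun m' hm' => ?_
    rw [Ser.coeff_C_mul, coeff_hl_div_vand p (hS m' hm') hm]
    split_ifs with h
    · subst h; rw [hc]; exact div_mul_cancel₀ _ (hκ _ hm')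
    · simp
  rw [hsum, Finset.sum_ite_eq]
  split_ifs with h
  · exact sub_self _
  · rw [sub_zero]
    by_contra hne
    exact h (hS' m hm hne)

/-! ### The stabilizer sum -/

/-- The permutation of `Fin (n + 1)` with `0 ↦ r` which is given by `w` on the rest. -/
def consPerm (rw' : Fin (n + 1) × Equiv.Perm (Fin n)) : Equiv.Perm (Fin (n + 1)) :=
  Equiv.ofBijective (Fin.cons rw'.1 fun i => rw'.1.succAbove (rw'.2 i)) <| by
    refine (Finite.injective_iff_bijective).mp (Fin.cons_injective_iff.mpr ⟨?_, ?_⟩)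
    · rintro ⟨i, hi⟩; exact Fin.succAbove_ne _ _ hi
    · exact (Fin.succAbove_right_injective).comp rw'.2.injective

theorem consPerm_zero (rw' : Fin (n + 1) × Equiv.Perm (Fin n)) : consPerm rw' 0 = rw'.1 := rfl

theorem consPerm_succ (rw' : Fin (n + 1) × Equiv.Perm (Fin n)) (i : Fin n) :
    consPerm rw' i.succ = rw'.1.succAbove (rw'.2 i) := by
  simp [consPerm]

theorem consPerm_bijective : Function.Bijective (consPerm (n := n)) := by
  rw [Fintype.bijective_iff_injective_and_card]
  refine ⟨fun a b h => ?_, ?_⟩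
  · have h0 : a.1 = b.1 := by rw [← consPerm_zero, h, consPerm_zero]
    refine Prod.ext h0 (Equiv.ext fun i => ?_)
    have h1 : consPerm a i.succ = consPerm b i.succ := by rw [h]
    rw [consPerm_succ, consPerm_succ, h0] at h1
    exact Fin.succAbove_right_injective h1
  · rw [Fintype.card_prod, Fintype.card_perm, Fintype.card_perm, Fintype.card_fin,
      Fintype.card_fin, Nat.factorial_succ]

theorem prod_pairs_succ {R : Type*} [CommMonoid R] (g : Fin (n + 1) → Fin (n + 1) → R) :
    ∏ ij ∈ pairs (n + 1), g ij.1 ij.2 =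
      (∏ j : Fin n, g 0 j.succ) * ∏ ij ∈ pairs n, g ij.1.succ ij.2.succ := by
  rw [← prod_pairs_eq, ← prod_pairs_eq fun i j => g i.succ j.succ, Fin.prod_univ_succ]
  congr 1
  · rw [Fin.prod_Ioi_zero]
  · exact Finset.prod_congr rfl fun i _ => Fin.prod_Ioi_succ _ _

/-- If 0 is sent to r, then exactly the r smaller values come later and form an inversion with it.
-/
theorem prod_succAbove_inversions (p : ℂ) (r : Fin (n + 1)) (w : Equiv.Perm (Fin n)) :
    ∏ j : Fin n, (if r < r.succAbove (w j) then (1 : ℂ) else p) = p ^ (r : ℕ) := by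
  rw [Equiv.prod_comp w fun j => if r < r.succAbove j then (1 : ℂ) else p]
  rw [Finset.prod_ite, Finset.prod_const_one, one_mul, Finset.prod_const]
  congr 1
  have : (Finset.univ.filter fun j : Fin n => ¬ r < r.succAbove j).card = (r : ℕ) := by
    have h1 : (Finset.univ.filter fun j : Fin n => ¬ r < r.succAbove j)
        = Finset.univ.filter fun j : Fin n => (j : ℕ) < r := by
      ext j
      simp only [Finset.mem_filter, Finset.mem_univ, true_and, Fin.lt_succAbove_iff_le_castSucc,
        not_le]
      rfl
    rw [h1, Fin.card_filter_val_lt]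
    have := r.2; omega
  exact this

/-- A permutation is determined by the image r of 0 and a permutation of the rest, and inversions
split accordingly. It fixes m exactly if r lies in the block of 0 and the rest fixes the tail of m.
-/
theorem kappa_succ (p : ℂ) {m : Fin (n + 1) → ℤ} (hm : Monotone m) :
    kappa p m = (∑ r : Fin (n + 1), if m r = m 0 then p ^ (r : ℕ) else 0) *
      kappa p (fun i => m i.succ) := by
  rw [kappa, ← (Equiv.ofBijective _ consPerm_bijective).sum_comp, Fintype.sum_prod_type,
    Finset.sum_mul]
  refine Finset.sum_congr rfl fun r _ => ?_
  rw [kappa, Finset.mul_sum]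
  refine Finset.sum_congr rfl fun w _ => ?_
  have hprod : ∏ ij ∈ pairs (n + 1), (if consPerm (r, w) ij.1 < consPerm (r, w) ij.2 then (1 : ℂ)
      else p) = p ^ (r : ℕ) * ∏ ij ∈ pairs n, (if w ij.1 < w ij.2 then 1 else p) := by
    rw [prod_pairs_succ fun i j => if consPerm (r, w) i < consPerm (r, w) j then (1 : ℂ) else p]
    simp only [consPerm_zero, consPerm_succ, prod_succAbove_inversions,
      Fin.succAbove_lt_succAbove_iff]
  have hcond : m ∘ consPerm (r, w) = m ↔ m r = m 0 ∧ (fun i => m i.succ) ∘ w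
      = fun i => m i.succ := by
    -- m is constant on the indices from 0 to r, so omitting the index r or the index 0 leaves the
    -- same sequence.
    have hstep : m r = m 0 → ∀ j : Fin n, m (r.succAbove j) = m j.succ := by
      intro hr j
      rcases lt_or_ge j.castSucc r with h | h
      · rw [Fin.succAbove_of_castSucc_lt _ _ h]
        have h1 : m j.castSucc = m 0 := le_antisymm ((hm h.le).trans hr.le) (hm (Fin.zero_le _))
        have h2 : m j.succ = m 0 := le_antisymm
          ((hm (Fin.castSucc_lt_iff_succ_le.mp h)).trans hr.le) (hm (Fin.zero_le _))
        rw [h1, h2]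
      · rw [Fin.succAbove_of_le_castSucc _ _ h]
    constructor
    · intro h
      have h0 : m r = m 0 := congrFun h 0
      refine ⟨h0, funext fun i => ?_⟩
      have := congrFun h i.succ
      simp only [Function.comp_apply, consPerm_succ] at this
      rw [hstep h0] at this
      exact this
    · rintro ⟨h0, h⟩
      funext i
      refine Fin.cases h0 (fun i => ?_) i
      simp only [Function.comp_apply, consPerm_succ]
      rw [hstep h0]
      exact congrFun h i
  simp only [Equiv.ofBijective_apply, hprod, hcond]
  by_cases h1 : m r = m 0 <;> by_cases h2 : (fun i => m i.succ) ∘ w = fun i => m i.succ <;>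
    simp [h1, h2]

/-- `∏_k (s(k))_p!` over the multiplicities of the elements of `s`. -/
def multFactorial (p : ℂ) (s : Multiset ℤ) : ℂ := ∏ k ∈ s.toFinset, qFactorial p (s.count k)

theorem qFactorial_zero (p : ℂ) : qFactorial p 0 = 1 := by simp [qFactorial]

theorem qFactorial_succ (p : ℂ) (n : ℕ) :
    qFactorial p (n + 1) = qFactorial p n * ∑ i ∈ Finset.range (n + 1), p ^ i := by
  rw [qFactorial, Finset.prod_range_succ, ← qFactorial]

theorem multFactorial_eq (p : ℂ) (s : Multiset ℤ) (T : Finset ℤ) (h : s.toFinset ⊆ T) :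
    multFactorial p s = ∏ k ∈ T, qFactorial p (s.count k) := by
  refine Finset.prod_subset h fun k _ hk => ?_
  rw [Multiset.count_eq_zero_of_notMem (by simpa using hk), qFactorial_zero]

theorem multFactorial_cons (p : ℂ) (a : ℤ) (s : Multiset ℤ) :
    multFactorial p (a ::ₘ s)
      = (∑ i ∈ Finset.range (s.count a + 1), p ^ i) * multFactorial p s := by
  have ha : a ∈ insert a s.toFinset := Finset.mem_insert_self _ _
  rw [multFactorial_eq p (a ::ₘ s) (insert a s.toFinset) (by simp),
    multFactorial_eq p s (insert a s.toFinset) (Finset.subset_insert _ _),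
    ← Finset.mul_prod_erase _ _ ha, ← Finset.mul_prod_erase _ _ ha,
    Multiset.count_cons_self, qFactorial_succ]
  have : ∏ k ∈ (insert a s.toFinset).erase a, qFactorial p ((a ::ₘ s).count k)
      = ∏ k ∈ (insert a s.toFinset).erase a, qFactorial p (s.count k) :=
    Finset.prod_congr rfl fun k hk => by
      rw [Multiset.count_cons_of_ne (Finset.ne_of_mem_erase hk)]
  rw [this]; ring

/-- By monotonicity the block of 0 is an initial segment, so the sum is a p-integer. -/
theorem sum_pow_initial (p : ℂ) {m : Fin (n + 1) → ℤ} (hm : Monotone m) :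
    ∑ r : Fin (n + 1), (if m r = m 0 then p ^ (r : ℕ) else 0) =
      ∑ i ∈ Finset.range ((Finset.univ.filter fun r => m r = m 0).card), p ^ i := by
  rw [← Finset.sum_filter]
  set S := Finset.univ.filter fun r => m r = m 0 with hS
  have hT : S.map Fin.valEmbedding = Finset.range S.card := by
    refine Finset.eq_of_subset_of_card_le (fun t ht => ?_) (by simp)
    obtain ⟨r, hr, rfl⟩ := Finset.mem_map.mp ht
    have hr' : m r = m 0 := by simpa [hS] using hr
    have hsub : Finset.Iic r ⊆ S := fun j hj => by
      have := hm (Finset.mem_Iic.mp hj)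
      simp only [hS, Finset.mem_filter, Finset.mem_univ, true_and]
      exact le_antisymm (this.trans hr'.le) (hm (Fin.zero_le _))
    have := Finset.card_le_card hsub
    rw [Fin.card_Iic] at this
    simpa using this
  rw [← hT, Finset.sum_map]; rfl

/-- The stabilizer sum of a monotone exponent is a product of `p`-factorials. -/
theorem kappa_eq (p : ℂ) {m : Fin n → ℤ} (hm : Monotone m) :
    kappa p m = multFactorial p (Multiset.map m Finset.univ.val) := by
  induction n with
  | zero =>
    have hw : ∀ w : Equiv.Perm (Fin 0), m ∘ w = m := fun w => Subsingleton.elim _ _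
    have hp : pairs 0 = ∅ := by ext ij; exact ij.1.elim0
    simp [kappa, multFactorial, hw, hp]
  | succ n ih =>
    have hcons : Multiset.map m Finset.univ.val
        = m 0 ::ₘ Multiset.map (fun i : Fin n => m i.succ) Finset.univ.val := by
      rw [Fin.univ_succ]; simp [Function.comp_def]
    rw [kappa_succ p hm, ih (m := fun i => m i.succ) fun i j h => hm (Fin.succ_le_succ_iff.mpr h),
      sum_pow_initial p hm, hcons, multFactorial_cons]
    congr 3
    have h1 : (Finset.univ.filter fun r => m r = m 0).card
        = Multiset.count (m 0) (Multiset.map m Finset.univ.val) := by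
      rw [Multiset.count_map]
      simp only [Finset.card_def, Finset.filter_val, eq_comm]
    rw [h1, hcons, Multiset.count_cons_self]

/-- A vanishing p-integer would give p^j = 1, by the geometric sum. -/
theorem qFactorial_ne_zero {p : ℂ} (hp : ∀ n : ℕ, 0 < n → p ^ n ≠ 1) (n : ℕ) :
    qFactorial p n ≠ 0 := by
  refine Finset.prod_ne_zero_iff.mpr fun j _ h => hp (j + 1) (Nat.succ_pos j) ?_
  have := geom_sum_mul p (j + 1)
  rw [h, zero_mul] at this
  exact (sub_eq_zero.mp this.symm)

theorem multFactorial_ne_zero {p : ℂ} (hp : ∀ n : ℕ, 0 < n → p ^ n ≠ 1) (s : Multiset ℤ) :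
    multFactorial p s ≠ 0 :=
  Finset.prod_ne_zero_iff.mpr fun _ _ => qFactorial_ne_zero hp _

end QuantumAffine

end

noncomputable section

namespace QuantumAffine

/-! ### Contour integrals -/

namespace Contour

variable {C : Contour} {F G : ℂ → ℂ}

theorem mem_support_of {γ : ClosedCurve} (hγ : γ ∈ Finsupp.support C) {t : ℝ}
    (ht : t ∈ Set.uIcc (0 : ℝ) 1) : γ.toFun t ∈ C.support :=
  ⟨γ, hγ, t, by rwa [Set.uIcc_of_le zero_le_one] at ht, rfl⟩

theorem integral_congr (h : ∀ z ∈ C.support, F z = G z) : C.integral F = C.integral G := by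
  refine Finset.sum_congr rfl fun γ hγ => ?_
  refine congrArg ((C γ : ℂ) * ·) (intervalIntegral.integral_congr fun t ht => ?_)
  simp only [h _ (mem_support_of hγ ht)]

theorem intervalIntegrable (hF : ContinuousOn F C.support) {γ : ClosedCurve}
    (hγ : γ ∈ Finsupp.support C) :
    IntervalIntegrable (fun t => F (γ.toFun t) * deriv γ.toFun t) MeasureTheory.volume 0 1 := by
  refine ContinuousOn.intervalIntegrable (ContinuousOn.mul ?_ ?_)
  · exact hF.comp γ.contDiff.continuous.continuousOn fun t ht => mem_support_of hγ ht
  · exact (γ.contDiff.continuous_deriv le_rfl).continuousOn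

theorem integral_add (hF : ContinuousOn F C.support) (hG : ContinuousOn G C.support) :
    (C.integral fun z => F z + G z) = C.integral F + C.integral G := by
  rw [integral, integral, integral, Finsupp.sum, Finsupp.sum, Finsupp.sum,
    ← Finset.sum_add_distrib]
  refine Finset.sum_congr rfl fun γ hγ => ?_
  rw [← mul_add, ← intervalIntegral.integral_add (intervalIntegrable hF hγ)
    (intervalIntegrable hG hγ)]
  congr 2; funext t; ring

theorem integral_const_mul (c : ℂ) (F : ℂ → ℂ) :
    (C.integral fun z => c * F z) = c * C.integral F := by
  rw [integral, integral, Finsupp.sum, Finsupp.sum, Finset.mul_sum]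
  refine Finset.sum_congr rfl fun γ _ => ?_
  simp only [mul_assoc]
  rw [mul_left_comm, intervalIntegral.integral_const_mul]

theorem integral_sub (hF : ContinuousOn F C.support) (hG : ContinuousOn G C.support) :
    (C.integral fun z => F z - G z) = C.integral F - C.integral G := by
  have := integral_add hF hG.neg
  have h2 := integral_const_mul (C := C) (-1) G
  simp only [neg_one_mul] at h2
  rw [sub_eq_add_neg, ← h2]
  simp only [sub_eq_add_neg]
  exact this

theorem integral_zero : (C.integral fun _ => 0) = 0 := by
  simp [integral]

theorem integral_eq_zero_of_hasDerivAt {Φ : ℂ → ℂ} (hF : ContinuousOn F C.support)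
    (h : ∀ z ∈ C.support, HasDerivAt Φ (F z) z) : C.integral F = 0 := by
  refine Finset.sum_eq_zero fun γ hγ => ?_
  have h1 : ∫ t in (0 : ℝ)..1, F (γ.toFun t) * deriv γ.toFun t
      = Φ (γ.toFun 1) - Φ (γ.toFun 0) := by
    refine intervalIntegral.integral_eq_sub_of_hasDerivAt (f := fun t => Φ (γ.toFun t))
      (fun t ht => ?_) (intervalIntegrable hF hγ)
    have hd : HasDerivAt γ.toFun (deriv γ.toFun t) t :=
      ((γ.contDiff.differentiable one_ne_zero) t).hasDerivAt
    exact (h _ (mem_support_of hγ ht)).comp t hd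
  simp only [h1, γ.closed, sub_self, mul_zero]

theorem integral_inv_sub (p : ℂ) :
    (C.integral fun z => (z - p)⁻¹) = 2 * (Real.pi : ℂ) * Complex.I * C.winding p := by
  rw [winding, mul_inv_cancel_left₀ Complex.two_pi_I_ne_zero]

theorem continuousOn_prod_inv {L : Multiset ℂ} (hL : ∀ p ∈ L, p ∉ C.support) :
    ContinuousOn (fun z => (L.map fun p => (z - p)⁻¹).prod) C.support := by
  induction L using Multiset.induction_on with
  | empty => simpa using continuousOn_const
  | cons p L ih =>
    simp only [Multiset.map_cons, Multiset.prod_cons]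
    refine ContinuousOn.mul (ContinuousOn.inv₀ (by fun_prop) fun z hz h => ?_)
      (ih fun p' hp' => hL p' (Multiset.mem_cons_of_mem hp'))
    exact hL p (Multiset.mem_cons_self _ _) (by rwa [← sub_eq_zero.mp h])

/-- The integral of a product of at least two simple fractions whose poles have the same winding
number vanishes. -/
theorem integral_prod_inv_eq_zero (ω : ℂ) (L : Multiset ℂ)
    (hL : ∀ p ∈ L, p ∉ C.support ∧ C.winding p = ω) (h2 : 2 ≤ L.card) :
    (C.integral fun z => (L.map fun p => (z - p)⁻¹).prod) = 0 := by
  induction hn : L.card using Nat.strong_induction_on generalizing L with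
  | _ N ih =>
  -- Two distinct poles are split by partial fractions, which lowers the number of factors. With two
  -- factors the result is a difference of equal winding numbers.
  by_cases hall : ∃ p ∈ L, ∃ p' ∈ L, p ≠ p'
  · obtain ⟨p, hp, p', hp', hne⟩ := hall
    obtain ⟨L1, rfl⟩ := Multiset.exists_cons_of_mem hp
    obtain ⟨L2, rfl⟩ := Multiset.exists_cons_of_mem
      ((Multiset.mem_cons.mp hp').resolve_left hne.symm)
    have hmem : ∀ x ∈ p ::ₘ L2, x ∉ C.support ∧ C.winding x = ω := fun x hx => hL x <| by
      rcases Multiset.mem_cons.mp hx with rfl | hx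
      · simp
      · simp [hx]
    have hmem' : ∀ x ∈ p' ::ₘ L2, x ∉ C.support ∧ C.winding x = ω := fun x hx => hL x <| by
      rcases Multiset.mem_cons.mp hx with rfl | hx
      · simp
      · simp [hx]
    have key : (C.integral fun z => (((p ::ₘ p' ::ₘ L2).map fun p => (z - p)⁻¹).prod)) =
        (p - p')⁻¹ * ((C.integral fun z => ((p ::ₘ L2).map fun p => (z - p)⁻¹).prod) -
          C.integral fun z => ((p' ::ₘ L2).map fun p => (z - p)⁻¹).prod) := by
      rw [← integral_sub (continuousOn_prod_inv fun x hx => (hmem x hx).1)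
        (continuousOn_prod_inv fun x hx => (hmem' x hx).1), ← integral_const_mul]
      refine integral_congr fun z hz => ?_
      have h1 : z - p ≠ 0 := fun h => (hL p (by simp)).1 (by rwa [← sub_eq_zero.mp h])
      have h3 : z - p' ≠ 0 := fun h => (hL p' (by simp)).1 (by rwa [← sub_eq_zero.mp h])
      have h4 : p - p' ≠ 0 := sub_ne_zero.mpr hne
      simp only [Multiset.map_cons, Multiset.prod_cons]
      field_simp
      ring
    rw [key]
    rcases Nat.lt_or_ge (L2.card + 1) 2 with hlt | hge
    · have : L2 = 0 := Multiset.card_eq_zero.mp (by omega)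
      subst this
      simp only [Multiset.map_cons, Multiset.prod_cons, Multiset.map_zero, Multiset.prod_zero,
        mul_one, integral_inv_sub]
      rw [(hL p (by simp)).2, (hL p' (by simp)).2]; simp
    · rw [ih (L2.card + 1) (by rw [← hn]; simp) (p ::ₘ L2) hmem (by simpa using hge) (by simp),
        ih (L2.card + 1) (by rw [← hn]; simp) (p' ::ₘ L2) hmem' (by simpa using hge) (by simp)]
      simp
  · push Not at hall
    obtain ⟨p, hp⟩ := Multiset.card_pos_iff_exists_mem.mp (by omega : 0 < L.card)
    have hrep : L = Multiset.replicate N p :=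
      Multiset.eq_replicate.mpr ⟨hn, fun b hb => hall b hb p hp⟩
    have hpC := (hL p hp).1
    -- A single pole of order N ≥ 2 has a primitive.
    refine integral_eq_zero_of_hasDerivAt
      (Φ := fun z => (1 - (N : ℂ))⁻¹ * (z - p) ^ (1 - (N : ℤ)))
      (continuousOn_prod_inv fun x hx => (hL x hx).1) fun z hz => ?_
    have h1 : z - p ≠ 0 := fun h => hpC (by rwa [← sub_eq_zero.mp h])
    have hd := ((hasDerivAt_zpow (1 - (N : ℤ)) (z - p) (Or.inl h1)).comp z
      ((hasDerivAt_id z).sub_const p)).const_mul (1 - (N : ℂ))⁻¹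
    refine hd.congr_deriv ?_
    have hN : (1 - (N : ℂ)) ≠ 0 := by
      rw [sub_ne_zero]
      have : N ≠ 1 := by omega
      exact_mod_cast this.symm
    rw [hrep, Multiset.map_replicate, Multiset.prod_replicate]
    push_cast
    rw [mul_one, ← mul_assoc, inv_mul_cancel₀ hN, one_mul,
      show (1 : ℤ) - N - 1 = -(N : ℤ) by ring, zpow_neg, zpow_natCast, inv_pow]

/-- The power is removed by z^{k+1} / (z - p) = z^k + p z^k / (z - p). Without it, a single pole
contributes its winding number 0 and several poles fall under `integral_prod_inv_eq_zero`. -/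
theorem integral_pow_mul_prod_inv_of_outside (k : ℕ) (L : Multiset ℂ) (hL : ∀ p ∈ L, C.Outside p) :
    (C.integral fun z => z ^ k * (L.map fun p => (z - p)⁻¹).prod) = 0 := by
  have hpow : ∀ k : ℕ, (C.integral fun z => z ^ k) = 0 := fun k => by
    refine integral_eq_zero_of_hasDerivAt (Φ := fun z => ((k : ℂ) + 1)⁻¹ * z ^ (k + 1))
      (by fun_prop) fun z _ => ?_
    have := (hasDerivAt_pow (k + 1) z).const_mul ((k : ℂ) + 1)⁻¹
    refine this.congr_deriv ?_
    have : (k : ℂ) + 1 ≠ 0 := by exact_mod_cast Nat.succ_ne_zero k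
    push_cast
    rw [← mul_assoc, inv_mul_cancel₀ this, one_mul]
  induction k generalizing L with
  | zero =>
    simp only [pow_zero, one_mul]
    rcases Nat.lt_or_ge L.card 2 with h | h
    · rcases Nat.lt_or_ge L.card 1 with h | h'
      · have : L = 0 := Multiset.card_eq_zero.mp (by omega)
        subst this; simpa using hpow 0
      · obtain ⟨p, rfl⟩ := Multiset.card_eq_one.mp (by omega : L.card = 1)
        simp only [Multiset.map_singleton, Multiset.prod_singleton, integral_inv_sub]
        rw [(hL p (by simp)).2, mul_zero]
    · exact integral_prod_inv_eq_zero 0 L hL h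
  | succ k ih =>
    induction L using Multiset.induction_on with
    | empty => simpa using hpow (k + 1)
    | cons p L _ =>
      have hL' : ∀ x ∈ L, C.Outside x := fun x hx => hL x (Multiset.mem_cons_of_mem hx)
      have key : (C.integral fun z => z ^ (k + 1) * ((p ::ₘ L).map fun p => (z - p)⁻¹).prod) =
          (C.integral fun z => z ^ k * (L.map fun p => (z - p)⁻¹).prod) +
          p * C.integral fun z => z ^ k * ((p ::ₘ L).map fun p => (z - p)⁻¹).prod := by
        rw [← integral_const_mul, ← integral_add]
        · refine integral_congr fun z hz => ?_
          have h1 : z - p ≠ 0 := fun h =>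
            (hL p (Multiset.mem_cons_self _ _)).1 (by rwa [← sub_eq_zero.mp h])
          simp only [Multiset.map_cons, Multiset.prod_cons]
          field_simp
          ring
        · exact ContinuousOn.mul (by fun_prop) (continuousOn_prod_inv fun x hx => (hL' x hx).1)
        · exact continuousOn_const.mul (ContinuousOn.mul (by fun_prop)
            (continuousOn_prod_inv fun x hx => (hL x hx).1))
      rw [key, ih L hL', ih (p ::ₘ L) hL]; simp

/-! ### Existence of contours -/

/-- The circle as a closed curve. -/
def circle (c : ℂ) (R : ℝ) : ClosedCurve where
  toFun t := circleMap c R (2 * Real.pi * t)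
  contDiff := (contDiff_circleMap c R).comp (contDiff_const.mul contDiff_id)
  closed := by simp [circleMap, Complex.exp_two_pi_mul_I]

theorem integral_single_circle (c : ℂ) (R : ℝ) (F : ℂ → ℂ) :
    integral (Finsupp.single (circle c R) 1) F = ∮ z in C(c, R), F z := by
  have hderiv : ∀ t : ℝ, deriv (circle c R).toFun t
      = (2 * Real.pi : ℝ) • deriv (circleMap c R) (2 * Real.pi * t) := by
    intro t
    have h1 : HasDerivAt (fun t : ℝ => 2 * Real.pi * t) (2 * Real.pi) t := by
      simpa using (hasDerivAt_id t).const_mul (2 * Real.pi)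
    have h2 := (hasDerivAt_circleMap c R (2 * Real.pi * t)).scomp t h1
    rw [deriv_circleMap]
    exact h2.deriv
  rw [integral, Finsupp.sum_single_index (by simp), circleIntegral]
  have h3 := intervalIntegral.smul_integral_comp_mul_left (a := 0) (b := 1)
    (fun θ => deriv (circleMap c R) θ • F (circleMap c R θ)) (2 * Real.pi)
  rw [mul_zero, mul_one] at h3
  rw [← h3, ← intervalIntegral.integral_smul]
  simp only [Int.cast_one, one_mul, hderiv]
  refine intervalIntegral.integral_congr fun t _ => ?_
  simp only [circle, smul_eq_mul, Complex.real_smul]; ring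

theorem mem_support_single_circle {c : ℂ} {R : ℝ} (hR : 0 ≤ R) {z : ℂ}
    (h : z ∈ support (Finsupp.single (circle c R) 1)) : dist z c = R := by
  obtain ⟨γ, hγ, t, _, rfl⟩ := h
  have : γ = circle c R := by
    have := Finsupp.support_single_subset hγ; simpa using this
  subst this
  simp [circle, hR, dist_eq_norm]

theorem winding_single_circle_self (c : ℂ) {R : ℝ} (hR : 0 < R) :
    winding (Finsupp.single (circle c R) 1) c = 1 := by
  rw [winding, integral_single_circle, circleIntegral.integral_sub_inv_of_mem_ball
    (Metric.mem_ball_self hR), inv_mul_cancel₀ Complex.two_pi_I_ne_zero]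

theorem winding_single_circle_of_lt {c p : ℂ} {R : ℝ} (hR : 0 < R) (h : R < dist p c) :
    winding (Finsupp.single (circle c R) 1) p = 0 := by
  have hne : ∀ z ∈ Metric.closedBall c R, z - p ≠ 0 := by
    intro z hz h0
    rw [sub_eq_zero] at h0; subst h0
    exact absurd (Metric.mem_closedBall.mp hz) (not_le.mpr h)
  rw [winding, integral_single_circle,
    Complex.circleIntegral_eq_zero_of_differentiable_on_off_countable hR.le Set.countable_empty,
    mul_zero]
  · exact ContinuousOn.inv₀ (by fun_prop) hne
  · intro z hz
    exact DifferentiableAt.inv (by fun_prop) (hne z (Metric.ball_subset_closedBall hz.1))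

theorem support_add_subset (C D : Contour) : (C + D).support ⊆ C.support ∪ D.support := by
  classical
  rintro z ⟨γ, hγ, t, ht, rfl⟩
  rcases Finset.mem_union.mp (Finsupp.support_add hγ) with h | h
  · exact Or.inl ⟨γ, h, t, ht, rfl⟩
  · exact Or.inr ⟨γ, h, t, ht, rfl⟩

theorem integral_add_contour (C D : Contour) (F : ℂ → ℂ) :
    (C + D).integral F = C.integral F + D.integral F := by
  classical
  refine Finsupp.sum_add_index' (fun γ => by simp) fun γ m k => ?_
  push_cast; ring

theorem winding_add_contour (C D : Contour) (p : ℂ) :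
    (C + D).winding p = C.winding p + D.winding p := by
  rw [winding, winding, winding, integral_add_contour, mul_add]

/-- A contour around the points of `A` that leaves the points of `B` outside. -/
theorem exists_contour (A B : Finset ℂ) (hAB : ∀ a ∈ A, ∀ b ∈ B, a ≠ b) :
    ∃ C : Contour, (∀ a ∈ A, C.Inside a) ∧ ∀ b ∈ B, C.Outside b := by
  classical
  -- The contour is the sum of the circles of radius ε around the points of A; ε is below all mutual
  -- distances, so each circle encloses only its centre.
  obtain ⟨ε, hε, hsep⟩ : ∃ ε : ℝ, 0 < ε ∧ ∀ x ∈ A ∪ B, ∀ y ∈ A ∪ B, x ≠ y → ε < dist x y := by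
    have : ∀ T : Finset (ℂ × ℂ), ∃ ε : ℝ, 0 < ε ∧ ∀ xy ∈ T, xy.1 ≠ xy.2 → ε < dist xy.1 xy.2 := by
      intro T
      induction T using Finset.induction_on with
      | empty => exact ⟨1, one_pos, by simp⟩
      | insert xy T _ ih =>
        obtain ⟨ε, hε, h⟩ := ih
        by_cases hxy : xy.1 = xy.2
        · refine ⟨ε, hε, fun u hu hne => ?_⟩
          rcases Finset.mem_insert.mp hu with rfl | hu
          · exact absurd hxy hne
          · exact h u hu hne
        · have hpos := dist_pos.mpr hxy
          refine ⟨min ε (dist xy.1 xy.2 / 2), lt_min hε (half_pos hpos), fun u hu hne => ?_⟩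
          rcases Finset.mem_insert.mp hu with rfl | hu
          · exact (min_le_right _ _).trans_lt (half_lt_self hpos)
          · exact (min_le_left _ _).trans_lt (h u hu hne)
    obtain ⟨ε, hε, h⟩ := this ((A ∪ B) ×ˢ (A ∪ B))
    exact ⟨ε, hε, fun x hx y hy => h (x, y) (Finset.mem_product.mpr ⟨hx, hy⟩)⟩
  have key : ∀ S ⊆ A, ∃ C : Contour, ∀ x ∈ A ∪ B, x ∉ C.support ∧
      C.winding x = if x ∈ S then 1 else 0 := by
    intro S hS
    induction S using Finset.induction_on with
    | empty => exact ⟨0, fun x _ => ⟨by rintro ⟨γ, hγ, _⟩; simp at hγ, by simp [winding, integral]⟩⟩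
    | insert a S ha ih =>
      obtain ⟨C, hC⟩ := ih ((Finset.subset_insert _ _).trans hS)
      have haA : a ∈ A ∪ B := Finset.mem_union_left _ (hS (Finset.mem_insert_self _ _))
      refine ⟨Finsupp.single (circle a ε) 1 + C, fun x hx => ⟨fun hmem => ?_, ?_⟩⟩
      · rcases support_add_subset _ _ hmem with h | h
        · have hd := mem_support_single_circle hε.le h
          rcases eq_or_ne x a with rfl | hne
          · rw [dist_self] at hd; exact hε.ne hd
          · exact (hsep x hx a haA hne).ne' hd
        · exact (hC x hx).1 h
      · rw [winding_add_contour, (hC x hx).2]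
        rcases eq_or_ne x a with rfl | hne
        · rw [winding_single_circle_self _ hε]; simp [ha]
        · rw [winding_single_circle_of_lt hε (hsep x hx a haA hne)]; simp [hne]
  obtain ⟨C, hC⟩ := key A subset_rfl
  refine ⟨C, fun a ha => ?_, fun b hb => ?_⟩
  · have := hC a (Finset.mem_union_left _ ha)
    exact ⟨this.1, by rw [this.2, if_pos ha]⟩
  · have := hC b (Finset.mem_union_right _ hb)
    exact ⟨this.1, by rw [this.2, if_neg fun h => hAB b h b hb rfl]⟩

end Contour

namespace ContourSystem

variable {n : ℕ}

/-- The contours are chosen from the outermost inwards. A point required to be both inside and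
outside the i-th contour would give z_j = q^{2(m+m')} z_k with m + m' ≤ 2^{i+1}. For j ≠ k this is
excluded by the condition on the contour of the smaller of the two indices, whose range of multiples
is at least twice as large; for j = k it would make q a root of unity. -/
theorem exists_admissible {q : ℂ} (hq0 : q ≠ 0) (hq : ∀ n : ℕ, 0 < n → q ^ n ≠ 1) (n : ℕ) :
    ∃ C : ContourSystem n, C.Admissible q := by
  classical
  let Good : (i : Fin n) → ({j : Fin n // i < j} → ℂ) → Contour → Prop := fun i z D =>
    D.Inside 0 ∧ ∀ j : {j : Fin n // i < j}, ∀ m : ℕ, 1 ≤ m → m ≤ 2 ^ (i : ℕ) →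
      D.Inside ((q ^ (2 * m))⁻¹ * z j) ∧ D.Outside (q ^ (2 * m) * z j)
  -- The zero cycle serves where no good contour exists; `main` shows that this does not happen when
  -- the outer variables lie on their contours.
  let C : ContourSystem n := fun i z => if h : ∃ D, Good i z D then h.choose else 0
  have hpow : ∀ m : ℕ, q ^ m ≠ 0 := fun m => pow_ne_zero m hq0
  have main : ∀ (d : ℕ) (i : Fin n), n - (i : ℕ) = d → ∀ z : Fin n → ℂ,
      (∀ j, i < j → z j ∈ (C.at' j z).support) → Good i (fun j => z j.1) (C.at' i z) := by
    intro d
    induction d using Nat.strong_induction_on with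
    | _ d ih =>
    intro i hd z hz
    have hgood : ∀ j, i < j → Good j (fun l => z l.1) (C.at' j z) := fun j hij =>
      ih (n - j) (by have := Fin.lt_def.mp hij; omega) j rfl z fun l hl => hz l (hij.trans hl)
    have hz0 : ∀ j, i < j → z j ≠ 0 := fun j hij h0 =>
      (hgood j hij).1.1 (h0 ▸ hz j hij)
    suffices hex : ∃ D, Good i (fun j => z j.1) D by
      have : C.at' i z = hex.choose := dif_pos hex
      rw [this]; exact hex.choose_spec
    have hle : ∀ {j : Fin n} {m m' : ℕ}, i < j → m ≤ 2 ^ (i : ℕ) → m' ≤ 2 ^ (i : ℕ) →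
        m + m' ≤ 2 ^ (j : ℕ) := by
      intro j m m' hij h1 h2
      calc m + m' ≤ 2 ^ (i : ℕ) + 2 ^ (i : ℕ) := add_le_add h1 h2
        _ = 2 ^ ((i : ℕ) + 1) := by ring
        _ ≤ 2 ^ (j : ℕ) := Nat.pow_le_pow_right two_pos hij
    let J := Finset.univ.filter fun j : Fin n => i < j
    let M := Finset.Icc 1 (2 ^ (i : ℕ))
    obtain ⟨D, hin, hout⟩ := Contour.exists_contour
      (insert 0 ((J ×ˢ M).image fun jm => (q ^ (2 * jm.2))⁻¹ * z jm.1))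
      ((J ×ˢ M).image fun jm => q ^ (2 * jm.2) * z jm.1) (by
        intro a ha b hb hab
        obtain ⟨⟨k, m'⟩, hkm, rfl⟩ := Finset.mem_image.mp hb
        simp only [J, M, Finset.mem_product, Finset.mem_filter, Finset.mem_univ, true_and,
          Finset.mem_Icc] at hkm
        rcases Finset.mem_insert.mp ha with rfl | ha
        · exact mul_ne_zero (hpow _) (hz0 k hkm.1) hab.symm
        · obtain ⟨⟨j, m⟩, hjm, rfl⟩ := Finset.mem_image.mp ha
          simp only [J, M, Finset.mem_product, Finset.mem_filter, Finset.mem_univ, true_and,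
            Finset.mem_Icc] at hjm
          simp only at hab
          have hab' : z j = q ^ (2 * (m + m')) * z k := by
            rw [inv_mul_eq_iff_eq_mul₀ (hpow _), ← mul_assoc, ← pow_add] at hab
            rw [hab]; congr 2; ring
          rcases lt_trichotomy j k with h | h | h
          · have := ((hgood j hjm.1).2 ⟨k, h⟩ (m + m') (by omega) (hle hjm.1 hjm.2.2 hkm.2.2)).2.1
            exact this (by rw [← hab']; exact hz j hjm.1)
          · subst h
            have h1 : q ^ (2 * (m + m')) = 1 := by
              have := hab'.symm
              exact (mul_eq_right₀ (hz0 j hjm.1)).mp this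
            exact hq _ (by omega) h1
          · have := ((hgood k hkm.1).2 ⟨j, h⟩ (m + m') (by omega) (hle hkm.1 hjm.2.2 hkm.2.2)).1.1
            refine this ?_
            simp only
            rw [hab', inv_mul_cancel_left₀ (hpow _)]
            exact hz k hkm.1)
    refine ⟨D, hin 0 (Finset.mem_insert_self _ _), fun j m h1 h2 => ⟨hin _ ?_, hout _ ?_⟩⟩
    · refine Finset.mem_insert_of_mem (Finset.mem_image.mpr ⟨(j.1, m), ?_, rfl⟩)
      simp [J, M, h1, h2, j.2]
    · refine Finset.mem_image.mpr ⟨(j.1, m), ?_, rfl⟩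
      simp [J, M, h1, h2, j.2]
  refine ⟨C, fun i z hz => ?_⟩
  have := main _ i rfl z hz
  exact ⟨this.1, fun j hij m h1 h2 => this.2 ⟨j, hij⟩ m h1 h2⟩

end ContourSystem

end QuantumAffine

end

noncomputable section

namespace QuantumAffine

variable {n : ℕ}

/-! ### Iterated integrals of rational functions by partial fractions -/

/-- The data of a term `c ∏ z_i ^ (-a_i) ∏ (z_i - t ^ m z_j)⁻¹`. -/
structure Term (n : ℕ) where
  coef : ℂ
  exp : Fin n → ℤ
  den : List (Fin n × Fin n × ℕ)

namespace Term

section Eval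

variable {K : Type*} [Field K] [Algebra ℂ K]

/-- `(z_i - t ^ m z_j)⁻¹`. -/
def fac (t : ℂ) (z : Fin n → K) (d : Fin n × Fin n × ℕ) : K :=
  (z d.1 - algebraMap ℂ K (t ^ d.2.2) * z d.2.1)⁻¹

/-- The value of a term. -/
def eval (t : ℂ) (τ : Term n) (z : Fin n → K) : K :=
  algebraMap ℂ K τ.coef * monoAt z τ.exp * (τ.den.map (fac t z)).prod

/-- The value of a sum of terms. -/
def evalSum (t : ℂ) (L : List (Term n)) (z : Fin n → K) : K := (L.map fun τ => τ.eval t z).sum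

theorem evalSum_append (t : ℂ) (L L' : List (Term n)) (z : Fin n → K) :
    evalSum t (L ++ L') z = evalSum t L z + evalSum t L' z := by
  simp [evalSum]

/-- A term `r` in the variables other than `z_u`, multiplied by
`z_u ^ N ∏ (z_u - t ^ m z_j)⁻¹ ∏ (z_i - t ^ m z_u)⁻¹`. -/
def sep (t : ℂ) (u : Fin n) (r : Term n) (N : ℤ) (ins outs : List (Fin n × ℕ)) (z : Fin n → K) :
    K :=
  r.eval t z * z u ^ N * (ins.map fun jm => fac t z (u, jm)).prod *
    (outs.map fun im => fac t z (im.1, u, im.2)).prod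

end Eval

/-- Multiplication of a term by a constant. -/
def mulC (r : Term n) (c : ℂ) : Term n := { r with coef := r.coef * c }

/-- Multiplication of a term by the monomial `∏ z_i ^ (-a_i)`. -/
def mulMono (r : Term n) (a : Fin n → ℤ) : Term n := { r with exp := r.exp + a }

/-- Multiplication of a term by a factor `(z_i - t ^ m z_j)⁻¹`. -/
def mulFac (r : Term n) (d : Fin n × Fin n × ℕ) : Term n := { r with den := d :: r.den }

/-- The term contains the variables in `U` only, and its denominators are `z_i - t ^ m z_j` with
`i < j` and `1 ≤ m ≤ M`. -/
def Valid (U : Finset (Fin n)) (M : ℕ) (τ : Term n) : Prop :=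
  (∀ i, i ∉ U → τ.exp i = 0) ∧
    ∀ d ∈ τ.den, d.1 ∈ U ∧ d.2.1 ∈ U ∧ d.1 < d.2.1 ∧ 1 ≤ d.2.2 ∧ d.2.2 ≤ M

theorem Valid.mulC {U : Finset (Fin n)} {M : ℕ} {r : Term n} (h : r.Valid U M) (c : ℂ) :
    (r.mulC c).Valid U M := h

theorem Valid.mulMono {U : Finset (Fin n)} {M : ℕ} {r : Term n} (h : r.Valid U M)
    {a : Fin n → ℤ} (ha : ∀ i, i ∉ U → a i = 0) : (r.mulMono a).Valid U M :=
  ⟨fun i hi => by simp [Term.mulMono, h.1 i hi, ha i hi], h.2⟩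

theorem Valid.mulFac {U : Finset (Fin n)} {M : ℕ} {r : Term n} (h : r.Valid U M)
    {d : Fin n × Fin n × ℕ} (hd : d.1 ∈ U ∧ d.2.1 ∈ U ∧ d.1 < d.2.1 ∧ 1 ≤ d.2.2 ∧ d.2.2 ≤ M) :
    (r.mulFac d).Valid U M :=
  ⟨h.1, fun e he => by
    rcases List.mem_cons.mp he with rfl | he
    · exact hd
    · exact h.2 e he⟩

/-- The variables and the differences that occur as denominators are nonzero. -/
structure Nonvanishing {K : Type*} [Field K] [Algebra ℂ K] (t : ℂ) (U : Finset (Fin n)) (M : ℕ)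
    (u : Fin n) (z : Fin n → K) : Prop where
  self : z u ≠ 0
  var : ∀ j ∈ U, z j ≠ 0
  ins : ∀ j ∈ U, ∀ m, 1 ≤ m → m ≤ M → u < j → z u - algebraMap ℂ K (t ^ m) * z j ≠ 0
  outs : ∀ i ∈ U, ∀ m, 1 ≤ m → m ≤ M → i < u → z i - algebraMap ℂ K (t ^ m) * z u ≠ 0
  rest : ∀ i ∈ U, ∀ j ∈ U, ∀ m, 1 ≤ m → m ≤ 2 * M → i < j → z i - algebraMap ℂ K (t ^ m) * z j ≠ 0

/-- The contour for the variable `z_u` separates the poles. -/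
structure Separates (t : ℂ) (U : Finset (Fin n)) (M : ℕ) (y : Fin n → ℂ) (C : Contour) : Prop where
  zero : C.Inside 0
  var : ∀ j ∈ U, y j ≠ 0
  ins : ∀ j ∈ U, ∀ m, 1 ≤ m → m ≤ M → C.Inside (t ^ m * y j)
  outs : ∀ i ∈ U, ∀ m, 1 ≤ m → m ≤ M → C.Outside ((t ^ m)⁻¹ * y i)
  rest : ∀ i ∈ U, ∀ j ∈ U, ∀ m, 1 ≤ m → m ≤ 2 * M → i < j → y i - t ^ m * y j ≠ 0

/-! ### Integration of one term over one variable -/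

section Step

variable {t : ℂ} {U : Finset (Fin n)} {M : ℕ} {u : Fin n}

/-- Every algebraic identity below is proved over an arbitrary field under `Nonvanishing` and used
twice: in `Ser n` for constant coefficients, and in ℂ on the contour for integrals. -/
theorem nonvanishing_Z : Nonvanishing t U M u (Ser.Z (n := n)) where
  self := Ser.Z_ne_zero u
  var j _ := Ser.Z_ne_zero j
  ins _ _ _ _ _ h := Z_sub_C_Z_ne_zero _ h
  outs _ _ _ _ _ h := Z_sub_C_Z_ne_zero _ h
  rest _ _ _ _ _ _ _ h := Z_sub_C_Z_ne_zero _ h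

theorem Separates.nonvanishing (ht : t ≠ 0) (hu : u ∉ U) {y : Fin n → ℂ} {C : Contour}
    (h : Separates t U M y C) {ζ : ℂ} (hζ : ζ ∈ C.support) :
    Nonvanishing t U M u (Function.update y u ζ) := by
  have hne : ∀ j ∈ U, Function.update y u ζ j = y j := fun j hj =>
    Function.update_of_ne (ne_of_mem_of_not_mem hj hu) _ _
  have hs : Function.update y u ζ u = ζ := Function.update_self _ _ _
  refine ⟨?_, fun j hj => ?_, fun j hj m h1 h2 _ h0 => ?_, fun i hi m h1 h2 _ h0 => ?_,
    fun i hi j hj m h1 h2 hij => ?_⟩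
  · rw [hs]; rintro rfl; exact h.zero.1 hζ
  · rw [hne j hj]; exact h.var j hj
  · rw [hs, hne j hj] at h0
    exact (h.ins j hj m h1 h2).1 (by
      have : ζ = t ^ m * y j := sub_eq_zero.mp h0
      rwa [← this])
  · rw [hs, hne i hi] at h0
    exact (h.outs i hi m h1 h2).1 (by
      have : y i = t ^ m * ζ := sub_eq_zero.mp h0
      rwa [this, inv_mul_cancel_left₀ (pow_ne_zero m ht)])
  · rw [hne i hi, hne j hj]; exact h.rest i hi j hj m h1 h2 hij

theorem Valid.eval_update {M' : ℕ} {r : Term n} (h : r.Valid U M') (hu : u ∉ U) (y : Fin n → ℂ)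
    (ζ : ℂ) : r.eval t (Function.update y u ζ) = r.eval t y := by
  have hne : ∀ j ∈ U, Function.update y u ζ j = y j := fun j hj =>
    Function.update_of_ne (ne_of_mem_of_not_mem hj hu) _ _
  rw [eval, eval]
  congr 1
  · congr 1
    refine Finset.prod_congr rfl fun i _ => ?_
    by_cases hi : i ∈ U
    · rw [hne i hi]
    · rw [h.1 i hi]; simp
  · congr 1
    refine List.map_congr_left fun d hd => ?_
    rw [fac, fac, hne _ (h.2 d hd).1, hne _ (h.2 d hd).2.1]

/-- Lists of poles inside the contour of `z_u`. -/
def ValidIns (U : Finset (Fin n)) (M : ℕ) (u : Fin n) (ins : List (Fin n × ℕ)) : Prop :=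
  ∀ jm ∈ ins, jm.1 ∈ U ∧ u < jm.1 ∧ 1 ≤ jm.2 ∧ jm.2 ≤ M

/-- Lists of poles outside the contour of `z_u`. -/
def ValidOuts (U : Finset (Fin n)) (M : ℕ) (u : Fin n) (outs : List (Fin n × ℕ)) : Prop :=
  ∀ im ∈ outs, im.1 ∈ U ∧ im.1 < u ∧ 1 ≤ im.2 ∧ im.2 ≤ M

theorem continuousOn_sep (ht : t ≠ 0) (hu : u ∉ U) {y : Fin n → ℂ} {C : Contour}
    (h : Separates t U M y C) {r : Term n}
    {M' : ℕ} (hr : r.Valid U M') (N : ℤ) {ins outs : List (Fin n × ℕ)} (hi : ValidIns U M u ins)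
    (ho : ValidOuts U M u outs) :
    ContinuousOn (fun ζ => sep t u r N ins outs (Function.update y u ζ) * ζ⁻¹) C.support := by
  have hfac : ∀ {d : Fin n × Fin n × ℕ}, (∀ ζ ∈ C.support, Function.update y u ζ d.1 -
      algebraMap ℂ ℂ (t ^ d.2.2) * Function.update y u ζ d.2.1 ≠ 0) →
      ContinuousOn (fun ζ => fac t (Function.update y u ζ) d) C.support := by
    intro d hd
    refine ContinuousOn.inv₀ ?_ hd
    have hcont : ∀ i, Continuous fun ζ => Function.update y u ζ i := fun i =>
      (continuous_apply i).comp
        ((continuous_const (y := y)).update u continuous_id : Continuous (Function.update y u))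
    exact ((hcont _).sub (continuous_const.mul (hcont _))).continuousOn
  have h0 : ∀ ζ ∈ C.support, ζ ≠ 0 := fun ζ hζ h0 => h.zero.1 (h0 ▸ hζ)
  have hlist : ∀ (l : List (Fin n × ℕ)) (f : Fin n × ℕ → ℂ → ℂ),
      (∀ x ∈ l, ContinuousOn (f x) C.support) →
      ContinuousOn (fun ζ => (l.map fun x => f x ζ).prod) C.support := by
    intro l f hf
    induction l with
    | nil => simpa using continuousOn_const
    | cons x l ih =>
      simp only [List.map_cons, List.prod_cons]
      exact (hf x (by simp)).mul (ih fun y hy => hf y (List.mem_cons_of_mem _ hy))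
  refine ContinuousOn.mul (ContinuousOn.mul (ContinuousOn.mul (ContinuousOn.mul ?_ ?_) ?_) ?_)
    (continuousOn_id.inv₀ h0)
  · simp only [hr.eval_update hu]; exact continuousOn_const
  · simp only [Function.update_self]
    exact continuousOn_id.zpow₀ N fun ζ hζ => Or.inl (h0 ζ hζ)
  · refine hlist ins (fun jm ζ => fac t (Function.update y u ζ) (u, jm)) fun jm hjm =>
      hfac fun ζ hζ => ?_
    obtain ⟨h1, h2, h3, h4⟩ := hi jm hjm
    exact (h.nonvanishing ht hu hζ).ins _ h1 _ h3 h4 h2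
  · refine hlist outs (fun im ζ => fac t (Function.update y u ζ) (im.1, u, im.2)) fun im him =>
      hfac fun ζ hζ => ?_
    obtain ⟨h1, h2, h3, h4⟩ := ho im him
    exact (h.nonvanishing ht hu hζ).outs _ h1 _ h3 h4 h2

/-- The result `L` of integrating a term over `z_u`: it has the same constant coefficient, and its
values are the contour integrals. -/
def IsIntegral (t : ℂ) (U : Finset (Fin n)) (M : ℕ) (u : Fin n)
    (x : Ser n) (X : (Fin n → ℂ) → ℂ) (L : List (Term n)) : Prop :=
  (∀ τ ∈ L, τ.Valid U (2 * M)) ∧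
  x.coeff 0 = (evalSum t L (Ser.Z (n := n))).coeff 0 ∧
  ∀ (y : Fin n → ℂ) (C : Contour), Separates t U M y C →
    (C.integral fun ζ => X (Function.update y u ζ) * ζ⁻¹)
      = 2 * (Real.pi : ℂ) * Complex.I * evalSum t L y

/-- Integration is compatible with a decomposition into two terms. -/
theorem exists_isIntegral_of_eq_add {r r₁ r₂ : Term n} {N N₁ N₂ : ℤ}
    {ins ins₁ ins₂ outs outs₁ outs₂ : List (Fin n × ℕ)}
    (ht : t ≠ 0) (hu : u ∉ U)
    (hr₁ : r₁.Valid U (2 * M)) (hr₂ : r₂.Valid U (2 * M))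
    (hi₁ : ValidIns U M u ins₁) (hi₂ : ValidIns U M u ins₂)
    (ho₁ : ValidOuts U M u outs₁) (ho₂ : ValidOuts U M u outs₂)
    (hX : ∀ {K : Type} [Field K] [Algebra ℂ K] (z : Fin n → K), Nonvanishing t U M u z →
      sep t u r N ins outs z = sep t u r₁ N₁ ins₁ outs₁ z + sep t u r₂ N₂ ins₂ outs₂ z)
    (h₁ : ∃ L, IsIntegral t U M u (sep t u r₁ N₁ ins₁ outs₁ Ser.Z) (sep t u r₁ N₁ ins₁ outs₁) L)
    (h₂ : ∃ L, IsIntegral t U M u (sep t u r₂ N₂ ins₂ outs₂ Ser.Z) (sep t u r₂ N₂ ins₂ outs₂) L) :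
    ∃ L, IsIntegral t U M u (sep t u r N ins outs Ser.Z) (sep t u r N ins outs) L := by
  obtain ⟨L₁, hv₁, hc₁, hI₁⟩ := h₁
  obtain ⟨L₂, hv₂, hc₂, hI₂⟩ := h₂
  refine ⟨L₁ ++ L₂, fun τ hτ => ?_, ?_, fun y C h => ?_⟩
  · rcases List.mem_append.mp hτ with h | h
    · exact hv₁ τ h
    · exact hv₂ τ h
  -- The decomposition is read in the field of series here, and at the points of the contour in the
  -- next case.
  · rw [hX _ nonvanishing_Z, HahnSeries.coeff_add, hc₁, hc₂, evalSum_append, HahnSeries.coeff_add]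
  · rw [evalSum_append, mul_add, ← hI₁ y C h, ← hI₂ y C h, ← Contour.integral_add
      (continuousOn_sep ht hu h hr₁ N₁ hi₁ ho₁) (continuousOn_sep ht hu h hr₂ N₂ hi₂ ho₂)]
    refine Contour.integral_congr fun ζ hζ => ?_
    rw [hX _ (h.nonvanishing ht hu hζ), add_mul]

/-! Supports of the constituents of a term. -/

theorem suppIn_mono {S : Set (Fin n → ℤ)} {a : Fin n → ℤ} (ha : a ∈ S) :
    SuppIn S (Ser.mono a) := by
  intro b hb
  rw [Ser.coeff_mono] at hb
  by_cases h : b = a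
  · rwa [h]
  · exact absurd (if_neg h) hb

theorem suppIn_list_prod {ι : Type*} {S : AddSubmonoid (Fin n → ℤ)} (l : List ι) (f : ι → Ser n)
    (hf : ∀ x ∈ l, SuppIn (S : Set (Fin n → ℤ)) (f x)) :
    SuppIn (S : Set (Fin n → ℤ)) (l.map f).prod := by
  induction l with
  | nil => simpa using SuppIn.one S
  | cons x l ih =>
    simp only [List.map_cons, List.prod_cons]
    exact (hf x (by simp)).mul (ih fun y hy => hf y (List.mem_cons_of_mem _ hy))

theorem suppIn_fac {S : AddSubmonoid (Fin n → ℤ)} {d : Fin n × Fin n × ℕ} (h : d.1 < d.2.1)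
    (h1 : (Pi.single d.1 1 : Fin n → ℤ) ∈ S)
    (h2 : (Pi.single d.1 1 - Pi.single d.2.1 1 : Fin n → ℤ) ∈ S) :
    SuppIn (S : Set (Fin n → ℤ)) (fac t (Ser.Z (n := n)) d) := by
  rw [fac, inv_Z_sub_C_Z _ h]
  exact (suppIn_mono h1).mul (suppIn_rootHom h h2 _)

theorem suppIn_C_mul {S : Set (Fin n → ℤ)} {x : Ser n} (h : SuppIn S x) (c : ℂ) :
    SuppIn S (algebraMap ℂ (Ser n) c * x) := by
  intro a ha
  rw [Ser.coeff_C_mul] at ha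
  exact h a (right_ne_zero_of_mul ha)

/-- Exponents with `a_u = 0`. -/
def freeOf (u : Fin n) : AddSubmonoid (Fin n → ℤ) where
  carrier := {a | a u = 0}
  zero_mem' := rfl
  add_mem' := fun {a b} ha hb => by
    have ha' : a u = 0 := ha
    have hb' : b u = 0 := hb
    simp [ha', hb']

/-- Exponents with `a_u ≤ 0`. -/
def nonposAt (u : Fin n) : AddSubmonoid (Fin n → ℤ) where
  carrier := {a | a u ≤ 0}
  zero_mem' := le_refl (0 : ℤ)
  add_mem' := fun {a b} ha hb => by
    have ha' : a u ≤ 0 := ha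
    have hb' : b u ≤ 0 := hb
    exact add_nonpos ha' hb'

/-- Exponents with `0 ≤ a_u`. -/
def nonnegAt (u : Fin n) : AddSubmonoid (Fin n → ℤ) where
  carrier := {a | 0 ≤ a u}
  zero_mem' := le_refl (0 : ℤ)
  add_mem' := fun {a b} ha hb => by
    have ha' : 0 ≤ a u := ha
    have hb' : 0 ≤ b u := hb
    exact add_nonneg ha' hb'

theorem Valid.suppIn {M' : ℕ} {r : Term n} (h : r.Valid U M') (hu : u ∉ U) :
    SuppIn (freeOf u : Set (Fin n → ℤ)) (r.eval t (Ser.Z (n := n))) := by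
  have hne : ∀ {j : Fin n}, j ∈ U → u ≠ j := fun hj he => hu (he ▸ hj)
  rw [eval, mul_assoc]
  refine suppIn_C_mul (SuppIn.mul ?_ (suppIn_list_prod _ _ fun d hd => ?_)) _
  · rw [Ser.monoAt_Z]; exact suppIn_mono (h.1 u hu)
  · obtain ⟨h1, h2, h3, -⟩ := h.2 d hd
    refine suppIn_fac h3 ?_ ?_
    · exact Pi.single_eq_of_ne (hne h1) _
    · change (Pi.single d.1 1 - Pi.single d.2.1 1 : Fin n → ℤ) u = 0
      simp [Pi.single_eq_of_ne (hne h1), Pi.single_eq_of_ne (hne h2)]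

theorem Z_zpow (u : Fin n) (N : ℤ) : (Ser.Z u : Ser n) ^ N = Ser.mono (-N • Pi.single u 1) := by
  rw [Ser.Z, Ser.mono_zpow, smul_neg, neg_smul]

/-- The integral vanishes if all poles are outside. -/
theorem isIntegral_nil_of_outs (ht : t ≠ 0) (hu : u ∉ U) {r : Term n} (hr : r.Valid U (2 * M))
    {N : ℤ} (hN : 1 ≤ N) {outs : List (Fin n × ℕ)} (ho : ValidOuts U M u outs) :
    IsIntegral t U M u (sep t u r N [] outs Ser.Z) (sep t u r N [] outs) [] := by
  refine ⟨by simp, ?_, fun y C h => ?_⟩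
  -- Expanded for |z_i| ≫ |z_u|, the outer factors contain nonnegative powers of z_u only, so z_u
  -- occurs with exponent at least N ≥ 1 and the constant coefficient vanishes.
  · have h1 : SuppIn {a | a u ≤ -N} (sep t u r N [] outs (Ser.Z (n := n))) := by
      rw [sep, List.map_nil, List.prod_nil, mul_one]
      refine SuppIn.mul_set (S := {a | a u ≤ -N}) (T := (nonposAt u : Set (Fin n → ℤ)))
        (fun a ha b hb => ?_) (SuppIn.mul_set (S := (freeOf u : Set (Fin n → ℤ)))
          (T := {a | a u = -N}) (fun a ha b hb => ?_) (hr.suppIn hu) ?_)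
        (suppIn_list_prod _ _ fun im him => ?_)
      · have ha' : a u ≤ -N := ha
        have hb' : b u ≤ 0 := hb
        change a u + b u ≤ -N
        omega
      · have ha' : a u = 0 := ha
        have hb' : b u = -N := hb
        change a u + b u ≤ -N
        omega
      · rw [Z_zpow]; refine suppIn_mono ?_; simp
      · obtain ⟨h1, h2, -⟩ := ho im him
        refine suppIn_fac h2 ?_ ?_
        · change (Pi.single im.1 1 : Fin n → ℤ) u ≤ 0
          rw [Pi.single_eq_of_ne h2.ne']
        · change (Pi.single im.1 1 - Pi.single u 1 : Fin n → ℤ) u ≤ 0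
          simp [Pi.single_eq_of_ne h2.ne']
    by_contra hne
    have h2 := h1 0 (by simpa [evalSum] using hne)
    have h3 : (0 : ℤ) ≤ -N := h2
    omega
  -- Since N ≥ 1, the factor 1/ζ of the measure is absorbed and there is no pole at 0. The other
  -- poles are ζ = t^{-m} y_i, outside the contour.
  · have hrest : ∀ ζ ∈ C.support, sep t u r N [] outs (Function.update y u ζ) * ζ⁻¹ =
        (r.eval t y * (outs.map fun im => -(t ^ im.2)⁻¹).prod) * (ζ ^ (N - 1).toNat *
          (Multiset.map (fun p => (ζ - p)⁻¹)
            (outs.map fun im => (t ^ im.2)⁻¹ * y im.1 : List ℂ)).prod) := by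
      intro ζ hζ
      have hζ0 : ζ ≠ 0 := fun h0 => h.zero.1 (h0 ▸ hζ)
      have hpow : ζ ^ N * ζ⁻¹ = ζ ^ (N - 1).toNat := by
        rw [← zpow_natCast, Int.toNat_of_nonneg (by omega), zpow_sub_one₀ hζ0]
      have hprod : (outs.map fun im => fac t (Function.update y u ζ) (im.1, u, im.2)).prod =
          (outs.map fun im => -(t ^ im.2)⁻¹).prod *
            (outs.map fun im => (ζ - (t ^ im.2)⁻¹ * y im.1)⁻¹).prod := by
        rw [← List.prod_map_mul]
        congr 1
        refine List.map_congr_left fun im him => ?_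
        have hne : im.1 ≠ u := (ho im him).2.1.ne
        have htm : t ^ im.2 ≠ 0 := pow_ne_zero _ ht
        rw [fac]
        simp only [Function.update_self, Function.update_of_ne hne]
        change (y im.1 - t ^ im.2 * ζ)⁻¹ = _
        have : y im.1 - t ^ im.2 * ζ = -(t ^ im.2) * (ζ - (t ^ im.2)⁻¹ * y im.1) := by
          field_simp; ring
        rw [this, mul_inv, inv_neg]
      rw [sep, hprod, hr.eval_update hu, Function.update_self, ← hpow]
      simp only [List.map_nil, List.prod_nil, mul_one, Multiset.map_coe, Multiset.prod_coe,
        List.map_map, Function.comp_def]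
      ring
    rw [Contour.integral_congr hrest, Contour.integral_const_mul,
      Contour.integral_pow_mul_prod_inv_of_outside]
    · simp [evalSum]
    · intro p hp
      obtain ⟨im, him, rfl⟩ := List.mem_map.mp (Multiset.mem_coe.mp hp)
      obtain ⟨h1, -, h3, h4⟩ := ho im him
      exact h.outs _ h1 _ h3 h4

/-- The integral vanishes if all poles are inside and the integrand decays. -/
theorem isIntegral_nil_of_ins (hu : u ∉ U) {r : Term n} (hr : r.Valid U (2 * M))
    {N : ℤ} {ins : List (Fin n × ℕ)} (hN : N ≤ 0) (hN' : N < ins.length)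
    (hi : ValidIns U M u ins) :
    IsIntegral t U M u (sep t u r N ins [] Ser.Z) (sep t u r N ins []) [] := by
  refine ⟨by simp, ?_, fun y C h => ?_⟩
  -- Expanded for |z_u| ≫ |z_j|, every inner factor contains only powers z_u^{-k} with k ≥ 1, so the
  -- total power of z_u is negative.
  · have hlist : ∀ l : List (Fin n × ℕ), ValidIns U M u l → SuppIn {a | (l.length : ℤ) ≤ a u}
        (l.map fun jm => fac t (Ser.Z (n := n)) (u, jm)).prod := by
      intro l hl
      induction l with
      | nil =>
        simp only [List.map_nil, List.prod_nil, List.length_nil, Nat.cast_zero]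
        exact SuppIn.one (nonnegAt u)
      | cons jm l ih =>
        simp only [List.map_cons, List.prod_cons]
        have hjm := hl jm (by simp)
        have h1 : SuppIn {a | (1 : ℤ) ≤ a u} (fac t (Ser.Z (n := n)) (u, jm)) := by
          rw [fac, inv_Z_sub_C_Z _ hjm.2.1]
          refine SuppIn.mul_set (S := {a | a u = 1}) (T := (nonnegAt u : Set (Fin n → ℤ)))
            (fun a ha b hb => ?_) (suppIn_mono (by simp)) (suppIn_rootHom hjm.2.1 ?_ _)
          · have ha' : a u = 1 := ha
            have hb' : 0 ≤ b u := hb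
            change 1 ≤ a u + b u
            omega
          · change 0 ≤ (Pi.single u 1 - Pi.single jm.1 1 : Fin n → ℤ) u
            simp [Pi.single_eq_of_ne hjm.2.1.ne]
        refine h1.mul_set (fun a ha b hb => ?_) (ih fun x hx => hl x (List.mem_cons_of_mem _ hx))
        have ha' : 1 ≤ a u := ha
        have hb' : (l.length : ℤ) ≤ b u := hb
        change ((l.length + 1 : ℕ) : ℤ) ≤ a u + b u
        push_cast; omega
    have h1 : SuppIn {a | (ins.length : ℤ) - N ≤ a u} (sep t u r N ins [] (Ser.Z (n := n))) := by
      rw [sep, List.map_nil, List.prod_nil, mul_one]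
      refine SuppIn.mul_set (S := {a | a u = -N}) (T := {a | (ins.length : ℤ) ≤ a u})
        (fun a ha b hb => ?_) (SuppIn.mul_set (S := (freeOf u : Set (Fin n → ℤ)))
          (T := {a | a u = -N}) (fun a ha b hb => ?_) (hr.suppIn hu) ?_) (hlist ins hi)
      · have ha' : a u = -N := ha
        have hb' : (ins.length : ℤ) ≤ b u := hb
        change (ins.length : ℤ) - N ≤ a u + b u
        omega
      · have ha' : a u = 0 := ha
        have hb' : b u = -N := hb
        change a u + b u = -N
        omega
      · rw [Z_zpow]; refine suppIn_mono ?_; simp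
    by_contra hne
    have h2 := h1 0 (by simpa [evalSum] using hne)
    have h3 : (ins.length : ℤ) - N ≤ 0 := h2
    omega
  -- Together with the 1 - N factors at 0 there are at least two simple fractions, all with poles of
  -- winding number 1.
  · have hrest : ∀ ζ ∈ C.support, sep t u r N ins [] (Function.update y u ζ) * ζ⁻¹ =
        r.eval t y * (Multiset.map (fun p => (ζ - p)⁻¹) (Multiset.replicate (1 - N).toNat 0 +
          ((ins.map fun jm => t ^ jm.2 * y jm.1 : List ℂ) : Multiset ℂ))).prod := by
      intro ζ hζ
      have hζ0 : ζ ≠ 0 := fun h0 => h.zero.1 (h0 ▸ hζ)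
      have hpow : ζ ^ N * ζ⁻¹ = (ζ⁻¹) ^ (1 - N).toNat := by
        rw [← zpow_natCast, Int.toNat_of_nonneg (by omega), inv_zpow', ← zpow_sub_one₀ hζ0]
        congr 1; ring
      have hprod : (ins.map fun jm => fac t (Function.update y u ζ) (u, jm)).prod =
          (ins.map fun jm => (ζ - t ^ jm.2 * y jm.1)⁻¹).prod := by
        congr 1
        refine List.map_congr_left fun jm hjm => ?_
        have hne : jm.1 ≠ u := (hi jm hjm).2.1.ne'
        rw [fac]
        simp only [Function.update_self, Function.update_of_ne hne]
        rfl
      rw [sep, hprod, hr.eval_update hu, Function.update_self, Multiset.map_add,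
        Multiset.prod_add, Multiset.map_replicate, Multiset.prod_replicate, sub_zero, ← hpow]
      simp only [List.map_nil, List.prod_nil, mul_one, Multiset.map_coe, Multiset.prod_coe,
        List.map_map, Function.comp_def]
      ring
    rw [Contour.integral_congr hrest, Contour.integral_const_mul,
      Contour.integral_prod_inv_eq_zero 1]
    · simp [evalSum]
    · intro p hp
      rcases Multiset.mem_add.mp hp with hp | hp
      · rw [Multiset.eq_of_mem_replicate hp]; exact h.zero
      · obtain ⟨jm, hjm, rfl⟩ := List.mem_map.mp (Multiset.mem_coe.mp hp)
        obtain ⟨h1, -, h3, h4⟩ := hi jm hjm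
        exact h.ins _ h1 _ h3 h4
    · rw [Multiset.card_add, Multiset.card_replicate, Multiset.coe_card, List.length_map]
      omega

/-- The only case with a residue: the simple pole at 0 coming from dz/z. -/
theorem isIntegral_one {r : Term n} (hu : u ∉ U) (hr : r.Valid U (2 * M)) :
    IsIntegral t U M u (sep t u r 0 [] [] Ser.Z) (sep t u r 0 [] []) [r] := by
  refine ⟨by simpa using hr, by simp [sep, evalSum], fun y C h => ?_⟩
  have : ∀ ζ ∈ C.support, sep t u r 0 [] [] (Function.update y u ζ) * ζ⁻¹
      = r.eval t y * (ζ - 0)⁻¹ := by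
    intro ζ _; simp [sep, hr.eval_update hu]
  rw [Contour.integral_congr this, Contour.integral_const_mul, Contour.integral_inv_sub,
    h.zero.2]
  simp [evalSum, mul_comm]

end Step

end Term

end QuantumAffine

end

noncomputable section

namespace QuantumAffine

variable {n : ℕ}

/-! ### Reduction to the basic cases by partial fractions -/

namespace Term

/-- Multiplication of a term by `z_j ^ k`. -/
def mulVar (r : Term n) (j : Fin n) (k : ℤ) : Term n := r.mulMono (Pi.single j (-k))

theorem Valid.mulVar {U : Finset (Fin n)} {M : ℕ} {r : Term n} (h : r.Valid U M) {j : Fin n}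
    (hj : j ∈ U) (k : ℤ) : (r.mulVar j k).Valid U M :=
  h.mulMono fun _ hi => Pi.single_eq_of_ne (ne_of_mem_of_not_mem hj hi).symm _

section Eval

variable {K : Type*} [Field K] [Algebra ℂ K] (t : ℂ) (r : Term n) (z : Fin n → K)

theorem eval_mulC (c : ℂ) : (r.mulC c).eval t z = r.eval t z * algebraMap ℂ K c := by
  simp only [eval, mulC, map_mul]; ring

theorem eval_mulFac (d : Fin n × Fin n × ℕ) : (r.mulFac d).eval t z = r.eval t z * fac t z d := by
  simp only [eval, mulFac, List.map_cons, List.prod_cons]; ring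

theorem monoAt_add_single {K : Type*} [Field K] {z : Fin n → K} {j : Fin n} (hz : z j ≠ 0)
    (a : Fin n → ℤ) (k : ℤ) :
    monoAt z (a + Pi.single j (-k)) = monoAt z a * z j ^ k := by
  rw [monoAt, monoAt, ← Finset.mul_prod_erase _ _ (Finset.mem_univ j),
    ← Finset.mul_prod_erase _ (fun i => z i ^ (-a i)) (Finset.mem_univ j)]
  have : ∏ i ∈ Finset.univ.erase j, z i ^ (-(a + Pi.single j (-k) : Fin n → ℤ) i)
      = ∏ i ∈ Finset.univ.erase j, z i ^ (-a i) :=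
    Finset.prod_congr rfl fun i hi => by simp [Pi.single_eq_of_ne (Finset.ne_of_mem_erase hi)]
  rw [this, Pi.add_apply, Pi.single_eq_same, neg_add, neg_neg, zpow_add₀ hz]; ring

theorem eval_mulVar {z : Fin n → K} {j : Fin n} (hz : z j ≠ 0) (k : ℤ) :
    (r.mulVar j k).eval t z = r.eval t z * z j ^ k := by
  simp only [eval, mulVar, mulMono, monoAt_add_single hz]; ring

end Eval

section Step

variable {t : ℂ} {U : Finset (Fin n)} {M : ℕ} {u : Fin n}

/-- Expansion of one outer factor. -/
theorem exists_isIntegral_outs_cons (ht : t ≠ 0) (hu : u ∉ U) {r : Term n}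
    (hr : r.Valid U (2 * M)) {N : ℤ} {im : Fin n × ℕ} {ins outs : List (Fin n × ℕ)}
    (hi : ValidIns U M u ins) (ho : ValidOuts U M u (im :: outs))
    (h₁ : ∀ r : Term n, r.Valid U (2 * M) →
      ∃ L, IsIntegral t U M u (sep t u r N ins outs Ser.Z) (sep t u r N ins outs) L)
    (h₂ : ∀ r : Term n, r.Valid U (2 * M) → ∃ L, IsIntegral t U M u
      (sep t u r (N + 1) ins (im :: outs) Ser.Z) (sep t u r (N + 1) ins (im :: outs)) L) :
    ∃ L, IsIntegral t U M u (sep t u r N ins (im :: outs) Ser.Z)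
      (sep t u r N ins (im :: outs)) L := by
  obtain ⟨hU, hlt, h1, h2⟩ := ho im (by simp)
  have ho' : ValidOuts U M u outs := fun x hx => ho x (List.mem_cons_of_mem _ hx)
  have hv₁ := hr.mulVar hU (-1)
  have hv₂ := (hr.mulVar hU (-1)).mulC (t ^ im.2)
  refine exists_isIntegral_of_eq_add ht hu hv₁ hv₂ hi hi ho' ho (fun {K} _ _ z hz => ?_)
    (h₁ _ hv₁) (h₂ _ hv₂)
  have hb := hz.var _ hU
  have hne := hz.outs _ hU _ h1 h2 hlt
  simp only [sep, List.map_cons, List.prod_cons, eval_mulC, eval_mulVar t r hb,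
    zpow_add_one₀ hz.self]
  -- One step of the geometric expansion in z_u / z_i; it raises the power of z_u.
  have key : fac t z (im.1, u, im.2) = z im.1 ^ (-1 : ℤ) +
      z im.1 ^ (-1 : ℤ) * algebraMap ℂ K (t ^ im.2) * z u * fac t z (im.1, u, im.2) := by
    rw [zpow_neg_one, fac]; simp only
    field_simp
    ring
  generalize fac t z (im.1, u, im.2) = x at key ⊢
  linear_combination (r.eval t z * z u ^ N * (ins.map fun jm => fac t z (u, jm)).prod *
    (outs.map fun im => fac t z (im.1, u, im.2)).prod) * key

/-- Expansion of one inner factor. -/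
theorem exists_isIntegral_ins_cons (ht : t ≠ 0) (hu : u ∉ U) {r : Term n}
    (hr : r.Valid U (2 * M)) {N : ℤ} {jm : Fin n × ℕ} {ins outs : List (Fin n × ℕ)}
    (hi : ValidIns U M u (jm :: ins)) (ho : ValidOuts U M u outs)
    (h₁ : ∀ r : Term n, r.Valid U (2 * M) →
      ∃ L, IsIntegral t U M u (sep t u r N ins outs Ser.Z) (sep t u r N ins outs) L)
    (h₂ : ∀ r : Term n, r.Valid U (2 * M) → ∃ L, IsIntegral t U M u
      (sep t u r N (jm :: ins) outs Ser.Z) (sep t u r N (jm :: ins) outs) L) :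
    ∃ L, IsIntegral t U M u (sep t u r (N + 1) (jm :: ins) outs Ser.Z)
      (sep t u r (N + 1) (jm :: ins) outs) L := by
  obtain ⟨hU, hlt, h1, h2⟩ := hi jm (by simp)
  have hi' : ValidIns U M u ins := fun x hx => hi x (List.mem_cons_of_mem _ hx)
  have hv₂ := (hr.mulVar hU 1).mulC (t ^ jm.2)
  refine exists_isIntegral_of_eq_add ht hu hr hv₂ hi' hi ho ho (fun {K} _ _ z hz => ?_)
    (h₁ _ hr) (h₂ _ hv₂)
  have hb := hz.var _ hU
  have hne := hz.ins _ hU _ h1 h2 hlt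
  simp only [sep, List.map_cons, List.prod_cons, eval_mulC, eval_mulVar t r hb,
    zpow_add_one₀ hz.self, zpow_one]
  -- One step of polynomial division; it lowers the power of z_u.
  have key : z u * fac t z (u, jm) = 1 + algebraMap ℂ K (t ^ jm.2) * z jm.1 * fac t z (u, jm) := by
    rw [fac]; simp only
    field_simp
    ring
  generalize fac t z (u, jm) = x at key ⊢
  linear_combination (r.eval t z * z u ^ N * (ins.map fun jm => fac t z (u, jm)).prod *
    (outs.map fun im => fac t z (im.1, u, im.2)).prod) * key

/-- Partial fractions for an inner and an outer factor. -/
theorem exists_isIntegral_partial_fractions (ht : t ≠ 0) (hu : u ∉ U) {r : Term n}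
    (hr : r.Valid U (2 * M)) {N : ℤ} {jm im : Fin n × ℕ} {ins outs : List (Fin n × ℕ)}
    (hi : ValidIns U M u (jm :: ins)) (ho : ValidOuts U M u (im :: outs))
    (h₁ : ∀ r : Term n, r.Valid U (2 * M) → ∃ L, IsIntegral t U M u
      (sep t u r N (jm :: ins) outs Ser.Z) (sep t u r N (jm :: ins) outs) L)
    (h₂ : ∀ r : Term n, r.Valid U (2 * M) → ∃ L, IsIntegral t U M u
      (sep t u r N ins (im :: outs) Ser.Z) (sep t u r N ins (im :: outs)) L) :
    ∃ L, IsIntegral t U M u (sep t u r N (jm :: ins) (im :: outs) Ser.Z)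
      (sep t u r N (jm :: ins) (im :: outs)) L := by
  obtain ⟨hU, hlt, h1, h2⟩ := hi jm (by simp)
  obtain ⟨hU', hlt', h1', h2'⟩ := ho im (by simp)
  have hi' : ValidIns U M u ins := fun x hx => hi x (List.mem_cons_of_mem _ hx)
  have ho' : ValidOuts U M u outs := fun x hx => ho x (List.mem_cons_of_mem _ hx)
  -- Where an inner and an outer pole of z_u meet, a new pole z_i = t^{m+m'} z_j arises. Exponents
  -- at most M can add up to 2M, which is why the bound doubles with each integration.
  have hv₁ : (r.mulFac (im.1, jm.1, im.2 + jm.2)).Valid U (2 * M) :=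
    hr.mulFac ⟨hU', hU, hlt'.trans hlt, by simp only; omega, by simp only; omega⟩
  have hv₂ := hv₁.mulC (t ^ im.2)
  refine exists_isIntegral_of_eq_add ht hu hv₁ hv₂ hi hi' ho' ho (fun {K} _ _ z hz => ?_)
    (h₁ _ hv₁) (h₂ _ hv₂)
  have hne := hz.ins _ hU _ h1 h2 hlt
  have hne' := hz.outs _ hU' _ h1' h2' hlt'
  have hne'' := hz.rest _ hU' _ hU (im.2 + jm.2) (by omega) (by omega) (hlt'.trans hlt)
  simp only [sep, List.map_cons, List.prod_cons, eval_mulC, eval_mulFac]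
  -- With a = z_u - c' z_j, b = z_i - c z_u and d = b + c a = z_i - c c' z_j, this is 1/(ab) =
  -- (1/d)(1/a + c/b).
  have key : fac t z (u, jm) * fac t z (im.1, u, im.2) = fac t z (im.1, jm.1, im.2 + jm.2) *
      (fac t z (u, jm) + algebraMap ℂ K (t ^ im.2) * fac t z (im.1, u, im.2)) := by
    rw [pow_add, map_mul] at hne''
    simp only [fac, pow_add, map_mul]
    generalize algebraMap ℂ K (t ^ im.2) = c at *
    generalize algebraMap ℂ K (t ^ jm.2) = c' at *
    have hd : z im.1 - c * c' * z jm.1 = (z im.1 - c * z u) + c * (z u - c' * z jm.1) := by ring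
    rw [hd] at hne'' ⊢
    generalize z im.1 - c * z u = b at *
    generalize z u - c' * z jm.1 = a at *
    rw [eq_inv_mul_iff_mul_eq₀ hne'']
    field_simp
  generalize fac t z (u, jm) = x at key ⊢
  generalize fac t z (im.1, u, im.2) = x' at key ⊢
  linear_combination (r.eval t z * z u ^ N * (ins.map fun jm => fac t z (u, jm)).prod *
    (outs.map fun im => fac t z (im.1, u, im.2)).prod) * key

/-- Induction on the number of factors and, inside, on the distance of N from 0. A positive power is
reduced against an inner factor and a negative one against an outer factor, with vanishing integral
if there is none. At N = 0, mixed factors are separated by partial fractions, and outer factors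
alone are moved to N = 1. -/
theorem exists_isIntegral_sep (ht : t ≠ 0) (hu : u ∉ U) (s : ℕ) (ins outs : List (Fin n × ℕ))
    (hs : ins.length + outs.length = s) (hi : ValidIns U M u ins) (ho : ValidOuts U M u outs)
    (N : ℤ) (r : Term n) (hr : r.Valid U (2 * M)) :
    ∃ L, IsIntegral t U M u (sep t u r N ins outs Ser.Z) (sep t u r N ins outs) L := by
  induction s using Nat.strong_induction_on generalizing ins outs N r with
  | _ s ih =>
  have tailI : ∀ {x l}, ValidIns U M u (x :: l) → ValidIns U M u l :=
    fun h y hy => h y (List.mem_cons_of_mem _ hy)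
  have tailO : ∀ {x l}, ValidOuts U M u (x :: l) → ValidOuts U M u l :=
    fun h y hy => h y (List.mem_cons_of_mem _ hy)
  have hnil : ValidIns U M u [] := fun _ h => absurd h List.not_mem_nil
  induction N using Int.induction_on generalizing r with
  | zero =>
    match ins, outs, hs, hi, ho with
    | [], [], _, _, _ => exact ⟨_, isIntegral_one hu hr⟩
    | [], im :: outs, hs, hi, ho =>
      refine exists_isIntegral_outs_cons ht hu hr hi ho (fun r hr => ?_) fun r hr => ?_
      · exact ih outs.length (by simp at hs; omega) [] outs (by simp) hi (tailO ho) 0 r hr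
      · exact ⟨_, isIntegral_nil_of_outs ht hu hr (by simp) ho⟩
    | jm :: ins, [], _, hi, _ =>
      exact ⟨_, isIntegral_nil_of_ins hu hr le_rfl (by simp) hi⟩
    | jm :: ins, im :: outs, hs, hi, ho =>
      simp only [List.length_cons] at hs
      refine exists_isIntegral_partial_fractions ht hu hr hi ho (fun r hr => ?_) fun r hr => ?_
      · exact ih (ins.length + 1 + outs.length) (by omega) _ _ (by simp) hi (tailO ho) 0 r hr
      · exact ih (ins.length + (outs.length + 1)) (by omega) _ _ (by simp) (tailI hi) ho 0 r hr
  | succ k ihN =>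
    match ins, hs, hi with
    | [], _, _ => exact ⟨_, isIntegral_nil_of_outs ht hu hr (by omega) ho⟩
    | jm :: ins, hs, hi =>
      simp only [List.length_cons] at hs
      refine exists_isIntegral_ins_cons ht hu hr hi ho (fun r hr => ?_) fun r hr => ?_
      · exact ih (ins.length + outs.length) (by omega) _ _ rfl (tailI hi) ho k r hr
      · exact ihN r hr
  | pred k ihN =>
    match outs, hs, ho with
    | [], _, _ => exact ⟨_, isIntegral_nil_of_ins hu hr (by omega) (by omega) hi⟩
    | im :: outs, hs, ho =>
      simp only [List.length_cons] at hs
      refine exists_isIntegral_outs_cons ht hu hr hi ho (fun r hr => ?_) fun r hr => ?_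
      · exact ih (ins.length + outs.length) (by omega) _ _ rfl hi (tailO ho) _ r hr
      · rw [sub_add_cancel]; exact ihN r hr

/-- Sorting the factors of a term by whether they contain `z_u`. -/
theorem Valid.exists_sep {τ : Term n} (hτ : τ.Valid (insert u U) M) (hu : u ∉ U) :
    ∃ (r : Term n) (N : ℤ) (ins outs : List (Fin n × ℕ)), r.Valid U M ∧ ValidIns U M u ins ∧
      ValidOuts U M u outs ∧ ∀ {K : Type} [Field K] [Algebra ℂ K] (z : Fin n → K),
        τ.eval t z = sep t u r N ins outs z := by
  obtain ⟨den, ins, outs, hd, hi, ho, heq⟩ : ∃ (den : List (Fin n × Fin n × ℕ))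
      (ins outs : List (Fin n × ℕ)),
      (∀ d ∈ den, d.1 ∈ U ∧ d.2.1 ∈ U ∧ d.1 < d.2.1 ∧ 1 ≤ d.2.2 ∧ d.2.2 ≤ M) ∧
      ValidIns U M u ins ∧ ValidOuts U M u outs ∧
      ∀ {K : Type} [Field K] [Algebra ℂ K] (z : Fin n → K), (τ.den.map (fac t z)).prod =
        (den.map (fac t z)).prod * (ins.map fun jm => fac t z (u, jm)).prod *
          (outs.map fun im => fac t z (im.1, u, im.2)).prod := by
    have hden := hτ.2
    generalize τ.den = l at hden
    induction l with
    | nil => exact ⟨[], [], [], by simp, fun _ h => absurd h List.not_mem_nil,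
        fun _ h => absurd h List.not_mem_nil, by simp⟩
    | cons d l ih =>
      obtain ⟨den, ins, outs, hd, hi, ho, heq⟩ := ih fun e he => hden e (List.mem_cons_of_mem _ he)
      obtain ⟨h1, h2, h3, h4, h5⟩ := hden d (by simp)
      rcases Finset.mem_insert.mp h1 with h1 | h1
      · have h2' : d.2.1 ∈ U := (Finset.mem_insert.mp h2).resolve_left (by rw [← h1]; exact h3.ne')
        refine ⟨den, (d.2.1, d.2.2) :: ins, outs, hd, fun x hx => ?_, ho, fun {K} _ _ z => ?_⟩
        · rcases List.mem_cons.mp hx with rfl | hx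
          · exact ⟨h2', h1 ▸ h3, h4, h5⟩
          · exact hi x hx
        · have : fac t z d = fac t z (u, d.2.1, d.2.2) := by rw [← h1]
          simp only [List.map_cons, List.prod_cons, heq, this]; ring
      · rcases Finset.mem_insert.mp h2 with h2 | h2
        · refine ⟨den, ins, (d.1, d.2.2) :: outs, hd, hi, fun x hx => ?_, fun {K} _ _ z => ?_⟩
          · rcases List.mem_cons.mp hx with rfl | hx
            · exact ⟨h1, h2 ▸ h3, h4, h5⟩
            · exact ho x hx
          · have : fac t z d = fac t z (d.1, u, d.2.2) := by rw [← h2]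
            simp only [List.map_cons, List.prod_cons, heq, this]; ring
        · refine ⟨d :: den, ins, outs, fun x hx => ?_, hi, ho, fun {K} _ _ z => ?_⟩
          · rcases List.mem_cons.mp hx with rfl | hx
            · exact ⟨h1, h2, h3, h4, h5⟩
            · exact hd x hx
          · simp only [List.map_cons, List.prod_cons, heq]; ring
  -- The sign of the power of z_u changes because `exp` records the negatives of the exponents.
  refine ⟨⟨τ.coef, Function.update τ.exp u 0, den⟩, -τ.exp u, ins, outs, ⟨fun i hi' => ?_, hd⟩,
    hi, ho, fun {K} _ _ z => ?_⟩
  · by_cases h : i = u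
    · subst h; simp
    · simp only [Function.update_of_ne h]
      exact hτ.1 i (by simp [h, hi'])
  · simp only [eval, sep, heq]
    have : monoAt z τ.exp = monoAt z (Function.update τ.exp u 0) * z u ^ (-τ.exp u) := by
      rw [monoAt, monoAt, ← Finset.mul_prod_erase _ _ (Finset.mem_univ u),
        ← Finset.mul_prod_erase _ (fun i => z i ^ (-Function.update τ.exp u 0 i))
          (Finset.mem_univ u), Function.update_self, neg_zero, zpow_zero, one_mul, mul_comm]
      congr 1
      exact Finset.prod_congr rfl fun i hi => by
        rw [Function.update_of_ne (Finset.ne_of_mem_erase hi)]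
    rw [this]; ring

theorem Valid.mono {M' : ℕ} {τ : Term n} (h : τ.Valid U M) (hM : M ≤ M') : τ.Valid U M' :=
  ⟨h.1, fun d hd => by
    obtain ⟨h1, h2, h3, h4, h5⟩ := h.2 d hd
    exact ⟨h1, h2, h3, h4, h5.trans hM⟩⟩

/-- Every term can be integrated over one variable. -/
theorem exists_isIntegral (ht : t ≠ 0) (hu : u ∉ U) {τ : Term n} (hτ : τ.Valid (insert u U) M) :
    ∃ L, IsIntegral t U M u (τ.eval t Ser.Z) (τ.eval t) L := by
  obtain ⟨r, N, ins, outs, hr, hi, ho, heq⟩ := hτ.exists_sep (t := t) hu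
  obtain ⟨L, hL⟩ := exists_isIntegral_sep ht hu _ ins outs rfl hi ho N r (hr.mono (by omega))
  refine ⟨L, ?_⟩
  rw [heq Ser.Z, show (τ.eval t : (Fin n → ℂ) → ℂ) = sep t u r N ins outs from funext heq]
  exact hL

theorem continuousOn_eval (ht : t ≠ 0) (hu : u ∉ U) {τ : Term n} (hτ : τ.Valid (insert u U) M)
    {y : Fin n → ℂ} {C : Contour} (h : Separates t U M y C) :
    ContinuousOn (fun ζ => τ.eval t (Function.update y u ζ) * ζ⁻¹) C.support := by
  obtain ⟨r, N, ins, outs, hr, hi, ho, heq⟩ := hτ.exists_sep (t := t) hu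
  simp only [heq]
  exact continuousOn_sep ht hu h hr N hi ho

end Step

/-! ### Nested integrals of terms -/

/-- The sum of the values of terms in permuted variables. -/
def permSum {K : Type*} [Field K] [Algebra ℂ K] (t : ℂ) (E : List (Equiv.Perm (Fin n) × Term n))
    (z : Fin n → K) : K := (E.map fun wτ => wτ.2.eval t (z ∘ wτ.1)).sum

/-- The sum of the constant coefficients of terms. -/
def ctSum (t : ℂ) (E : List (Equiv.Perm (Fin n) × Term n)) : ℂ :=
  (E.map fun wτ => (wτ.2.eval t (Ser.Z (n := n))).coeff 0).sum

/-- The variables that are left after the integration over `s` variables. -/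
def remaining (w : Equiv.Perm (Fin n)) (s : ℕ) : Finset (Fin n) :=
  Finset.univ.filter fun i => s ≤ (w i : ℕ)

theorem remaining_eq_insert (w : Equiv.Perm (Fin n)) {s : ℕ} (hs : s < n) :
    remaining w s = insert (w.symm ⟨s, hs⟩) (remaining w (s + 1)) := by
  ext i
  simp only [remaining, Finset.mem_filter, Finset.mem_univ, true_and, Finset.mem_insert,
    Equiv.eq_symm_apply, Fin.ext_iff]
  omega

theorem notMem_remaining (w : Equiv.Perm (Fin n)) {s : ℕ} (hs : s < n) :
    w.symm ⟨s, hs⟩ ∉ remaining w (s + 1) := by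
  simp [remaining]

variable {q : ℂ}

theorem inv_sq_pow (q : ℂ) (m : ℕ) : ((q ^ 2)⁻¹) ^ m = (q ^ (2 * m))⁻¹ := by
  rw [inv_pow, pow_mul]

/-- Admissibility puts q^{-2m} z_j inside and q^{2m} z_j outside for every remaining variable,
without reference to an order among them. Therefore one contour serves all permutations w, with t =
q⁻². -/
theorem separates_of_admissible (hq0 : q ≠ 0) {C : ContourSystem n} (hC : C.Admissible q) {s : ℕ}
    (hs : s < n) {z : Fin n → ℂ} (hz : ∀ j : Fin n, s + 1 ≤ (j : ℕ) → z j ∈ (C.at' j z).support)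
    (w : Equiv.Perm (Fin n)) :
    Separates ((q ^ 2)⁻¹) (remaining w (s + 1)) (2 ^ s) (z ∘ w) (C.at' ⟨s, hs⟩ z) := by
  have hgood : ∀ j : Fin n, s ≤ (j : ℕ) → _ := fun j hj => hC j z fun l hl => hz l (by
    have := Fin.lt_def.mp hl; omega)
  have h1 := hgood ⟨s, hs⟩ le_rfl
  have hmem : ∀ {i}, i ∈ remaining w (s + 1) → s + 1 ≤ (w i : ℕ) := fun hi => by
    simpa [remaining] using hi
  refine ⟨h1.1, fun j hj h0 => ?_, fun j hj m hm hm' => ?_, fun i hi m hm hm' => ?_,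
    fun i hi j hj m hm hm' hij h0 => ?_⟩
  · have h0' : z (w j) = 0 := h0
    refine (hgood (w j) (by have := hmem hj; omega)).1.1 ?_
    rw [← h0']; exact hz _ (hmem hj)
  · rw [inv_sq_pow]
    exact (h1.2 (w j) (Fin.lt_def.mpr (by have := hmem hj; simp; omega)) m hm hm').1
  · rw [inv_sq_pow, inv_inv]
    exact (h1.2 (w i) (Fin.lt_def.mpr (by have := hmem hi; simp; omega)) m hm hm').2
  · rw [inv_sq_pow] at h0
    have h0' : z (w i) = (q ^ (2 * m))⁻¹ * z (w j) := sub_eq_zero.mp h0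
    have hpow : q ^ (2 * m) ≠ 0 := pow_ne_zero _ hq0
    -- The poles created by integrating z_s have m ≤ 2 · 2^s, still within the range allowed for the
    -- contours of larger index.
    have hbound : ∀ k : Fin n, s + 1 ≤ (k : ℕ) → m ≤ 2 ^ (k : ℕ) := fun k hk =>
      hm'.trans (by rw [← pow_succ']; exact Nat.pow_le_pow_right two_pos hk)
    have hi' := hmem hi
    have hj' := hmem hj
    rcases lt_trichotomy (w i) (w j) with h | h | h
    · have := ((hgood (w i) (by omega)).2 (w j) h m hm (hbound _ hi')).1.1
      exact this (h0' ▸ hz _ hi')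
    · exact hij.ne (w.injective h)
    · have := ((hgood (w j) (by omega)).2 (w i) h m hm (hbound _ hj')).2.1
      refine this ?_
      rw [h0', mul_inv_cancel_left₀ hpow]
      exact hz _ hj'

theorem update_comp_perm (z : Fin n → ℂ) (w : Equiv.Perm (Fin n)) (k : Fin n) (ζ : ℂ) :
    Function.update z k ζ ∘ w = Function.update (z ∘ w) (w.symm k) ζ := by
  ext i
  simp only [Function.comp_apply, Function.update_apply, Equiv.eq_symm_apply]

/-- Integration of a sum of terms in permuted variables over the variable `z_s`. -/
theorem exists_permSum_step (hq0 : q ≠ 0) {s : ℕ} (hs : s < n)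
    (E : List (Equiv.Perm (Fin n) × Term n))
    (hE : ∀ wτ ∈ E, wτ.2.Valid (remaining wτ.1 s) (2 ^ s)) :
    ∃ E' : List (Equiv.Perm (Fin n) × Term n),
      (∀ wτ ∈ E', wτ.2.Valid (remaining wτ.1 (s + 1)) (2 ^ (s + 1))) ∧
      ctSum ((q ^ 2)⁻¹) E' = ctSum ((q ^ 2)⁻¹) E ∧
      ∀ (C : ContourSystem n), C.Admissible q → ∀ z : Fin n → ℂ,
        (∀ j : Fin n, s + 1 ≤ (j : ℕ) → z j ∈ (C.at' j z).support) →
        ContinuousOn (fun ζ => permSum ((q ^ 2)⁻¹) E (Function.update z ⟨s, hs⟩ ζ) * ζ⁻¹)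
          (C.at' ⟨s, hs⟩ z).support ∧
        ((C.at' ⟨s, hs⟩ z).integral fun ζ =>
          permSum ((q ^ 2)⁻¹) E (Function.update z ⟨s, hs⟩ ζ) * ζ⁻¹) =
          2 * (Real.pi : ℂ) * Complex.I * permSum ((q ^ 2)⁻¹) E' z := by
  have ht : (q ^ 2)⁻¹ ≠ 0 := inv_ne_zero (pow_ne_zero 2 hq0)
  induction E with
  | nil =>
    refine ⟨[], by simp, rfl, fun C hC z hz => ⟨?_, ?_⟩⟩
    · simpa [permSum] using continuousOn_const
    · simp [permSum, Contour.integral_zero]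
  | cons wτ E ih =>
    obtain ⟨E', hE', hct, hint⟩ := ih fun x hx => hE x (List.mem_cons_of_mem _ hx)
    obtain ⟨w, τ⟩ := wτ
    have hτ : τ.Valid (insert (w.symm ⟨s, hs⟩) (remaining w (s + 1))) (2 ^ s) := by
      rw [← remaining_eq_insert]; exact hE (w, τ) (by simp)
    obtain ⟨L, hL, hLc, hLi⟩ := exists_isIntegral ht (notMem_remaining w hs) hτ
    refine ⟨L.map (fun τ' => (w, τ')) ++ E', fun x hx => ?_, ?_, fun C hC z hz => ?_⟩
    · rcases List.mem_append.mp hx with h | h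
      · obtain ⟨τ', hτ', rfl⟩ := List.mem_map.mp h
        have := hL τ' hτ'
        rwa [← pow_succ'] at this
      · exact hE' x h
    · have : ((evalSum ((q ^ 2)⁻¹) L (Ser.Z (n := n))).coeff 0)
          = (L.map fun τ' => (τ'.eval ((q ^ 2)⁻¹) (Ser.Z (n := n))).coeff 0).sum := by
        clear hLi hLc hL
        induction L with
        | nil => simp [evalSum]
        | cons a L ih =>
          simp only [evalSum, List.map_cons, List.sum_cons, HahnSeries.coeff_add] at ih ⊢
          rw [ih]
      simp only [ctSum, List.map_append, List.sum_append, List.map_map, List.map_cons,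
        List.sum_cons, Function.comp_def] at hct ⊢
      rw [hct, ← this, ← hLc]
    · obtain ⟨hc, hi⟩ := hint C hC z hz
      have hsep := separates_of_admissible hq0 hC hs hz w
      have hcont := continuousOn_eval ht (notMem_remaining w hs) hτ hsep
      have hval := hLi _ _ hsep
      have hsplit : ∀ ζ, permSum ((q ^ 2)⁻¹) ((w, τ) :: E) (Function.update z ⟨s, hs⟩ ζ) * ζ⁻¹ =
          τ.eval ((q ^ 2)⁻¹) (Function.update (z ∘ w) (w.symm ⟨s, hs⟩) ζ) * ζ⁻¹ +
            permSum ((q ^ 2)⁻¹) E (Function.update z ⟨s, hs⟩ ζ) * ζ⁻¹ := by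
        intro ζ
        simp only [permSum, List.map_cons, List.sum_cons, add_mul, update_comp_perm]
      simp only [hsplit]
      refine ⟨hcont.add hc, ?_⟩
      rw [Contour.integral_add hcont hc, hval, hi, ← mul_add]
      congr 1
      simp [permSum, evalSum, List.map_append, Function.comp_def]

/-- A point whose coordinates lie on their contours from the index `s` on. -/
def OnContours (C : ContourSystem n) (s : ℕ) (z : Fin n → ℂ) : Prop :=
  ∀ j : Fin n, s ≤ (j : ℕ) → z j ∈ (C.at' j z).support

/-- The contours of index at least s depend only on variables of index larger than s, so moving z_s
does not move them. -/
theorem OnContours.update {C : ContourSystem n} {s : ℕ} (hs : s < n) {z : Fin n → ℂ}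
    (hz : OnContours C (s + 1) z) {ζ : ℂ} (hζ : ζ ∈ (C.at' ⟨s, hs⟩ z).support) :
    OnContours C s (Function.update z ⟨s, hs⟩ ζ) := by
  have hat : ∀ j : Fin n, s ≤ (j : ℕ) → C.at' j (Function.update z ⟨s, hs⟩ ζ) = C.at' j z := by
    intro j hj
    unfold ContourSystem.at'
    congr 1
    funext l
    refine Function.update_of_ne (fun he => ?_) _ _
    have h1 := Fin.lt_def.mp l.2
    rw [he] at h1
    simp at h1
    omega
  intro j hj
  rw [hat j hj]
  by_cases h : j = ⟨s, hs⟩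
  · subst h; rwa [Function.update_self]
  · rw [Function.update_of_ne h]
    refine hz j ?_
    have : (j : ℕ) ≠ s := fun he => h (Fin.ext he)
    omega

/-- The nested integral of a sum of terms in permuted variables is `(2πi)ⁿ` times the sum of the
constant coefficients of the terms. -/
theorem nestedIntegral_permSum (hq0 : q ≠ 0) (E : List (Equiv.Perm (Fin n) × Term n))
    (hE : ∀ wτ ∈ E, wτ.2.Valid Finset.univ 1) {C : ContourSystem n} (hC : C.Admissible q)
    {G : (Fin n → ℂ) → ℂ} (hG : ∀ z, OnContours C 0 z → G z = permSum ((q ^ 2)⁻¹) E z) :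
    C.nestedIntegral G = (2 * (Real.pi : ℂ) * Complex.I) ^ n * ctSum ((q ^ 2)⁻¹) E := by
  have main : ∀ s : ℕ, s ≤ n → ∃ E' : List (Equiv.Perm (Fin n) × Term n),
      (∀ wτ ∈ E', wτ.2.Valid (remaining wτ.1 s) (2 ^ s)) ∧
      ctSum ((q ^ 2)⁻¹) E' = ctSum ((q ^ 2)⁻¹) E ∧
      ∀ z, OnContours C s z → C.partialIntegral G s z =
        (2 * (Real.pi : ℂ) * Complex.I) ^ s * permSum ((q ^ 2)⁻¹) E' z := by
    intro s
    induction s with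
    | zero =>
      intro _
      refine ⟨E, fun x hx => ?_, rfl, fun z hz => ?_⟩
      · have : remaining x.1 0 = Finset.univ := by ext; simp [remaining]
        rw [this]; simpa using hE x hx
      · rw [ContourSystem.partialIntegral, hG z hz]; simp
    | succ s ih =>
      intro hs
      obtain ⟨E', hE', hct, hint⟩ := ih (by omega)
      obtain ⟨E'', hE'', hct', hint'⟩ := exists_permSum_step hq0 (by omega : s < n) E' hE'
      refine ⟨E'', hE'', hct'.trans hct, fun z hz => ?_⟩
      rw [ContourSystem.partialIntegral, dif_pos (by omega : s < n)]
      have : ∀ ζ ∈ (C.at' ⟨s, hs⟩ z).support,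
          C.partialIntegral G s (Function.update z ⟨s, hs⟩ ζ) * ζ⁻¹ =
          (2 * (Real.pi : ℂ) * Complex.I) ^ s *
            (permSum ((q ^ 2)⁻¹) E' (Function.update z ⟨s, hs⟩ ζ) * ζ⁻¹) := by
        intro ζ hζ
        rw [hint _ (hz.update hs hζ)]; ring
      rw [Contour.integral_congr this, Contour.integral_const_mul, (hint' C hC z hz).2]
      ring
  obtain ⟨E', hE', hct, hint⟩ := main n le_rfl
  -- No variable is left, so the base point 0 satisfies the contour condition vacuously and all
  -- terms are constants.
  rw [ContourSystem.nestedIntegral, hint 0 fun j hj => absurd j.2 (by omega), ← hct]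
  congr 1
  rw [permSum, ctSum]
  congr 1
  refine List.map_congr_left fun wτ hwτ => ?_
  have hrem : remaining wτ.1 n = ∅ := by
    ext i; simp [remaining]
  have hv := hE' wτ hwτ
  rw [hrem] at hv
  have hexp : wτ.2.exp = 0 := funext fun i => hv.1 i (by simp)
  have hden : wτ.2.den = [] := List.eq_nil_iff_forall_not_mem.mpr fun d hd =>
    absurd (hv.2 d hd).1 (by simp)
  simp only [eval, hexp, hden, monoAt_zero, List.map_nil, List.prod_nil, mul_one]
  rw [HahnSeries.algebraMap_apply]
  simp

end Term

end QuantumAffine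

end

noncomputable section

namespace QuantumAffine

variable {n : ℕ}

/-! ### The nested integral of a product of two antisymmetric functions -/

section Symmetrization

variable {K : Type*} [Field K] [Algebra ℂ K]

/-- Since t p = 1, (z_i - t z_j)(z_i - p z_j) = z_i² - (t + p) z_i z_j + z_j² is symmetric in i and
j. -/
theorem vand_mul_vand_comp {t p : ℂ} (htp : t * p = 1) (z : Fin n → K)
    (w : Equiv.Perm (Fin n)) :
    vand t (z ∘ w) * vand p (z ∘ w) = vand t z * vand p z := by
  have htp' : algebraMap ℂ K t * algebraMap ℂ K p = 1 := by rw [← map_mul, htp, map_one]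
  simp only [vand, ← Finset.prod_mul_distrib, Function.comp_apply]
  exact prod_pairs_perm w (fun i j => (z i - algebraMap ℂ K t * z j) *
    (z i - algebraMap ℂ K p * z j)) fun i j => by
      linear_combination (z j * z j - z i * z i) * htp'

theorem ev_hl (p : ℂ) (m : Fin n → ℤ) (z : Fin n → K) (hz : ∀ i, z i ≠ 0) :
    ev z hz (hl p m) = ∑ w : Equiv.Perm (Fin n),
      algebraMap ℂ K ((Equiv.Perm.sign w : ℤ) : ℂ) * (monoAt (z ∘ w) m * vand p (z ∘ w)) := by
  rw [hl, map_sum]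
  refine Finset.sum_congr rfl fun w _ => ?_
  rw [ev_smul, ev_perm, map_mul, ev_single, ev_vand, map_one, one_mul]

theorem LPoly.IsAntisymm.sign_mul_ev {F : LPoly n} (hF : F.IsAntisymm) (z : Fin n → K)
    (hz : ∀ i, z i ≠ 0) (w : Equiv.Perm (Fin n)) :
    algebraMap ℂ K ((Equiv.Perm.sign w : ℤ) : ℂ) * ev z hz F =
      ev (z ∘ w) (fun i => hz (w i)) F := by
  rw [← ev_perm, hF w, ev_smul]

/-- The product of an antisymmetric function and an antisymmetrization is a symmetrization. -/
theorem ev_mul_ev_hl {t p : ℂ} (htp : t * p = 1) {F : LPoly n} (hF : F.IsAntisymm)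
    (m : Fin n → ℤ) (z : Fin n → K) (hz : ∀ i, z i ≠ 0)
    (hp : ∀ w : Equiv.Perm (Fin n), vand p (z ∘ w) ≠ 0) :
    ev z hz F * ev z hz (hl p m) * (vand t z * vand p z)⁻¹ =
      ∑ w : Equiv.Perm (Fin n), ev (z ∘ w) (fun i => hz (w i)) F * monoAt (z ∘ w) m *
        (vand t (z ∘ w))⁻¹ := by
  rw [ev_hl, Finset.mul_sum, Finset.sum_mul]
  refine Finset.sum_congr rfl fun w _ => ?_
  -- The sign is absorbed by F, the symmetric denominator is rewritten in the permuted variables,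
  -- and the factor with parameter p cancels.
  rw [← hF.sign_mul_ev z hz w, ← vand_mul_vand_comp htp z w, mul_inv]
  have := mul_inv_cancel₀ (hp w)
  linear_combination (algebraMap ℂ K ((Equiv.Perm.sign w : ℤ) : ℂ) * ev z hz F *
    monoAt (z ∘ w) m * (vand t (z ∘ w))⁻¹) * this

end Symmetrization

namespace Term

/-- The term `c ∏ z_i ^ (-a_i) / ∏_{i<j} (z_i - t z_j)`. -/
def overVand (c : ℂ) (a : Fin n → ℤ) : Term n :=
  ⟨c, a, (pairs n).toList.map fun ij => (ij.1, ij.2, 1)⟩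

theorem overVand_valid (c : ℂ) (a : Fin n → ℤ) : (overVand c a).Valid Finset.univ 1 := by
  refine ⟨fun i hi => absurd (Finset.mem_univ i) hi, fun d hd => ?_⟩
  simp only [overVand, List.mem_map, Finset.mem_toList] at hd
  obtain ⟨ij, hij, rfl⟩ := hd
  exact ⟨Finset.mem_univ _, Finset.mem_univ _, mem_pairs.mp hij, le_rfl, le_rfl⟩

theorem eval_overVand {K : Type*} [Field K] [Algebra ℂ K] (t c : ℂ) (a : Fin n → ℤ)
    (z : Fin n → K) :
    (overVand c a).eval t z = algebraMap ℂ K c * monoAt z a * (vand t z)⁻¹ := by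
  simp only [eval, overVand, List.map_map, Finset.prod_map_toList, vand, ← Finset.prod_inv_distrib]
  congr 1
  refine Finset.prod_congr rfl fun ij _ => ?_
  simp [fac]

end Term

/-- Points on admissible contours avoid the poles of the integrand. -/
theorem OnContours.mem_polesComplement {q : ℂ} (hq0 : q ≠ 0) {C : ContourSystem n}
    (hC : C.Admissible q) {z : Fin n → ℂ} (hz : Term.OnContours C 0 z) :
    z ∈ polesComplement q n := by
  have h := fun i => hC i z fun j _ => hz j (Nat.zero_le _)
  have hp : ∀ i, 1 ≤ 2 ^ (i : ℕ) := fun i => Nat.one_le_two_pow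
  refine ⟨fun i h0 => (h i).1.1 (h0 ▸ hz i (Nat.zero_le _)), fun i j hij he => ?_⟩
  rcases lt_or_gt_of_ne hij with hlt | hlt
  · refine (((h i).2 j hlt 1 le_rfl (hp _)).2).1 ?_
    rw [mul_one, ← he]
    exact hz i (Nat.zero_le _)
  · refine (((h j).2 i hlt 1 le_rfl (hp _)).1).1 ?_
    rw [mul_one, he, inv_mul_cancel_left₀ (pow_ne_zero _ hq0)]
    exact hz j (Nat.zero_le _)

theorem vand_comp_ne_zero {q : ℂ} {z : Fin n → ℂ} (hz : z ∈ polesComplement q n)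
    (w : Equiv.Perm (Fin n)) : vand (q ^ 2) (z ∘ w) ≠ 0 := by
  refine Finset.prod_ne_zero_iff.mpr fun ij hij => sub_ne_zero.mpr ?_
  exact hz.2 _ _ fun he => (mem_pairs.mp hij).ne (w.injective he)

/-- The nested integral of the product of two antisymmetric functions over admissible contours, in
terms of the coefficients of their expansions. -/
theorem nestedIntegral_eq_sum {q : ℂ} (hq0 : q ≠ 0) {F H : LPoly n}
    (hF : F.IsAntisymm) (hH : H.IsAntisymm) (S : Finset (Fin n → ℤ)) (hS : ∀ m ∈ S, Monotone m)
    (hκ : ∀ m ∈ S, kappa (q ^ 2) m ≠ 0)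
    (hS' : ∀ m : Fin n → ℤ, Monotone m →
      (H.ser * (vand (q ^ 2) Ser.Z)⁻¹).coeff (toLex m) ≠ 0 → m ∈ S)
    {C : ContourSystem n} (hC : C.Admissible q) {G : (Fin n → ℂ) → ℂ}
    (hG : ∀ z (hz : z ∈ polesComplement q n), G z =
      ev z hz.1 F * ev z hz.1 H * (vand (q ^ 2)⁻¹ z * vand (q ^ 2) z)⁻¹) :
    C.nestedIntegral G = (2 * (Real.pi : ℂ) * Complex.I) ^ n * (n.factorial *
      ∑ m ∈ S, (F.ser * (vand (q ^ 2)⁻¹ Ser.Z)⁻¹).coeff (toLex (-m)) *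
        (H.ser * (vand (q ^ 2) Ser.Z)⁻¹).coeff (toLex m) / kappa (q ^ 2) m) := by
  set y : (Fin n → ℤ) → ℂ := fun m =>
    (H.ser * (vand (q ^ 2) Ser.Z)⁻¹).coeff (toLex m) / kappa (q ^ 2) m with hy
  -- Only H is expanded in antisymmetrizations; F is expanded in monomials.
  have hHe : H = ∑ m ∈ S, y m • hl (q ^ 2) m := hH.eq_sum_hl (q ^ 2) S hS hκ hS'
  have htp : (q ^ 2)⁻¹ * q ^ 2 = 1 := inv_mul_cancel₀ (pow_ne_zero _ hq0)
  let I : Finset ((Fin n → ℤ) × Equiv.Perm (Fin n) × (Fin n → ℤ)) :=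
    S ×ˢ Finset.univ ×ˢ F.coeff.support
  let E : List (Equiv.Perm (Fin n) × Term n) := I.toList.map fun x =>
    (x.2.1, Term.overVand (y x.1 * F.coeff x.2.2) (x.2.2 + x.1))
  rw [Term.nestedIntegral_permSum hq0 E _ hC]
  · congr 1
    rw [Term.ctSum, List.map_map, Finset.sum_map_toList, Finset.sum_product, Finset.mul_sum]
    refine Finset.sum_congr rfl fun m _ => ?_
    simp only [Finset.sum_product, Function.comp_apply, Term.eval_overVand]
    -- The constant coefficient of a term does not depend on the permutation attached to it; this
    -- produces n!.
    rw [Finset.sum_const, Finset.card_univ, Fintype.card_perm, Fintype.card_fin, nsmul_eq_mul]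
    congr 1
    have : F.ser * (vand (q ^ 2)⁻¹ Ser.Z)⁻¹ = ∑ a ∈ F.coeff.support,
        algebraMap ℂ (Ser n) (F.coeff a) * monoAt Ser.Z a * (vand (q ^ 2)⁻¹ Ser.Z)⁻¹ := by
      rw [LPoly.ser, ev_eq_sum, Finsupp.sum, Finset.sum_mul]
    rw [this, HahnSeries.coeff_sum, mul_div_assoc, Finset.sum_mul]
    refine Finset.sum_congr rfl fun a _ => ?_
    have h : algebraMap ℂ (Ser n) (y m * F.coeff a) * monoAt Ser.Z (a + m) *
        (vand (q ^ 2)⁻¹ Ser.Z)⁻¹ = algebraMap ℂ (Ser n) (y m) * (Ser.mono m *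
          (algebraMap ℂ (Ser n) (F.coeff a) * monoAt Ser.Z a * (vand (q ^ 2)⁻¹ Ser.Z)⁻¹)) := by
      rw [monoAt_add Ser.Z_ne_zero, Ser.monoAt_Z m, map_mul]; ring
    rw [h, Ser.coeff_C_mul, ← toLex_zero, Ser.coeff_mono_mul, zero_sub, mul_comm]
  · intro z hz
    have hz' := OnContours.mem_polesComplement hq0 hC hz
    rw [hG z hz', Term.permSum, List.map_map, Finset.sum_map_toList, Finset.sum_product]
    conv_lhs => rw [hHe, map_sum, Finset.mul_sum, Finset.sum_mul]
    refine Finset.sum_congr rfl fun m _ => ?_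
    rw [ev_smul, mul_left_comm, mul_assoc,
      ev_mul_ev_hl htp hF m z hz'.1 (vand_comp_ne_zero hz'), Finset.sum_product, Finset.mul_sum]
    refine Finset.sum_congr rfl fun w _ => ?_
    rw [ev_eq_sum, Finsupp.sum, Finset.sum_mul, Finset.sum_mul, Finset.mul_sum]
    refine Finset.sum_congr rfl fun a _ => ?_
    simp only [Function.comp_apply, Term.eval_overVand]
    rw [monoAt_add (z := z ∘ w) (fun i => hz'.1 (w i)), map_mul]; ring
  · intro wτ hwτ
    obtain ⟨x, -, rfl⟩ := List.mem_map.mp hwτ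
    exact Term.overVand_valid _ _

end QuantumAffine

end

noncomputable section

namespace QuantumAffine

variable {n : ℕ}

/-! ### Convergence of the expansions -/

theorem hasSum_mul_prod {ι : Type*} {g h : ι → ℂ} {s t : ℂ} (hg : HasSum g s) (hh : HasSum h t) :
    HasSum (fun ab : ι × ι => g ab.1 * h ab.2) (s * t) :=
  hg.mul hh (summable_mul_of_summable_norm hg.summable.norm hh.summable.norm)

/-- The series `x` converges at the point `z` to the value `s`. -/
def Ser.HasValue (x : Ser n) (z : Fin n → ℂ) (s : ℂ) : Prop :=
  HasSum (fun a : Fin n → ℤ => x.coeff (toLex a) * monoAt z a) s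

theorem monoAt_single (z : Fin n → ℂ) (i : Fin n) :
    monoAt z (Pi.single i 1) = (z i)⁻¹ := by
  rw [monoAt, Finset.prod_eq_single i]
  · simp
  · intro j _ hj; simp [Pi.single_eq_of_ne hj]
  · simp

namespace Ser.HasValue

variable {z : Fin n → ℂ} {x y : Ser n} {s t : ℂ}

theorem hasSum_mul (hx : x.HasValue z s) (hy : y.HasValue z t) :
    HasSum (fun ab : (Fin n → ℤ) × (Fin n → ℤ) =>
      (x.coeff (toLex ab.1) * monoAt z ab.1) * (y.coeff (toLex ab.2) * monoAt z ab.2)) (s * t) := by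
  have := hasSum_mul_prod hx hy
  exact this

/-- The absolutely convergent double series is grouped by the sum of the two exponents. Each group
is finite because the supports are well ordered, and it is the coefficient of the product. -/
theorem mul (hz : ∀ i, z i ≠ 0) (hx : x.HasValue z s) (hy : y.HasValue z t) :
    (x * y).HasValue z (s * t) := by
  let e : (Fin n → ℤ) × (Fin n → ℤ) ≃ (Fin n → ℤ) × (Fin n → ℤ) :=
    { toFun := fun ca => (ca.2, ca.1 - ca.2)
      invFun := fun ab => (ab.1 + ab.2, ab.1)
      left_inv := fun ca => by simp
      right_inv := fun ab => by simp }
  refine HasSum.prod_fiberwise ((e.hasSum_iff).mpr (hasSum_mul hx hy)) fun c => ?_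
  let A := (Finset.antidiagonal x.isPWO_support y.isPWO_support (toLex c)).image
    fun ij => ofLex ij.1
  have h0 : ∀ a ∉ A, x.coeff (toLex a) * monoAt z a *
      (y.coeff (toLex (c - a)) * monoAt z (c - a)) = 0 := by
    intro a ha
    by_contra hne
    refine ha (Finset.mem_image.mpr ⟨(toLex a, toLex (c - a)), ?_, rfl⟩)
    rw [Finset.mem_antidiagonal]
    refine ⟨fun h => hne (by rw [h]; ring), fun h => hne (by rw [h]; ring), ?_⟩
    rw [← toLex_add, add_sub_cancel]
  have hfin := hasSum_sum_of_ne_finset_zero (L := SummationFilter.unconditional _) h0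
  suffices hc : ∑ a ∈ A, x.coeff (toLex a) * monoAt z a *
      (y.coeff (toLex (c - a)) * monoAt z (c - a)) = (x * y).coeff (toLex c) * monoAt z c by
    rw [hc] at hfin; exact hfin
  symm
  rw [HahnSeries.coeff_mul, Finset.sum_mul, Finset.sum_image]
  · refine Finset.sum_congr rfl fun ij hij => ?_
    have h : ofLex ij.1 + ofLex ij.2 = c := congrArg ofLex (Finset.mem_antidiagonal.mp hij).2.2
    rw [← h, add_sub_cancel_left, monoAt_add hz, toLex_ofLex, toLex_ofLex]; ring
  · intro ij hij kl hkl h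
    have h1 := (Finset.mem_antidiagonal.mp hij).2.2
    have h2 := (Finset.mem_antidiagonal.mp hkl).2.2
    have h3 : ij.1 = kl.1 := ofLex.injective h
    refine Prod.ext h3 ?_
    rw [← h2, h3] at h1
    exact add_left_cancel h1

theorem ser (hz : ∀ i, z i ≠ 0) (P : LPoly n) : P.ser.HasValue z (ev z hz P) := by
  have h0 : ∀ a ∉ P.coeff.support, P.ser.coeff (toLex a) * monoAt z a = 0 := fun a ha => by
    rw [LPoly.coeff_ser, Finsupp.notMem_support_iff.mp ha, zero_mul]
  have hfin := hasSum_sum_of_ne_finset_zero (L := SummationFilter.unconditional _) h0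
  have hev : ev z hz P = ∑ a ∈ P.coeff.support, P.ser.coeff (toLex a) * monoAt z a := by
    rw [ev_eq_sum, Finsupp.sum]
    exact Finset.sum_congr rfl fun a _ => by rw [LPoly.coeff_ser]; rfl
  rw [hev]; exact hfin

theorem mono (a : Fin n → ℤ) : (Ser.mono a).HasValue z (monoAt z a) := by
  have h0 : ∀ b, b ≠ a → (Ser.mono a).coeff (toLex b) * monoAt z b = 0 := fun b hb => by
    rw [Ser.coeff_mono, if_neg hb, zero_mul]
  have := hasSum_single a h0
  rw [Ser.coeff_mono, if_pos rfl, one_mul] at this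
  exact this

theorem geom (hz : ∀ i, z i ≠ 0) {c : ℂ} {i j : Fin n} (h : i < j) (hc : ‖c * z j‖ < ‖z i‖) :
    (geom c i j h).HasValue z (1 - c * (z j / z i))⁻¹ := by
  have hm : ∀ k : ℕ, monoAt z (k • (Pi.single i 1 - Pi.single j 1)) = (z j / z i) ^ k := by
    intro k
    induction k with
    | zero => rw [zero_smul, monoAt_zero, pow_zero]
    | succ k ih =>
      rw [succ_nsmul, monoAt_add hz, ih, pow_succ, sub_eq_add_neg, monoAt_add hz,
        monoAt_neg_single, monoAt_single]
      ring
  have hg : Function.Injective fun k : ℕ => k • (Pi.single i 1 - Pi.single j 1 : Fin n → ℤ) := by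
    intro k l hkl
    have := congrFun hkl i
    simpa [Pi.single_eq_of_ne h.ne] using this
  refine (hg.hasSum_iff fun a ha => ?_).mp ?_
  · by_contra hne
    obtain ⟨k, rfl⟩ := coeff_rootHom_ne_zero i j h _ (left_ne_zero_of_mul hne)
    exact ha ⟨k, rfl⟩
  · have hlt : ‖c * (z j / z i)‖ < 1 := by
      rw [← mul_div_assoc, norm_div, div_lt_one (norm_pos_iff.mpr (hz i))]; exact hc
    have hsum := hasSum_geometric_of_norm_lt_one hlt
    suffices hc : ∀ k : ℕ, (QuantumAffine.geom c i j h).coeff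
        (toLex (k • (Pi.single i 1 - Pi.single j 1))) *
          monoAt z (k • (Pi.single i 1 - Pi.single j 1)) = (c * (z j / z i)) ^ k by
      rw [← funext hc] at hsum; exact hsum
    intro k
    simp only [QuantumAffine.geom, coeff_rootHom, PowerSeries.coeff_mk, hm,
      mul_pow]

theorem inv_vand (hz : ∀ i, z i ≠ 0) {c : ℂ} (hc : ∀ i j, i < j → ‖c * z j‖ < ‖z i‖) :
    ((vand c (Ser.Z (n := n)))⁻¹).HasValue z (vand c z)⁻¹ := by
  have key : ∀ S ⊆ pairs n,
      (∏ ij ∈ S, (Ser.Z ij.1 - algebraMap ℂ (Ser n) c * Ser.Z ij.2)⁻¹).HasValue z (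
        ∏ ij ∈ S, (z ij.1 - algebraMap ℂ ℂ c * z ij.2)⁻¹) := by
    intro S
    induction S using Finset.induction_on with
    | empty =>
      intro _
      rw [Finset.prod_empty, Finset.prod_empty, ← Ser.mono_zero, ← monoAt_zero z]
      exact mono 0
    | insert ij S hij ih =>
      intro hS
      rw [Finset.prod_insert hij, Finset.prod_insert hij]
      have h := mem_pairs.mp (hS (Finset.mem_insert_self _ _))
      refine mul hz ?_ (ih fun x hx => hS (Finset.mem_insert_of_mem hx))
      rw [inv_Z_sub_C_Z c h]
      convert mul hz (mono (Pi.single ij.1 1)) (geom hz h (hc _ _ h)) using 1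
      rw [monoAt_single, ← mul_inv]
      congr 1
      have := hz ij.1
      rw [Algebra.algebraMap_self_apply]
      field_simp
  rw [vand, vand, ← Finset.prod_inv_distrib, ← Finset.prod_inv_distrib]
  exact key _ subset_rfl

end Ser.HasValue

/-! ### The analytic continuation -/

/-- The function `F H / ∏_{i < j} (z_i - q⁻² z_j) (z_i - q² z_j)`. -/
def quotFun (q : ℂ) (F H : LPoly n) (z : Fin n → ℂ) : ℂ :=
  (F.coeff.sum fun a c => c * monoAt z a) * (H.coeff.sum fun a c => c * monoAt z a) *
    (vand (q ^ 2)⁻¹ z * vand (q ^ 2) z)⁻¹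

/-- `ev` takes a proof that the coordinates are nonzero; `quotFun` writes out the sums in order to
be a function on all of ℂⁿ. -/
theorem quotFun_eq (q : ℂ) (F H : LPoly n) (z : Fin n → ℂ) (hz : ∀ i, z i ≠ 0) :
    quotFun q F H z = ev z hz F * ev z hz H * (vand (q ^ 2)⁻¹ z * vand (q ^ 2) z)⁻¹ := by
  rw [quotFun, ev_eq_sum, ev_eq_sum]; rfl

theorem vand_inv_ne_zero {q : ℂ} (hq0 : q ≠ 0) {z : Fin n → ℂ} (hz : z ∈ polesComplement q n) :
    vand (q ^ 2)⁻¹ z ≠ 0 := by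
  refine Finset.prod_ne_zero_iff.mpr fun ij hij h => ?_
  refine hz.2 ij.2 ij.1 (mem_pairs.mp hij).ne' ?_
  rw [sub_eq_zero.mp h, Algebra.algebraMap_self_apply,
    mul_inv_cancel_left₀ (pow_ne_zero _ hq0)]

theorem analyticAt_coord (i : Fin n) (z : Fin n → ℂ) : AnalyticAt ℂ (fun z : Fin n → ℂ => z i) z :=
  (ContinuousLinearMap.proj (R := ℂ) (φ := fun _ : Fin n => ℂ) i).analyticAt z

theorem analyticAt_monoAt {z : Fin n → ℂ} (hz : ∀ i, z i ≠ 0) (a : Fin n → ℤ) :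
    AnalyticAt ℂ (fun z : Fin n → ℂ => monoAt z a) z :=
  Finset.analyticAt_fun_prod _ fun i _ => (analyticAt_coord i z).zpow (hz i)

theorem analyticAt_vand (p : ℂ) (z : Fin n → ℂ) :
    AnalyticAt ℂ (fun z : Fin n → ℂ => vand p z) z :=
  Finset.analyticAt_fun_prod _ fun ij _ =>
    (analyticAt_coord ij.1 z).sub (analyticAt_const.mul (analyticAt_coord ij.2 z))

theorem analyticOnNhd_quotFun {q : ℂ} (hq0 : q ≠ 0) (F H : LPoly n) :
    AnalyticOnNhd ℂ (quotFun q F H) (polesComplement q n) := by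
  intro z hz
  have hs : ∀ P : LPoly n, AnalyticAt ℂ
      (fun z : Fin n → ℂ => P.coeff.sum fun a c => c * monoAt z a) z := fun P =>
    Finset.analyticAt_fun_sum _ fun a _ => analyticAt_const.mul (analyticAt_monoAt hz.1 a)
  exact ((hs F).mul (hs H)).mul (((analyticAt_vand _ z).mul (analyticAt_vand _ z)).inv
    (mul_ne_zero (vand_inv_ne_zero hq0 hz) (vand_comp_ne_zero hz (Equiv.refl _))))

/-! ### Matrix coefficients as rational functions -/

section Rep

variable {q : ℂ} {V W : Type*} [AddCommGroup V] [Module ℂ V] [AddCommGroup W] [Module ℂ W]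
  {ρ : Uq q →ₐ[ℂ] Module.End ℂ V} {σ : Uq q →ₐ[ℂ] Module.End ℂ W}
  {φ : Module.Dual ℂ V} {ψ : Module.Dual ℂ W} {v : V} {w : W}

theorem isContinuation_quotFun (hq0 : q ≠ 0) {F H : LPoly n}
    (hF : ∀ a : Fin n → ℤ, (F.ser * (vand (q ^ 2)⁻¹ Ser.Z)⁻¹).coeff (toLex a) =
      φ ((List.ofFn fun i => ρ (f q (a i))).prod v))
    (hH : ∀ a : Fin n → ℤ, (H.ser * (vand (q ^ 2) Ser.Z)⁻¹).coeff (toLex a) =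
      ψ ((List.ofFn fun i => σ (e q (a i))).prod w)) :
    IsContinuation ρ σ φ ψ v w n (quotFun q F H) := by
  refine ⟨analyticOnNhd_quotFun hq0 F H, ‖(q ^ 2)⁻¹‖ + ‖q ^ 2‖, ?_, fun z hz hr => ?_⟩
  · have := norm_pos_iff.mpr (pow_ne_zero 2 hq0)
    positivity
  · have h1 : ∀ i j, i < j → ‖(q ^ 2)⁻¹ * z j‖ < ‖z i‖ := fun i j hij => by
      rw [norm_mul]
      refine lt_of_le_of_lt ?_ (hr i j hij)
      gcongr
      exact le_add_of_nonneg_right (norm_nonneg _)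
    have h2 : ∀ i j, i < j → ‖q ^ 2 * z j‖ < ‖z i‖ := fun i j hij => by
      rw [norm_mul]
      refine lt_of_le_of_lt ?_ (hr i j hij)
      gcongr
      exact le_add_of_nonneg_left (norm_nonneg _)
    have := Ser.HasValue.hasSum_mul
      ((Ser.HasValue.ser hz F).mul hz (Ser.HasValue.inv_vand hz h1))
      ((Ser.HasValue.ser hz H).mul hz (Ser.HasValue.inv_vand hz h2))
    rw [quotFun_eq q F H z hz]
    convert this using 1
    · funext ab
      rw [currentTerm, hF, hH]
      have : ∏ i, z i ^ (-ab.1 i - ab.2 i) = monoAt z ab.1 * monoAt z ab.2 := by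
        rw [← monoAt_add hz, monoAt]
        exact Finset.prod_congr rfl fun i _ => by rw [Pi.add_apply, neg_add']
      rw [this]; ring
    · rw [mul_inv]; ring

/-- The points of the line through `z` and `w` in the complement of the poles form a connected
set. -/
theorem isPreconnected_line (z : Fin n → ℂ) {w : Fin n → ℂ}
    (hw : w ∈ polesComplement q n) :
    IsPreconnected {s : ℂ | w + s • (z - w) ∈ polesComplement q n} := by
  have hsub : ∀ a b : ℂ, b ≠ 0 → {s : ℂ | b + s * a = 0}.Countable := by
    intro a b hb
    refine Set.Subsingleton.countable fun s hs t ht => ?_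
    simp only [Set.mem_ofPred_eq] at hs ht
    have ha : a ≠ 0 := by rintro rfl; simp at hs; exact hb hs
    exact mul_right_cancel₀ ha (by linear_combination hs - ht)
  -- Each forbidden equation is affine in s and fails at s = 0, so it has at most one solution, and
  -- ℂ without a countable set is path connected.
  have hc : {s : ℂ | w + s • (z - w) ∈ polesComplement q n}ᶜ.Countable := by
    refine Set.Countable.mono (s₂ := (⋃ i : Fin n, {s : ℂ | w i + s * (z i - w i) = 0}) ∪
      ⋃ ij : {ij : Fin n × Fin n // ij.1 ≠ ij.2}, {s : ℂ | (w ij.1.1 - q ^ 2 * w ij.1.2) +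
        s * ((z ij.1.1 - w ij.1.1) - q ^ 2 * (z ij.1.2 - w ij.1.2)) = 0}) ?_ ?_
    · intro s hs
      by_contra hns
      simp only [Set.mem_union, Set.mem_iUnion, not_or, not_exists] at hns
      refine hs ⟨fun i hi => hns.1 i ?_, fun i j hij he => hns.2 ⟨(i, j), hij⟩ ?_⟩
      · simpa using hi
      · simp only [Pi.add_apply, Pi.smul_apply, Pi.sub_apply, smul_eq_mul] at he
        simp only [Set.mem_ofPred_eq]
        linear_combination he
    · refine Set.Countable.union (Set.countable_iUnion fun i => hsub _ _ (hw.1 i))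
        (Set.countable_iUnion fun ij => hsub _ _ (sub_ne_zero.mpr (hw.2 _ _ ij.2)))
  have := hc.isPathConnected_compl_of_one_lt_rank (by
    rw [Complex.rank_real_complex]; exact Cardinal.one_lt_two)
  rw [compl_compl] at this
  exact this.isConnected.isPreconnected

/-- Both functions are the sum of the same series on an open set. The identity theorem is applied in
one variable, along the complex line from a point of this set to the given point. -/
theorem IsContinuation.eqOn (hq0 : q ≠ 0) {G G' : (Fin n → ℂ) → ℂ}
    (hG : IsContinuation ρ σ φ ψ v w n G) (hG' : IsContinuation ρ σ φ ψ v w n G') :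
    Set.EqOn G G' (polesComplement q n) := by
  obtain ⟨ha, r, hr, hs⟩ := hG
  obtain ⟨ha', r', hr', hs'⟩ := hG'
  -- The two norms keep the region Ω away from the shifted diagonals.
  set R : ℝ := r + r' + ‖q ^ 2‖ + ‖(q ^ 2)⁻¹‖ with hR
  have hRpos : 0 < R := by positivity
  let Ω : Set (Fin n → ℂ) := {z | (∀ i, z i ≠ 0) ∧ ∀ i j, i < j → R * ‖z j‖ < ‖z i‖}
  have hΩ : IsOpen Ω := by
    have h1 : Ω = (⋂ i, {z : Fin n → ℂ | z i ≠ 0}) ∩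
        ⋂ ij : {ij : Fin n × Fin n // ij.1 < ij.2}, {z | R * ‖z ij.1.2‖ < ‖z ij.1.1‖} := by
      ext z
      simp [Ω]
    rw [h1]
    refine IsOpen.inter (isOpen_iInter_of_finite fun i => ?_) (isOpen_iInter_of_finite fun ij => ?_)
    · exact isOpen_ne_fun (continuous_apply i) continuous_const
    · exact isOpen_lt (by fun_prop) (by fun_prop)
  have hmono : ∀ {z : Fin n → ℂ}, z ∈ Ω → ∀ c : ℝ, c ≤ R → ∀ i j, i < j → c * ‖z j‖ < ‖z i‖ :=
    fun hz c hc i j hij => lt_of_le_of_lt (by gcongr) (hz.2 i j hij)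
  have hn := norm_nonneg (q ^ 2)
  have hn' := norm_nonneg (q ^ 2)⁻¹
  have heq : Set.EqOn G G' Ω := fun z hz =>
    (hs z hz.1 (hmono hz r (by linarith))).unique (hs' z hz.1 (hmono hz r' (by linarith)))
  have hΩp : Ω ⊆ polesComplement q n := by
    refine fun z hz => ⟨hz.1, fun i j hij he => ?_⟩
    rcases lt_or_gt_of_ne hij with hlt | hlt
    · have := hmono hz ‖q ^ 2‖ (by linarith) i j hlt
      rw [he, norm_mul] at this
      exact lt_irrefl _ this
    · have := hmono hz ‖(q ^ 2)⁻¹‖ (by linarith) j i hlt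
      rw [he, ← norm_mul, inv_mul_cancel_left₀ (pow_ne_zero _ hq0)] at this
      exact lt_irrefl _ this
  -- Neighbouring coordinates have ratio R + 1 > R.
  let w₀ : Fin n → ℂ := fun i => ((R + 1 : ℝ) : ℂ) ^ (n - (i : ℕ))
  have hw₀ : w₀ ∈ Ω := by
    have hR1 : ((R + 1 : ℝ) : ℂ) ≠ 0 := by
      rw [Complex.ofReal_ne_zero]; positivity
    refine ⟨fun i => pow_ne_zero _ hR1, fun i j hij => ?_⟩
    have hnorm : ∀ i, ‖w₀ i‖ = (R + 1) ^ (n - (i : ℕ)) := fun i => by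
      simp only [w₀]
      rw [norm_pow, Complex.norm_real, Real.norm_of_nonneg (by positivity)]
    rw [hnorm, hnorm]
    have hpow : (R + 1) ^ (n - (j : ℕ) + 1) ≤ (R + 1) ^ (n - (i : ℕ)) :=
      pow_le_pow_right₀ (by linarith) (by have := Fin.lt_def.mp hij; omega)
    have : 0 < (R + 1) ^ (n - (j : ℕ)) := by positivity
    rw [pow_succ] at hpow
    linarith
  intro z hz
  let γ : ℂ → Fin n → ℂ := fun s => w₀ + s • (z - w₀)
  have hγ : ∀ s, AnalyticAt ℂ γ s := fun s =>
    analyticAt_const.add (analyticAt_id.smul analyticAt_const)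
  have hγ0 : γ 0 = w₀ := by simp [γ]
  have hγ1 : γ 1 = z := by simp [γ]
  have h0 : (0 : ℂ) ∈ {s : ℂ | w₀ + s • (z - w₀) ∈ polesComplement q n} := by
    have := hΩp hw₀
    rw [← hγ0] at this; exact this
  have hnear : (fun s => G (γ s)) =ᶠ[nhds 0] fun s => G' (γ s) := by
    have : ∀ᶠ s in nhds (0 : ℂ), γ s ∈ Ω :=
      (hγ 0).continuousAt.eventually_mem (hΩ.mem_nhds (by rw [hγ0]; exact hw₀))
    filter_upwards [this] with s hs using heq hs
  have := AnalyticOnNhd.eqOn_of_preconnected_of_eventuallyEq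
    (f := fun s => G (γ s)) (g := fun s => G' (γ s))
    (fun s hs => (ha (γ s) hs).comp (hγ s)) (fun s hs => (ha' (γ s) hs).comp (hγ s))
    (isPreconnected_line z (hΩp hw₀)) h0 hnear
  have hz1 : γ 1 ∈ polesComplement q n := by rw [hγ1]; exact hz
  have h1 := this hz1
  simpa only [hγ1] using h1

end Rep

end QuantumAffine

end

noncomputable section

namespace QuantumAffine

variable {n : ℕ}

/-! ### Relations in the algebra -/

section Relations

variable {q : ℂ}

theorem toUq_eq_of_rel {x y : Free} (h : Rel q x y) : toUq q x = toUq q y :=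
  RingQuot.mkAlgHom_rel ℂ h

/-- The extreme coefficient a = -1 of the exchange relation: the mode of K⁺ of index -1 is zero, and
the remaining factor q^{c/2} is invertible. -/
theorem k_mul_e (b : ℤ) : k q * e q b = q ^ 2 • (e q b * k q) := by
  have h := toUq_eq_of_rel (Rel.kp_e (q := q) (-1) b)
  have hc := toUq_eq_of_rel (Rel.inv_c (q := q))
  have hk : Free.kp (-1) = 0 := rfl
  rw [hk, zero_mul, smul_zero, sub_zero, mul_zero, sub_zero, map_smul, map_mul, map_mul, map_mul,
    map_mul, neg_add_cancel] at h
  rw [map_mul, map_one] at hc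
  have := congrArg (toUq q Free.cInv * ·) h
  simp only [mul_smul_comm, ← mul_assoc, hc, one_mul] at this
  exact this

theorem k_mul_f (b : ℤ) : k q * f q b = (q ^ 2)⁻¹ • (f q b * k q) := by
  have h := toUq_eq_of_rel (Rel.kp_f (q := q) (-1) b)
  have hc := toUq_eq_of_rel (Rel.c_inv (q := q))
  have hk : Free.kp (-1) = 0 := rfl
  rw [hk, zero_mul, smul_zero, sub_zero, mul_zero, sub_zero, map_smul, map_mul, map_mul, map_mul,
    map_mul, neg_add_cancel] at h
  rw [map_mul, map_one] at hc
  have := congrArg (toUq q Free.c * ·) h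
  simp only [mul_smul_comm, ← mul_assoc, hc, one_mul] at this
  exact this

theorem d_mul_e (a : ℤ) : d q * e q a = e q a * d q + (a : ℂ) • e q a := by
  have h := toUq_eq_of_rel (Rel.d_e (q := q) a)
  rw [map_sub, map_mul, map_mul, map_smul] at h
  exact sub_eq_iff_eq_add'.mp h

theorem d_mul_f (a : ℤ) : d q * f q a = f q a * d q + (a : ℂ) • f q a := by
  have h := toUq_eq_of_rel (Rel.d_f (q := q) a)
  rw [map_sub, map_mul, map_mul, map_smul] at h
  exact sub_eq_iff_eq_add'.mp h

theorem exists_mul_k_eq_one (q : ℂ) : ∃ x : Uq q, x * k q = 1 :=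
  ⟨toUq q (Free.km 0), by
    rw [k, ← map_mul, toUq_eq_of_rel Rel.inv_k, map_one]⟩

theorem e_exchange (a b : ℤ) : e q (a + 1) * e q b - q ^ 2 • (e q a * e q (b + 1)) =
    q ^ 2 • (e q b * e q (a + 1)) - e q (b + 1) * e q a := by
  have h := toUq_eq_of_rel (Rel.e_e (q := q) a b)
  simp only [map_sub, map_smul, map_mul] at h
  exact h

theorem f_exchange (a b : ℤ) : f q (a + 1) * f q b - (q ^ 2)⁻¹ • (f q a * f q (b + 1)) =
    (q ^ 2)⁻¹ • (f q b * f q (a + 1)) - f q (b + 1) * f q a := by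
  have h := toUq_eq_of_rel (Rel.f_f (q := q) a b)
  simp only [map_sub, map_smul, map_mul] at h
  exact h

end Relations

/-! ### Words in the modes of a current -/

section Words

variable {V : Type*} [AddCommGroup V] [Module ℂ V]

theorem prod_ofFn_split {A : Type*} [Monoid A] (g : Fin n → A) (i : Fin n) (h : (i : ℕ) + 1 < n) :
    (List.ofFn g).prod = ((List.ofFn g).take i).prod *
      (g i * g ⟨i + 1, h⟩ * ((List.ofFn g).drop (i + 2)).prod) := by
  rw [← List.prod_take_mul_prod_drop _ (i : ℕ), List.drop_eq_getElem_cons (by simp),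
    List.drop_eq_getElem_cons (by simpa using h), List.prod_cons, List.prod_cons, mul_assoc (g i)]
  simp

/-- The exchange relation for adjacent factors of a word. -/
theorem prod_ofFn_exchange {A : Type*} [Ring A] [Algebra ℂ A] {x : ℤ → A} {p : ℂ}
    (hx : ∀ a b, x (a + 1) * x b - p • (x a * x (b + 1)) = p • (x b * x (a + 1)) - x (b + 1) * x a)
    (i : Fin n) (h : (i : ℕ) + 1 < n) (a : Fin n → ℤ) :
    (List.ofFn fun j => x ((a ∘ Equiv.swap i ⟨i + 1, h⟩ + Pi.single i 1 : Fin n → ℤ) j)).prod -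
      p • (List.ofFn fun j =>
        x ((a ∘ Equiv.swap i ⟨i + 1, h⟩ + Pi.single ⟨i + 1, h⟩ 1 : Fin n → ℤ) j)).prod =
    -((List.ofFn fun j => x ((a + Pi.single i 1 : Fin n → ℤ) j)).prod -
      p • (List.ofFn fun j => x ((a + Pi.single ⟨i + 1, h⟩ 1 : Fin n → ℤ) j)).prod) := by
  set i' : Fin n := ⟨i + 1, h⟩ with hi'
  have hne : i ≠ i' := by simp [hi', Fin.ext_iff]
  have key : ∀ b : Fin n → ℤ, (∀ j, j ≠ i → j ≠ i' → b j = a j) →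
      (List.ofFn fun j => x (b j)).prod = ((List.ofFn fun j => x (a j)).take i).prod *
        (x (b i) * x (b i') * ((List.ofFn fun j => x (a j)).drop (i + 2)).prod) := by
    intro b hb
    rw [prod_ofFn_split _ i h]
    congr 2
    · refine List.ext_getElem (by simp) fun m h1 h2 => ?_
      simp only [List.length_take, List.length_ofFn] at h1
      simp only [List.getElem_take, List.getElem_ofFn]
      rw [hb _ (by simp [Fin.ext_iff]; omega) (by simp [Fin.ext_iff, hi']; omega)]
    · congr 1
      refine List.ext_getElem (by simp) fun m h1 h2 => ?_
      simp only [List.getElem_drop, List.getElem_ofFn]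
      rw [hb _ (by simp [Fin.ext_iff]; omega) (by simp [Fin.ext_iff, hi']; omega)]
  rw [key (a ∘ Equiv.swap i i' + Pi.single i 1) fun j h1 h2 => by
      simp [h1, Equiv.swap_apply_of_ne_of_ne h1 h2],
    key (a ∘ Equiv.swap i i' + Pi.single i' 1) fun j h1 h2 => by
      simp [h2, Equiv.swap_apply_of_ne_of_ne h1 h2],
    key (a + Pi.single i 1) fun j h1 h2 => by simp [h1],
    key (a + Pi.single i' 1) fun j h1 h2 => by simp [h2]]
  simp only [Pi.add_apply, Function.comp_apply, Equiv.swap_apply_left, Equiv.swap_apply_right,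
    Pi.single_eq_same, Pi.single_eq_of_ne hne, Pi.single_eq_of_ne hne.symm, add_zero]
  generalize ((List.ofFn fun j => x (a j)).take i).prod = y
  generalize ((List.ofFn fun j => x (a j)).drop (i + 2)).prod = y'
  -- After the swap, position i carries the mode a_{i+1} and position i+1 the mode a_i.
  have := congrArg (fun T => y * (T * y')) (hx (a i') (a i))
  simp only [sub_mul, mul_sub, smul_mul_assoc, mul_smul_comm] at this
  rw [this, neg_sub]

theorem sum_Ici_eq_sum_drop (a : Fin n → ℤ) (k : Fin n) :
    ∑ i ∈ Finset.Ici k, a i = ((List.ofFn a).drop k).sum := by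
  have h1 := List.sum_take_add_sum_drop (List.ofFn a) (k : ℕ)
  rw [List.sum_take_ofFn, List.sum_ofFn] at h1
  have h2 := Finset.sum_filter_add_sum_filter_not Finset.univ (fun j : Fin n => (j : ℕ) < k) a
  have h3 : Finset.Ici k = Finset.univ.filter fun j : Fin n => ¬(j : ℕ) < k := by
    ext j; simp only [Finset.mem_Ici, Finset.mem_filter, Finset.mem_univ, true_and, Fin.le_def,
      not_lt]
  rw [h3]
  linarith

theorem word_apply_eq_zero {x : ℤ → Module.End ℂ V} {v : V} (l : List ℤ) (i : ℕ)
    (h : ((l.drop i).map x).prod v = 0) : (l.map x).prod v = 0 := by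
  rw [← List.prod_take_mul_prod_drop (l.map x) i, ← List.map_drop, Module.End.mul_apply, h,
    map_zero]

theorem ofFn_eq_map (x : ℤ → Module.End ℂ V) (a : Fin n → ℤ) :
    (List.ofFn fun i => x (a i)) = (List.ofFn a).map x := List.map_ofFn.symm

/-- The right end of a word acts first, so every tail has to be nonzero on v, which bounds all tail
sums; the functional bounds only the total degree. -/
theorem tailBound_of_word_ne_zero {x : ℤ → Module.End ℂ V} {φ : Module.Dual ℂ V} {v : V} {M N : ℤ}
    (hM : ∀ l : List ℤ, M < l.sum → (l.map x).prod v = 0)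
    (hN : ∀ l : List ℤ, l.sum < -N → φ ((l.map x).prod v) = 0) (a : Fin n → ℤ)
    (ha : φ ((List.ofFn fun i => x (a i)).prod v) ≠ 0) : TailBound M N a := by
  rw [ofFn_eq_map] at ha
  constructor
  · intro k
    rw [sum_Ici_eq_sum_drop]
    by_contra! hlt
    exact ha (by rw [word_apply_eq_zero _ _ (hM _ hlt), map_zero])
  · by_contra! hlt
    exact ha (hN _ (by rw [List.sum_ofFn]; exact hlt))

/-- The generating function of the matrix coefficients of words, multiplied by
`∏_{i < j} (z_i - p z_j)`, is an antisymmetric Laurent polynomial. -/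
theorem exists_antisymm_of_words {x : ℤ → Module.End ℂ V} {p : ℂ}
    (hx : ∀ a b, x (a + 1) * x b - p • (x a * x (b + 1)) = p • (x b * x (a + 1)) - x (b + 1) * x a)
    {φ : Module.Dual ℂ V} {v : V} {M N : ℤ} (hM0 : 0 ≤ M)
    (hM : ∀ l : List ℤ, M < l.sum → (l.map x).prod v = 0)
    (hN : ∀ l : List ℤ, l.sum < -N → φ ((l.map x).prod v) = 0) (n : ℕ) :
    ∃ P : LPoly n, P.IsAntisymm ∧ ∀ a : Fin n → ℤ,
      (P.ser * (vand p Ser.Z)⁻¹).coeff (toLex a) = φ ((List.ofFn fun i => x (a i)).prod v) := by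
  obtain ⟨P, hP, hser⟩ := exists_antisymm_of_exchange hM0
    (c := fun a : Fin n → ℤ => φ ((List.ofFn fun i => x (a i)).prod v))
    (tailBound_of_word_ne_zero hM hN) p fun i h a => by
      have := congrArg (fun T : Module.End ℂ V => φ (T v)) (prod_ofFn_exchange hx i h a)
      simpa only [LinearMap.sub_apply, LinearMap.smul_apply, LinearMap.neg_apply, map_sub, map_neg,
        map_smul, smul_eq_mul] using this
  refine ⟨P, hP, fun a => ?_⟩
  rw [hser, mul_comm (vand p Ser.Z), mul_assoc, mul_inv_cancel₀ (vand_Z_ne_zero p), mul_one]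
  rfl

end Words

/-! ### Weights -/

section Weights

variable {q : ℂ} {V : Type*} [AddCommGroup V] [Module ℂ V] {ρ : Uq q →ₐ[ℂ] Module.End ℂ V}

theorem mem_weightSpace {μ : ℂ × ℂ} {v : V} :
    v ∈ weightSpace ρ μ ↔ ρ (k q) v = μ.1 • v ∧ ρ (d q) v = μ.2 • v := by
  rw [weightSpace, Submodule.mem_inf, Module.End.mem_eigenspace_iff, Module.End.mem_eigenspace_iff]

/-- The modes `x a` multiply the eigenvalue of `k` by `s` and raise that of `d` by `a`. -/
def IsShift (ρ : Uq q →ₐ[ℂ] Module.End ℂ V) (s : ℂ) (x : ℤ → Module.End ℂ V) : Prop :=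
  ∀ (a : ℤ) (μ : ℂ × ℂ), ∀ v ∈ weightSpace ρ μ, x a v ∈ weightSpace ρ (s * μ.1, μ.2 + a)

theorem isShift_of_relations {s : ℂ} {x : ℤ → Uq q} (hk : ∀ a, k q * x a = s • (x a * k q))
    (hd : ∀ a, d q * x a = x a * d q + (a : ℂ) • x a) : IsShift ρ s fun a => ρ (x a) := by
  intro a μ v hv
  rw [mem_weightSpace] at hv ⊢
  constructor
  · rw [← Module.End.mul_apply, ← map_mul, hk, map_smul, map_mul, LinearMap.smul_apply,
      Module.End.mul_apply, hv.1, map_smul, smul_smul]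
  · rw [← Module.End.mul_apply, ← map_mul, hd, map_add, map_smul, map_mul, LinearMap.add_apply,
      LinearMap.smul_apply, Module.End.mul_apply, hv.2, map_smul, ← add_smul]

theorem isShift_e : IsShift ρ (q ^ 2) fun a => ρ (e q a) := isShift_of_relations k_mul_e d_mul_e

theorem isShift_f : IsShift ρ (q ^ 2)⁻¹ fun a => ρ (f q a) := isShift_of_relations k_mul_f d_mul_f

theorem IsShift.word_mem {s : ℂ} {x : ℤ → Module.End ℂ V} (hx : IsShift ρ s x) {μ : ℂ × ℂ} {v : V}
    (hv : v ∈ weightSpace ρ μ) (l : List ℤ) :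
    (l.map x).prod v ∈ weightSpace ρ (s ^ l.length * μ.1, μ.2 + (l.sum : ℤ)) := by
  induction l with
  | nil => simpa using hv
  | cons a l ih =>
    have := hx a _ _ ih
    rw [List.map_cons, List.prod_cons, Module.End.mul_apply, List.length_cons, List.sum_cons]
    convert this using 2
    · simp only [Prod.mk.injEq]
      constructor
      · ring
      · push_cast; ring

/-- The bounds needed below are additive in the vector, so they only have to be found for nonzero
weight vectors. -/
theorem exists_bound_of_weightSpace (hρ : IsHighestWeight ρ) {Q : V → ℤ → Prop}
    (hmono : ∀ v M M', M ≤ M' → Q v M → Q v M') (h0 : Q 0 0)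
    (hadd : ∀ v w M, Q v M → Q w M → Q (v + w) M)
    (hw : ∀ μ, ∀ v ∈ weightSpace ρ μ, v ≠ 0 → ∃ M, Q v M) (v : V) : ∃ M, 0 ≤ M ∧ Q v M := by
  have hv : v ∈ ⨆ μ, weightSpace ρ μ := by rw [hρ.1]; trivial
  refine Submodule.iSup_induction (motive := fun v => ∃ M, 0 ≤ M ∧ Q v M) _ hv ?_ ⟨0, le_rfl, h0⟩ ?_
  · intro μ v hv
    rcases eq_or_ne v 0 with rfl | hne
    · exact ⟨0, le_rfl, h0⟩
    · obtain ⟨M, hM⟩ := hw μ v hv hne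
      exact ⟨max M 0, le_max_right _ _, hmono _ _ _ (le_max_left _ _) hM⟩
  · rintro v w ⟨M, hM0, hM⟩ ⟨M', -, hM'⟩
    exact ⟨max M M', hM0.trans (le_max_left _ _), hadd _ _ _ (hmono _ _ _ (le_max_left _ _) hM)
      (hmono _ _ _ (le_max_right _ _) hM')⟩

theorem exists_int_bound {ι : Type*} (S : Finset ι) (Q : ι → ℤ → Prop)
    (hmono : ∀ i M M', M ≤ M' → Q i M → Q i M') (h : ∀ i ∈ S, ∃ M, Q i M) :
    ∃ M, ∀ i ∈ S, Q i M := by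
  classical
  induction S using Finset.induction_on with
  | empty => exact ⟨0, by simp⟩
  | insert i S _ ih =>
    obtain ⟨M, hM⟩ := ih fun j hj => h j (Finset.mem_insert_of_mem hj)
    obtain ⟨M', hM'⟩ := h i (Finset.mem_insert_self _ _)
    refine ⟨max M M', fun j hj => ?_⟩
    rcases Finset.mem_insert.mp hj with rfl | hj
    · exact hmono _ _ _ (le_max_right _ _) hM'
    · exact hmono _ _ _ (le_max_left _ _) (hM j hj)

/-- Words in the modes of `f` of large degree kill a given vector. -/
theorem IsHighestWeight.exists_f_bound (hρ : IsHighestWeight ρ) (v : V) :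
    ∃ M : ℤ, 0 ≤ M ∧ ∀ l : List ℤ, M < l.sum → (l.map fun a => ρ (f q a)).prod v = 0 := by
  refine exists_bound_of_weightSpace hρ
    (Q := fun v M => ∀ l : List ℤ, M < l.sum → (l.map fun a => ρ (f q a)).prod v = 0)
    (fun v M M' h hM l hl => hM l (by omega))
    (fun l _ => map_zero _) (fun v w M hv hw l hl => by rw [map_add, hv l hl, hw l hl, add_zero])
    (fun μ v hv _ => ?_) v
  obtain ⟨S, hS⟩ := hρ.2
  -- A word of degree s raises the eigenvalue of d by s, while a weight in the cone at l has
  -- eigenvalue l.2 - a with a ≥ 0; comparing real parts bounds s.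
  obtain ⟨M, hM⟩ := exists_int_bound S (fun l M => ∀ (a : ℕ) (s : ℤ), μ.2 + s = l.2 - a → s ≤ M)
    (fun i M M' h hM a s hs => (hM a s hs).trans h) fun l _ => ⟨⌈(l.2 - μ.2).re⌉, fun a s hs => by
      have h1 : (s : ℝ) = (l.2 - μ.2).re - a := by
        have := congrArg Complex.re hs
        simp at this ⊢; linarith
      have h2 := Int.le_ceil (l.2 - μ.2).re
      have h3 : (s : ℝ) ≤ (⌈(l.2 - μ.2).re⌉ : ℤ) := by
        have : (0 : ℝ) ≤ a := Nat.cast_nonneg a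
        linarith
      exact_mod_cast h3⟩
  refine ⟨M, fun l hl => ?_⟩
  by_contra hne
  have hmem := isShift_f.word_mem hv l
  obtain ⟨m, hm, a, b, hab⟩ := hS _ fun h => hne (by rw [h] at hmem; exact hmem)
  exact absurd (hM m hm a _ (Prod.mk.inj hab).2) (not_le.mpr hl)

theorem zpow_injective_of_not_root (hq0 : q ≠ 0) (hq : ∀ n : ℕ, 0 < n → q ^ n ≠ 1) :
    Function.Injective fun m : ℤ => q ^ m := by
  have h : ∀ m : ℤ, q ^ m = 1 → m = 0 := by
    intro m hm
    obtain ⟨k, rfl | rfl⟩ := m.eq_nat_or_neg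
    · by_contra hne
      exact hq k (by omega) (by simpa using hm)
    · by_contra hne
      exact hq k (by omega) (by simpa using hm)
  intro a b hab
  have := h (a - b) (by
    simp only at hab
    rw [zpow_sub₀ hq0, hab, div_self (zpow_ne_zero _ hq0)])
  omega

/-- Words in the modes of `e` of large degree or length kill a given vector. -/
theorem IsHighestWeight.exists_e_bound (hq0 : q ≠ 0) (hq : ∀ n : ℕ, 0 < n → q ^ n ≠ 1)
    (hρ : IsHighestWeight ρ) (v : V) :
    ∃ M : ℤ, 0 ≤ M ∧ ∀ l : List ℤ, M < l.sum + l.length →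
      (l.map fun a => ρ (e q a)).prod v = 0 := by
  refine exists_bound_of_weightSpace hρ
    (Q := fun v M => ∀ l : List ℤ, M < l.sum + l.length → (l.map fun a => ρ (e q a)).prod v = 0)
    (fun v M M' h hM l hl => hM l (by omega))
    (fun l _ => map_zero _) (fun v w M hv hw l hl => by rw [map_add, hv l hl, hw l hl, add_zero])
    (fun μ v hv hv0 => ?_) v
  -- k has a left inverse, so it has no eigenvector with eigenvalue 0.
  have hμ : μ.1 ≠ 0 := by
    intro h0
    obtain ⟨x, hx⟩ := exists_mul_k_eq_one q
    have h1 := (mem_weightSpace.mp hv).1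
    rw [h0, zero_smul] at h1
    refine hv0 ?_
    have : ρ (x * k q) v = 0 := by rw [map_mul, Module.End.mul_apply, h1, map_zero]
    rwa [hx, map_one, Module.End.one_apply] at this
  obtain ⟨S, hS⟩ := hρ.2
  have hb : ∀ l : ℂ × ℂ, ∃ M : ℤ, ∀ (a b N : ℕ) (s : ℤ), μ.2 + s = l.2 - a →
      (q ^ 2) ^ N * μ.1 = q ^ (2 * ((a : ℤ) - b)) * l.1 → s + N ≤ M := by
    intro l
    by_cases hex : ∃ a b N : ℕ, (q ^ 2) ^ N * μ.1 = q ^ (2 * ((a : ℤ) - b)) * l.1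
    · obtain ⟨a₀, b₀, N₀, h₀⟩ := hex
      -- Since q is not a root of unity, the eigenvalue of k determines N - a + b, so it has the
      -- value of one fixed solution. Adding the bound on s + a from d bounds s + N + b, hence s +
      -- N.
      refine ⟨⌈(l.2 - μ.2).re⌉ + (N₀ - a₀ + b₀), fun a b N s hs hN => ?_⟩
      have h1 : (s : ℝ) = (l.2 - μ.2).re - a := by
        have := congrArg Complex.re hs
        simp at this ⊢; linarith
      have h2 := Int.le_ceil (l.2 - μ.2).re
      have h3 : s + a ≤ ⌈(l.2 - μ.2).re⌉ := by
        have : (s : ℝ) + a ≤ (⌈(l.2 - μ.2).re⌉ : ℤ) := by linarith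
        exact_mod_cast this
      have hl : ∀ a b N : ℕ, (q ^ 2) ^ N * μ.1 = q ^ (2 * ((a : ℤ) - b)) * l.1 →
          l.1 = q ^ (2 * ((N : ℤ) - a + b)) * μ.1 := by
        intro a b N h
        have e1 : (q ^ 2) ^ N = q ^ (2 * (N : ℤ)) := by
          rw [← pow_mul, ← zpow_natCast]; push_cast; rfl
        have e2 : q ^ (2 * ((N : ℤ) - a + b)) =
            (q ^ (2 * ((a : ℤ) - b)))⁻¹ * q ^ (2 * (N : ℤ)) := by
          rw [← zpow_neg, ← zpow_add₀ hq0]; congr 1; ring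
        rw [e2, mul_assoc, ← e1, h, inv_mul_cancel_left₀ (zpow_ne_zero _ hq0)]
      have h4 := zpow_injective_of_not_root hq0 hq
        (mul_right_cancel₀ hμ ((hl a b N hN).symm.trans (hl a₀ b₀ N₀ h₀)))
      omega
    · exact ⟨0, fun a b N s _ hN => absurd ⟨a, b, N, hN⟩ hex⟩
  obtain ⟨M, hM⟩ := exists_int_bound S (fun l M => ∀ (a b N : ℕ) (s : ℤ), μ.2 + s = l.2 - a →
      (q ^ 2) ^ N * μ.1 = q ^ (2 * ((a : ℤ) - b)) * l.1 → s + N ≤ M)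
    (fun i M M' h hM a b N s hs hN => (hM a b N s hs hN).trans h) fun l _ => hb l
  refine ⟨M, fun l hl => ?_⟩
  by_contra hne
  have hmem := isShift_e.word_mem hv l
  obtain ⟨m, hm, a, b, hab⟩ := hS _ fun h => hne (by rw [h] at hmem; exact hmem)
  exact absurd (hM m hm a b _ _ (Prod.mk.inj hab).2 (Prod.mk.inj hab).1) (not_le.mpr hl)

/-- A restricted functional vanishes on words of very negative degree. -/
theorem IsHighestWeight.exists_lower_bound (hρ : IsHighestWeight ρ) {s : ℂ}
    {x : ℤ → Module.End ℂ V} (hx : IsShift ρ s x) {φ : Module.Dual ℂ V} (hφ : IsRestricted ρ φ)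
    (v : V) : ∃ N : ℤ, ∀ l : List ℤ, l.sum < -N → φ ((l.map x).prod v) = 0 := by
  have h := exists_bound_of_weightSpace hρ
    (Q := fun v N => ∀ l : List ℤ, l.sum < -N → φ ((l.map x).prod v) = 0)
    (fun v M M' h hM l hl => hM l (by omega)) (fun l _ => by rw [map_zero, map_zero])
    (fun v w M hv hw l hl => by rw [map_add, map_add, hv l hl, hw l hl, add_zero])
    (fun μ v hv _ => ?_) v
  · obtain ⟨N, -, hN⟩ := h
    exact ⟨N, hN⟩
  obtain ⟨S, hS⟩ := hφ
  obtain ⟨M, hM⟩ := exists_int_bound S (fun l M => ∀ s : ℤ, μ.2 + s = l.2 → -M ≤ s)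
    (fun i M M' h hM s hs => (neg_le_neg h).trans (hM s hs)) fun l _ =>
      ⟨⌈-(l.2 - μ.2).re⌉, fun s hs => by
        have h1 : (s : ℝ) = (l.2 - μ.2).re := by
          have := congrArg Complex.re hs
          simp at this ⊢; linarith
        have h2 := Int.le_ceil (-(l.2 - μ.2).re)
        have h3 : -((⌈-(l.2 - μ.2).re⌉ : ℤ) : ℝ) ≤ s := by linarith
        exact_mod_cast h3⟩
  refine ⟨M, fun l hl => ?_⟩
  by_contra hne
  have hmem := hx.word_mem hv l
  by_cases hS' : (s ^ l.length * μ.1, μ.2 + (l.sum : ℤ)) ∈ S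
  · exact absurd (hM _ hS' _ rfl) (not_le.mpr hl)
  · exact hne (hS _ hS' _ hmem)

end Weights

end QuantumAffine

end

noncomputable section

namespace QuantumAffine

/-! ### Locally finite sums of operators -/

section LocSum

variable {ι U : Type*} [AddCommGroup U] [Module ℂ U]

/-- Every vector is killed by all but finitely many of the operators. -/
def IsLocallyFinite (A : ι → Module.End ℂ U) : Prop :=
  ∀ u, (Function.support fun i => A i u).Finite

/-- The sum of a locally finite family of operators. -/
def locSum (A : ι → Module.End ℂ U) (hA : IsLocallyFinite A) : Module.End ℂ U where
  toFun u := ∑ᶠ i, A i u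
  map_add' u u' := by
    simp only [map_add]
    exact finsum_add_distrib (hA u) (hA u')
  map_smul' c u := by
    simp only [map_smul, RingHom.id_apply]
    rw [smul_finsum]

theorem locSum_apply (A : ι → Module.End ℂ U) (hA : IsLocallyFinite A) (u : U) :
    locSum A hA u = ∑ᶠ i, A i u := rfl

end LocSum

/-! ### Sums over words and ordered products of `q`-exponentials -/

section OrderedWords

variable {U : Type*} [AddCommGroup U] [Module ℂ U] {x : ℤ → Module.End ℂ U}

/-- Every vector is killed by all but finitely many words. -/
def HasFiniteWords (x : ℤ → Module.End ℂ U) : Prop :=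
  ∀ u, ∃ K : ℕ, ∀ l : List ℤ, (K < l.length ∨ ∃ a ∈ l, (K : ℤ) < |a|) → (l.map x).prod u = 0

/-- The product of the operators `x a` over the elements of a multiset, in increasing order. -/
def sortedWord (x : ℤ → Module.End ℂ U) (s : Multiset ℤ) : Module.End ℂ U :=
  ((s.sort (· ≤ ·)).map x).prod

/-- The contribution of a multiset to the ordered product of `q`-exponentials. -/
def wordTerm (p : ℂ) (x : ℤ → Module.End ℂ U) (s : Multiset ℤ) : Module.End ℂ U :=
  (multFactorial p s)⁻¹ • sortedWord x s

theorem prod_map_smul (c : ℂ) (x : ℤ → Module.End ℂ U) (l : List ℤ) :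
    (l.map fun a => c • x a).prod = c ^ l.length • (l.map x).prod := by
  induction l with
  | nil => simp
  | cons a l ih =>
    rw [List.map_cons, List.prod_cons, ih, List.map_cons, List.prod_cons, List.length_cons,
      smul_mul_smul_comm, pow_succ']

theorem HasFiniteWords.smul (hx : HasFiniteWords x) (c : ℂ) : HasFiniteWords fun a => c • x a :=
  fun u => (hx u).imp fun K hK l hl => by
    rw [prod_map_smul, LinearMap.smul_apply, hK l hl, smul_zero]

theorem sortedWord_smul (c : ℂ) (s : Multiset ℤ) :
    sortedWord (fun a => c • x a) s = c ^ s.card • sortedWord x s := by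
  rw [sortedWord, prod_map_smul, Multiset.length_sort, sortedWord]

theorem multFactorial_zero (p : ℂ) : multFactorial p 0 = 1 := by simp [multFactorial]

theorem wordTerm_zero (p : ℂ) (x : ℤ → Module.End ℂ U) : wordTerm p x 0 = 1 := by
  rw [wordTerm, multFactorial_zero, inv_one, one_smul, sortedWord]
  simp

/-- Only finitely many sorted words do not kill a given vector. -/
theorem exists_words_finset (hx : HasFiniteWords x) (u : U) : ∃ (K : ℕ) (B : Finset (Multiset ℤ)),
    (∀ s ∈ B, s.card ≤ K ∧ ∀ a ∈ s, |a| ≤ K) ∧ ∀ s, sortedWord x s u ≠ 0 → s ∈ B := by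
  obtain ⟨K, hK⟩ := hx u
  have hfin : {s : Multiset ℤ | s.card ≤ K ∧ ∀ a ∈ s, |a| ≤ K}.Finite := by
    -- Such a multiset is contained in K copies of the interval from -K to K.
    refine (Set.finite_Iic (K • (Finset.Icc (-K : ℤ) K).val)).subset fun s hs => ?_
    rw [Set.mem_Iic, Multiset.le_iff_count]
    intro a
    by_cases ha : a ∈ s
    · rw [Multiset.count_nsmul, Multiset.count_eq_one_of_mem (Finset.nodup _)
        (Finset.mem_val.mpr (Finset.mem_Icc.mpr (abs_le.mp (hs.2 a ha)))), mul_one]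
      exact (Multiset.count_le_card a s).trans hs.1
    · rw [Multiset.count_eq_zero_of_notMem ha]; exact Nat.zero_le _
  refine ⟨K, hfin.toFinset, fun s hs => by simpa using hs, fun s hs => ?_⟩
  rw [Set.Finite.mem_toFinset]
  refine ⟨?_, fun a ha => ?_⟩
  · by_contra! h
    exact hs (hK _ (Or.inl (by rwa [Multiset.length_sort])))
  · by_contra! h
    exact hs (hK _ (Or.inr ⟨a, by rwa [Multiset.mem_sort], h⟩))

theorem sortedWord_ne_zero_of_wordTerm {p : ℂ} {s : Multiset ℤ} {u : U}
    (h : wordTerm p x s u ≠ 0) : sortedWord x s u ≠ 0 := fun h0 => h (by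
  rw [wordTerm, LinearMap.smul_apply, h0, smul_zero])

theorem HasFiniteWords.isLocallyFinite (hx : HasFiniteWords x) (p : ℂ) :
    IsLocallyFinite (wordTerm p x) := fun u => by
  obtain ⟨K, B, -, hB⟩ := exists_words_finset hx u
  exact B.finite_toSet.subset fun s hs => hB s (sortedWord_ne_zero_of_wordTerm hs)

theorem HasFiniteWords.exists_pow_eq_zero (hx : HasFiniteWords x) (a : ℤ) (u : U) :
    ∃ K : ℕ, ∀ m, K < m → (x a ^ m) u = 0 := by
  obtain ⟨K, hK⟩ := hx u
  refine ⟨K, fun m hm => ?_⟩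
  have := hK (List.replicate m a) (Or.inl (by simpa using hm))
  rwa [List.map_replicate, List.prod_replicate] at this

theorem HasFiniteWords.isLocallyFinite_exp (hx : HasFiniteWords x) (p : ℂ) (a : ℤ) :
    IsLocallyFinite fun m : ℕ => (qFactorial p m)⁻¹ • x a ^ m := fun u => by
  obtain ⟨K, hK⟩ := hx.exists_pow_eq_zero a u
  refine (Set.finite_Iic K).subset fun m hm => ?_
  by_contra hlt
  exact hm (by
    simp only [LinearMap.smul_apply]
    rw [hK m (not_le.mp hlt), smul_zero])

/-- The `q`-exponential of `x a`. -/
def expOf (hx : HasFiniteWords x) (p : ℂ) (a : ℤ) : Module.End ℂ U :=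
  locSum _ (hx.isLocallyFinite_exp p a)

theorem isQExp_expOf (hx : HasFiniteWords x) (p : ℂ) (a : ℤ) : IsQExp p (x a) (expOf hx p a) := by
  intro u
  obtain ⟨K, hK⟩ := hx.exists_pow_eq_zero a u
  filter_upwards [Filter.eventually_gt_atTop K] with N hN
  rw [expOf, locSum_apply, finsum_eq_sum_of_support_subset (s := Finset.range N)]
  · rfl
  · intro m hm
    rw [Finset.coe_range, Set.mem_Iio]
    by_contra! hle
    exact hm (by
      simp only [LinearMap.smul_apply]
      rw [hK m (by omega), smul_zero])

theorem multFactorial_replicate_add (p : ℂ) {a : ℤ} {s : Multiset ℤ} (ha : a ∉ s) (m : ℕ) :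
    multFactorial p (Multiset.replicate m a + s) = qFactorial p m * multFactorial p s := by
  classical
  have ha' : a ∉ s.toFinset := by simpa using ha
  rw [multFactorial_eq p _ (insert a s.toFinset), Finset.prod_insert ha', multFactorial]
  · congr 1
    · simp [Multiset.count_eq_zero_of_notMem ha]
    · refine Finset.prod_congr rfl fun b hb => ?_
      have hne : b ≠ a := fun h => ha' (h ▸ hb)
      rw [Multiset.count_add, Multiset.count_replicate, if_neg hne.symm, zero_add]
  · intro b hb
    simp only [Multiset.mem_toFinset, Multiset.mem_add, Finset.mem_insert] at hb ⊢
    exact hb.imp Multiset.eq_of_mem_replicate id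

theorem sort_replicate_add {a : ℤ} {s : Multiset ℤ} (ha : ∀ b ∈ s, a ≤ b) (m : ℕ) :
    (Multiset.replicate m a + s).sort (· ≤ ·) = List.replicate m a ++ s.sort (· ≤ ·) := by
  refine List.Perm.eq_of_pairwise (le := (· ≤ ·)) (fun _ _ _ _ h1 h2 => le_antisymm h1 h2)
    (Multiset.pairwise_sort _ _) ?_ ?_
  · rw [List.pairwise_append]
    refine ⟨List.pairwise_replicate.mpr (Or.inr le_rfl), Multiset.pairwise_sort _ _, ?_⟩
    intro b hb c hc
    rw [List.eq_of_mem_replicate hb]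
    exact ha c ((Multiset.mem_sort _).mp hc)
  · rw [← Multiset.coe_eq_coe, Multiset.sort_eq, ← Multiset.coe_add, Multiset.sort_eq,
      Multiset.coe_replicate]

/-- The copies of a mode smaller than all others stand leftmost in the sorted word and split off
their own factorial: this is one term of the q-exponential of `x a`. -/
theorem wordTerm_replicate_add (p : ℂ) (x : ℤ → Module.End ℂ U) {a : ℤ} {s : Multiset ℤ}
    (ha : ∀ b ∈ s, a < b) (m : ℕ) (u : U) :
    wordTerm p x (Multiset.replicate m a + s) u =
      ((qFactorial p m)⁻¹ • x a ^ m) (wordTerm p x s u) := by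
  rw [wordTerm, wordTerm, sortedWord, sortedWord, sort_replicate_add (fun b hb => (ha b hb).le),
    multFactorial_replicate_add p (fun h => lt_irrefl a (ha a h)), List.map_append,
    List.prod_append, List.map_replicate, List.prod_replicate, mul_inv]
  simp only [LinearMap.smul_apply, Module.End.mul_apply, map_smul, smul_smul, mul_comm]

/-- The multisets with elements between `a` and `b`. -/
def boxed (a b : ℤ) : Set (Multiset ℤ) := {s | ∀ c ∈ s, a ≤ c ∧ c ≤ b}

theorem bijOn_replicate_add {a b : ℤ} (hab : a ≤ b) :
    Set.BijOn (fun y : Multiset ℤ × ℕ => Multiset.replicate y.2 a + y.1)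
      (boxed (a + 1) b ×ˢ Set.univ) (boxed a b) := by
  have hnot : ∀ s ∈ boxed (a + 1) b, a ∉ s := fun s hs h => by have := (hs a h).1; omega
  refine ⟨?_, ?_, ?_⟩
  · rintro ⟨s, m⟩ ⟨hs, -⟩ c hc
    rcases Multiset.mem_add.mp hc with hc | hc
    · rw [Multiset.eq_of_mem_replicate hc]; exact ⟨le_rfl, hab⟩
    · have := hs c hc; exact ⟨by omega, this.2⟩
  · rintro ⟨s, m⟩ ⟨hs, -⟩ ⟨s', m'⟩ ⟨hs', -⟩ h
    simp only at h hs hs'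
    have hm : m = m' := by
      have := congrArg (Multiset.count a) h
      simpa [Multiset.count_eq_zero_of_notMem (hnot s hs),
        Multiset.count_eq_zero_of_notMem (hnot s' hs')] using this
    subst hm
    rw [add_left_cancel h]
  · intro s hs
    refine ⟨(s.filter fun c => ¬c = a, s.count a), ⟨fun c hc => ?_, trivial⟩, ?_⟩
    · obtain ⟨h1, h2⟩ := Multiset.mem_filter.mp hc
      have := hs c h1
      exact ⟨by omega, this.2⟩
    · simp only
      rw [← Multiset.filter_eq', Multiset.filter_add_not]

theorem orderedProd_eq (E : ℤ → Module.End ℂ U) (a b : ℤ) :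
    orderedProd E a b = ((List.range (b + 1 - a).toNat).map fun i : ℕ => E (a + i)).prod := by
  simp only [orderedProd, bind_pure_comp, List.map_eq_map, List.map_map, Function.comp_def]

theorem orderedProd_of_lt (E : ℤ → Module.End ℂ U) {a b : ℤ} (h : b < a) :
    orderedProd E a b = 1 := by
  rw [orderedProd_eq, Int.toNat_of_nonpos (by omega)]
  simp

theorem orderedProd_of_le (E : ℤ → Module.End ℂ U) {a b : ℤ} (h : a ≤ b) :
    orderedProd E a b = E a * orderedProd E (a + 1) b := by
  rw [orderedProd_eq, orderedProd_eq]
  obtain ⟨m, hm⟩ : ∃ m, (b + 1 - a).toNat = m + 1 := ⟨(b - a).toNat, by omega⟩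
  have hm' : (b + 1 - (a + 1)).toNat = m := by omega
  rw [hm, hm', List.range_succ_eq_map, List.map_cons, List.prod_cons, List.map_map]
  congr 2
  · simp
  · refine List.map_congr_left fun i _ => ?_
    simp only [Function.comp_apply]
    congr 1; push_cast; ring

/-- The leftmost factor is peeled off. The summation index of its exponential series is the
multiplicity of a, and the remaining product sums over multisets with elements from a + 1 to b. -/
theorem orderedProd_expOf_apply (hx : HasFiniteWords x) (p : ℂ) (u : U) (m : ℕ) (a b : ℤ)
    (hm : (b + 1 - a).toNat = m) :
    orderedProd (expOf hx p) a b u = ∑ᶠ s ∈ boxed a b, wordTerm p x s u := by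
  have hfin := hx.isLocallyFinite p u
  induction m generalizing a with
  | zero =>
    rw [orderedProd_of_lt _ (by omega)]
    have : boxed a b = {0} := by
      ext s
      refine ⟨fun hs => Multiset.eq_zero_of_forall_notMem fun c hc => ?_, ?_⟩
      · have := hs c hc; omega
      · rintro rfl c hc; simp at hc
    rw [this, finsum_mem_singleton, wordTerm_zero]
  | succ m ih =>
    have hab : a ≤ b := by omega
    rw [orderedProd_of_le _ hab, Module.End.mul_apply, ih (a + 1) (by omega)]
    have hbij := bijOn_replicate_add hab
    set e : Multiset ℤ × ℕ → Multiset ℤ := fun y => Multiset.replicate y.2 a + y.1 with he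
    rw [← finsum_mem_eq_of_bijOn (f := fun y => wordTerm p x (e y) u) e hbij fun _ _ => rfl]
    rw [finsum_mem_def, finsum_mem_def, finsum_curry]
    · have hmap := (expOf hx p a).toAddMonoidHom.map_finsum
        (f := (boxed (a + 1) b).indicator fun s => wordTerm p x s u)
        (hfin.subset fun s hs => (Set.indicator_apply_ne_zero.mp hs).2)
      refine hmap.trans (finsum_congr fun s => ?_)
      by_cases hs : s ∈ boxed (a + 1) b
      · rw [Set.indicator_of_mem hs]
        change ∑ᶠ m, _ = _
        refine finsum_congr fun m => ?_
        rw [Set.indicator_of_mem (Set.mk_mem_prod hs (Set.mem_univ m))]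
        exact (wordTerm_replicate_add p x (fun c hc => by have := (hs c hc).1; omega) m u).symm
      · rw [Set.indicator_of_notMem hs, map_zero]
        symm
        refine finsum_eq_zero_of_forall_eq_zero fun m => ?_
        exact Set.indicator_of_notMem (fun h => hs h.1) _
    -- Exchanging the single sum for an iterated one needs finite support, inherited from the family
    -- of words through the injectivity of `e`.
    · refine Set.Finite.of_finite_image (f := e) (hfin.subset ?_) (hbij.injOn.mono ?_)
      · rintro _ ⟨y, hy, rfl⟩
        exact (Set.indicator_apply_ne_zero.mp hy).2
      · exact fun y hy => (Set.indicator_apply_ne_zero.mp hy).1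

/-- The sum over all multisets is the limit of the ordered products of `q`-exponentials. -/
theorem eventually_orderedProd_expOf (hx : HasFiniteWords x) (p : ℂ) (u : U) :
    ∀ᶠ ab : ℤ × ℤ in Filter.atBot ×ˢ Filter.atTop,
      orderedProd (expOf hx p) ab.1 ab.2 u = locSum _ (hx.isLocallyFinite p) u := by
  classical
  obtain ⟨K, B, hB, hB'⟩ := exists_words_finset hx u
  filter_upwards [(Filter.eventually_le_atBot (-(K : ℤ))).prod_mk
    (Filter.eventually_ge_atTop (K : ℤ))] with ab hab
  rw [orderedProd_expOf_apply hx p u _ _ _ rfl, locSum_apply, finsum_mem_def]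
  refine finsum_congr fun s => ?_
  by_cases h0 : wordTerm p x s u = 0
  · rw [Set.indicator_apply, h0, ite_self]
  · refine Set.indicator_of_mem (fun c hc => ?_) _
    have := abs_le.mp ((hB s (hB' s (sortedWord_ne_zero_of_wordTerm h0))).2 c hc)
    exact ⟨hab.1.trans this.1, this.2.trans hab.2⟩

/-! ### Homogeneous parts of the ordered product -/

theorem HasFiniteWords.isLocallyFinite_degree (hx : HasFiniteWords x) (p : ℂ) (n : ℕ) :
    IsLocallyFinite fun s : Multiset ℤ => if s.card = n then wordTerm p x s else 0 := fun u =>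
  (hx.isLocallyFinite p u).subset fun s hs h0 => hs (by
    simp only at h0 ⊢
    split_ifs
    · exact h0
    · rfl)

/-- The contribution of the multisets with `n` elements. -/
def degreePart (hx : HasFiniteWords x) (p : ℂ) (n : ℕ) : Module.End ℂ U :=
  locSum _ (hx.isLocallyFinite_degree p n)

theorem degreePart_apply (hx : HasFiniteWords x) (p : ℂ) (n : ℕ) (u : U) :
    degreePart hx p n u = ∑ᶠ s ∈ {s : Multiset ℤ | s.card = n}, wordTerm p x s u := by
  classical
  rw [degreePart, locSum_apply, finsum_mem_def]
  refine finsum_congr fun s => ?_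
  rw [Set.indicator_apply]
  by_cases h : s.card = n
  · rw [if_pos h, if_pos (by exact h)]
  · rw [if_neg h, if_neg (by exact h), LinearMap.zero_apply]

theorem degreePart_smul (hx : HasFiniteWords x) (c p : ℂ) (n : ℕ) :
    degreePart (hx.smul c) p n = c ^ n • degreePart hx p n := by
  ext u
  rw [LinearMap.smul_apply, degreePart_apply, degreePart_apply, finsum_mem_def, finsum_mem_def,
    smul_finsum]
  refine finsum_congr fun s => ?_
  by_cases h : s ∈ {s : Multiset ℤ | s.card = n}
  · rw [Set.indicator_of_mem h, Set.indicator_of_mem h, wordTerm, wordTerm, sortedWord_smul,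
      show s.card = n from h, smul_comm]
    rfl
  · rw [Set.indicator_of_notMem h, Set.indicator_of_notMem h, smul_zero]

theorem degreePart_zero (hx : HasFiniteWords x) (p : ℂ) (u : U) : degreePart hx p 0 u = u := by
  have : {s : Multiset ℤ | s.card = 0} = {0} := by ext s; simp
  rw [degreePart_apply, this, finsum_mem_singleton, wordTerm_zero, Module.End.one_apply]

theorem eventually_sum_degreePart (hx : HasFiniteWords x) (p : ℂ) (u : U) :
    ∀ᶠ N in Filter.atTop, u + ∑ n ∈ Finset.Icc 1 N, degreePart hx p n u =
      locSum _ (hx.isLocallyFinite p) u := by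
  classical
  obtain ⟨K, B, hB, hB'⟩ := exists_words_finset hx u
  have hB'' : ∀ s, wordTerm p x s u ≠ 0 → s ∈ B := fun s hs =>
    hB' s (sortedWord_ne_zero_of_wordTerm hs)
  filter_upwards [Filter.eventually_ge_atTop K] with N hN
  have h1 : ∀ n, degreePart hx p n u = ∑ s ∈ B, if s.card = n then wordTerm p x s u else 0 := by
    intro n
    rw [degreePart_apply, finsum_mem_def, finsum_eq_sum_of_support_subset (s := B)]
    · exact Finset.sum_congr rfl fun s _ => Set.indicator_apply _ _ _
    · exact fun s hs => hB'' s (Set.indicator_apply_ne_zero.mp hs).2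
  have h2 : u + ∑ n ∈ Finset.Icc 1 N, degreePart hx p n u =
      ∑ n ∈ Finset.range (N + 1), degreePart hx p n u := by
    rw [Finset.sum_range_succ', degreePart_zero, add_comm u]
    congr 1
    rw [Finset.range_eq_Ico, Finset.sum_Ico_add' (fun n => degreePart hx p n u) 0 N 1]
    rfl
  rw [h2, locSum_apply, finsum_eq_sum_of_support_subset _ (s := B) fun s hs => hB'' s hs]
  simp only [h1]
  rw [Finset.sum_comm]
  refine Finset.sum_congr rfl fun s hs => ?_
  rw [Finset.sum_ite_eq, if_pos]
  rw [Finset.mem_range]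
  have := (hB s hs).1
  omega

end OrderedWords

end QuantumAffine

end

noncomputable section

namespace QuantumAffine

/-! ### The operators `f_{-a} ⊗ e_a` -/

/-- The largest coordinate is the last tail sum and the smallest is the first partial sum. -/
theorem TailBound.mem_Icc_of_monotone {n : ℕ} {M N : ℤ} (hM : 0 ≤ M) {m : Fin n → ℤ}
    (h : TailBound M N m) (hm : Monotone m) (i : Fin n) : m i ∈ Finset.Icc (-(M + N)) M := by
  cases n with
  | zero => exact i.elim0
  | succ n =>
    have h1 := h.1 ⊤
    have h2 := h.prefix_bound hM ⊥
    rw [Finset.Ici_top, Finset.sum_singleton] at h1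
    rw [Finset.Iic_bot, Finset.sum_singleton] at h2
    exact Finset.mem_Icc.mpr ⟨h2.trans (hm bot_le), (hm le_top).trans h1⟩

theorem bijOn_monotone_multiset (n : ℕ) :
    Set.BijOn (fun m : Fin n → ℤ => Multiset.map m Finset.univ.val) {m | Monotone m}
      {s | s.card = n} := by
  have hcoe : ∀ m : Fin n → ℤ, Multiset.map m Finset.univ.val = (List.ofFn m : Multiset ℤ) :=
    fun m => by rw [List.ofFn_eq_map, ← Multiset.map_coe]; rfl
  refine ⟨fun m _ => by simp, fun m hm m' hm' h => ?_, fun s hs => ?_⟩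
  · simp only [hcoe, Multiset.coe_eq_coe] at h
    exact List.ofFn_injective (h.eq_of_sortedLE hm.sortedLE_ofFn hm'.sortedLE_ofFn)
  · have hlen : (s.sort (· ≤ ·)).length = n := by rw [Multiset.length_sort]; exact hs
    subst hlen
    refine ⟨(s.sort (· ≤ ·)).get, (Multiset.pairwise_sort s _).sortedLE.monotone_get, ?_⟩
    simp only [hcoe]
    rw [List.ofFn_get, Multiset.sort_eq]

theorem sort_map_univ {n : ℕ} {m : Fin n → ℤ} (hm : Monotone m) :
    (Multiset.map m Finset.univ.val).sort (· ≤ ·) = List.ofFn m := by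
  have hcoe : Multiset.map m Finset.univ.val = (List.ofFn m : Multiset ℤ) := by
    rw [List.ofFn_eq_map, ← Multiset.map_coe]; rfl
  refine List.Perm.eq_of_pairwise (le := (· ≤ ·)) (fun _ _ _ _ h1 h2 => le_antisymm h1 h2)
    (Multiset.pairwise_sort _ _) hm.sortedLE_ofFn.pairwise ?_
  rw [← Multiset.coe_eq_coe, Multiset.sort_eq, hcoe]

theorem sum_map_neg (l : List ℤ) : (l.map Neg.neg).sum = -l.sum := by
  induction l with
  | nil => rfl
  | cons a l ih => rw [List.map_cons, List.sum_cons, ih, List.sum_cons, neg_add]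

section Tensor

variable {q : ℂ} {V W : Type*} [AddCommGroup V] [Module ℂ V] [AddCommGroup W] [Module ℂ W]
  {ρ : Uq q →ₐ[ℂ] Module.End ℂ V} {σ : Uq q →ₐ[ℂ] Module.End ℂ W}

/-- The operator `f_{-a} ⊗ e_a`. -/
def fe (ρ : Uq q →ₐ[ℂ] Module.End ℂ V) (σ : Uq q →ₐ[ℂ] Module.End ℂ W) (a : ℤ) :
    Module.End ℂ (V ⊗[ℂ] W) := TensorProduct.map (ρ (f q (-a))) (σ (e q a))

theorem word_fe_tmul (l : List ℤ) (v : V) (w : W) :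
    (l.map (fe ρ σ)).prod (v ⊗ₜ[ℂ] w) = ((l.map Neg.neg).map fun a => ρ (f q a)).prod v ⊗ₜ[ℂ]
      (l.map fun a => σ (e q a)).prod w := by
  induction l with
  | nil => simp
  | cons a l ih =>
    simp only [List.map_cons, List.prod_cons, Module.End.mul_apply, ih, fe,
      TensorProduct.map_tmul]

/-- The modes of f and e have opposite degrees. If a word does not kill v ⊗ w, each of its tails has
sum at least -M by the bound for f, and sum plus length at most N by the bound for e. So the length
is at most M + N, and so is the absolute value of every letter. -/
theorem hasFiniteWords_fe (hq0 : q ≠ 0) (hq : ∀ n : ℕ, 0 < n → q ^ n ≠ 1)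
    (hρ : IsHighestWeight ρ) (hσ : IsHighestWeight σ) : HasFiniteWords (fe ρ σ) := by
  intro u
  induction u using TensorProduct.induction_on with
  | zero => exact ⟨0, fun l _ => map_zero _⟩
  | add u u' hu hu' =>
    obtain ⟨K, hK⟩ := hu
    obtain ⟨K', hK'⟩ := hu'
    refine ⟨max K K', fun l hl => ?_⟩
    rw [map_add, hK l (hl.imp (fun h => by omega) fun ⟨a, ha, h⟩ => ⟨a, ha, by omega⟩),
      hK' l (hl.imp (fun h => by omega) fun ⟨a, ha, h⟩ => ⟨a, ha, by omega⟩), add_zero]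
  | tmul v w =>
    obtain ⟨M, hM0, hM⟩ := hρ.exists_f_bound v
    obtain ⟨N, hN0, hN⟩ := hσ.exists_e_bound hq0 hq w
    refine ⟨(M + N).toNat, fun l hl => ?_⟩
    by_contra hne
    rw [word_fe_tmul] at hne
    have hf : ∀ i, -(l.drop i).sum ≤ M := by
      intro i
      by_contra! hlt
      refine hne ?_
      rw [word_apply_eq_zero _ i, TensorProduct.zero_tmul]
      refine hM _ ?_
      rw [← List.map_drop, sum_map_neg]
      exact hlt
    have he : ∀ i, (l.drop i).sum + (l.drop i).length ≤ N := by
      intro i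
      by_contra! hlt
      exact hne (by rw [word_apply_eq_zero _ i (hN _ hlt), TensorProduct.tmul_zero])
    rcases hl with hl | ⟨a, ha, hlt⟩
    · have h1 := hf 0
      have h2 := he 0
      rw [List.drop_zero] at h1 h2
      omega
    · obtain ⟨l₁, l₂, rfl⟩ := List.append_of_mem ha
      have h1 := hf l₁.length
      have h2 := he l₁.length
      have h3 := hf (l₁.length + 1)
      have h4 := he (l₁.length + 1)
      have e1 : (l₁ ++ a :: l₂).drop l₁.length = a :: l₂ := List.drop_left
      have e2 : (l₁ ++ a :: l₂).drop (l₁.length + 1) = l₂ := by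
        rw [← List.drop_drop, e1]; rfl
      rw [e1, List.sum_cons] at h1 h2
      rw [e2] at h3 h4
      rw [List.length_cons] at h2
      -- The letter a is the difference of two consecutive tail sums, both between -M and N.
      have := abs_le.mpr (⟨by omega, by omega⟩ : -(M + N) ≤ a ∧ a ≤ M + N)
      omega

/-- The matrix coefficients of the homogeneous parts of the ordered product. -/
theorem dualDistrib_degreePart (hx : HasFiniteWords (fe ρ σ)) (p : ℂ) (n : ℕ)
    (φ : Module.Dual ℂ V) (ψ : Module.Dual ℂ W) (v : V) (w : W) :
    TensorProduct.dualDistrib ℂ V W (φ ⊗ₜ ψ) (degreePart hx p n (v ⊗ₜ w)) =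
      ∑ᶠ m ∈ {m : Fin n → ℤ | Monotone m}, φ ((List.ofFn fun i => ρ (f q ((-m) i))).prod v) *
        ψ ((List.ofFn fun i => σ (e q (m i))).prod w) / kappa p m := by
  set L : V ⊗[ℂ] W →ₗ[ℂ] ℂ := TensorProduct.dualDistrib ℂ V W (φ ⊗ₜ ψ) with hL
  have hmap : L (degreePart hx p n (v ⊗ₜ w)) =
      ∑ᶠ s ∈ {s : Multiset ℤ | s.card = n}, L (wordTerm p (fe ρ σ) s (v ⊗ₜ w)) := by
    rw [degreePart_apply]
    exact L.toAddMonoidHom.map_finsum_mem' ((hx.isLocallyFinite p _).subset Set.inter_subset_right)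
  rw [hmap]
  refine (finsum_mem_eq_of_bijOn _ (bijOn_monotone_multiset n) fun m hm => ?_).symm
  have hm' : Monotone m := hm
  rw [wordTerm, sortedWord, sort_map_univ hm', kappa_eq p hm', LinearMap.smul_apply, map_smul,
    word_fe_tmul, hL, TensorProduct.dualDistrib_apply, smul_eq_mul, div_eq_inv_mul]
  simp only [List.map_ofFn, Function.comp_def, Pi.neg_apply]

/-- Both sides are the same sum over monotone m: on the left by integrating the rational
continuation, on the right because a multiset has exactly one monotone arrangement and its
p-factorial is `kappa`. -/
theorem isCurrentIntegral_degreePart (hq0 : q ≠ 0) (hq : ∀ n : ℕ, 0 < n → q ^ n ≠ 1)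
    (hρ : IsHighestWeight ρ) (hσ : IsHighestWeight σ) (hx : HasFiniteWords (fe ρ σ)) (n : ℕ) :
    IsCurrentIntegral ρ σ n (((2 * (Real.pi : ℂ) * Complex.I) ^ n * (n.factorial : ℂ)) •
      degreePart hx (q ^ 2) n) := by
  classical
  refine ⟨ContourSystem.exists_admissible hq0 hq n, fun φ ψ hφ hψ v w => ?_⟩
  obtain ⟨M, hM0, hM⟩ := hρ.exists_f_bound v
  obtain ⟨N, hN⟩ := hρ.exists_lower_bound isShift_f hφ v
  obtain ⟨M', hM0', hM'⟩ := hσ.exists_e_bound hq0 hq w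
  obtain ⟨N', hN'⟩ := hσ.exists_lower_bound isShift_e hψ w
  replace hM' : ∀ l : List ℤ, M' < l.sum → (l.map fun a => σ (e q a)).prod w = 0 :=
    fun l hl => hM' l (by omega)
  obtain ⟨F, hF, hFc⟩ := exists_antisymm_of_words (x := fun a => ρ (f q a)) (p := (q ^ 2)⁻¹)
    (fun a b => by simpa only [map_sub, map_smul, map_mul] using congrArg ρ (f_exchange a b))
    hM0 hM hN n
  obtain ⟨H, hH, hHc⟩ := exists_antisymm_of_words (x := fun a => σ (e q a)) (p := q ^ 2)
    (fun a b => by simpa only [map_sub, map_smul, map_mul] using congrArg σ (e_exchange a b))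
    hM0' hM' hN' n
  have hcont := isContinuation_quotFun hq0 hFc hHc
  refine ⟨⟨_, hcont⟩, fun G hG C hC => ?_⟩
  have hp : ∀ n : ℕ, 0 < n → (q ^ 2) ^ n ≠ 1 := fun n hn => by
    rw [← pow_mul]; exact hq _ (by omega)
  -- A finite set containing every monotone m for which the word in e has a nonzero matrix
  -- coefficient.
  let S : Finset (Fin n → ℤ) :=
    (Fintype.piFinset fun _ => Finset.Icc (-(M' + N')) M').filter fun m => Monotone m
  have hS : ∀ m ∈ S, Monotone m := fun m hm => (Finset.mem_filter.mp hm).2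
  have hS' : ∀ m : Fin n → ℤ, Monotone m →
      ψ ((List.ofFn fun i => σ (e q (m i))).prod w) ≠ 0 → m ∈ S := fun m hm hne =>
    Finset.mem_filter.mpr ⟨Fintype.mem_piFinset.mpr fun i =>
      (tailBound_of_word_ne_zero hM' hN' m hne).mem_Icc_of_monotone hM0' hm i, hm⟩
  rw [nestedIntegral_eq_sum hq0 hF hH S hS
    (fun m hm => by rw [kappa_eq _ (hS m hm)]; exact multFactorial_ne_zero hp _)
    (fun m hm hne => hS' m hm (by rwa [hHc] at hne)) hC fun z hz => by
      rw [hG.eqOn hq0 hcont hz, quotFun_eq]]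
  rw [LinearMap.smul_apply, map_smul, smul_eq_mul, dualDistrib_degreePart,
    mul_assoc ((2 * (Real.pi : ℂ) * Complex.I) ^ n)]
  congr 2
  rw [finsum_mem_eq_sum_of_inter_support_eq (t := S)]
  · exact Finset.sum_congr rfl fun m _ => by rw [hFc, hHc]
  · ext m
    refine ⟨fun h => ⟨hS' m h.1 fun h0 => h.2 (by simp only [h0, mul_zero, zero_div]), h.2⟩,
      fun h => ⟨hS m h.1, h.2⟩⟩

end Tensor

end QuantumAffine

end

theorem proposition3 (q : ℂ) (hq0 : q ≠ 0) (hq : ∀ n : ℕ, 0 < n → q ^ n ≠ 1)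
    {V W : Type*} [AddCommGroup V] [Module ℂ V] [AddCommGroup W] [Module ℂ W]
    (ρ : QuantumAffine.Uq q →ₐ[ℂ] Module.End ℂ V) (σ : QuantumAffine.Uq q →ₐ[ℂ] Module.End ℂ W)
    (hρ : QuantumAffine.IsHighestWeight ρ) (hσ : QuantumAffine.IsHighestWeight σ) :
    ∃ R : Module.End ℂ (TensorProduct ℂ V W),
      QuantumAffine.IsRbar ρ σ R ∧ QuantumAffine.IsOrderedExpIntegral ρ σ R := by
  have hx := QuantumAffine.hasFiniteWords_fe hq0 hq hρ hσ
  have hy := hx.smul (-(q - q⁻¹))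
  refine ⟨QuantumAffine.locSum _ (hy.isLocallyFinite (q ^ 2)),
    ⟨QuantumAffine.expOf hy (q ^ 2), QuantumAffine.isQExp_expOf hy (q ^ 2),
      QuantumAffine.eventually_orderedProd_expOf hy (q ^ 2)⟩,
    fun n => ((2 * (Real.pi : ℂ) * Complex.I) ^ n * (n.factorial : ℂ)) •
      QuantumAffine.degreePart hx (q ^ 2) n,
    fun n _ => QuantumAffine.isCurrentIntegral_degreePart hq0 hq hρ hσ hx n, fun u => ?_⟩
  filter_upwards [QuantumAffine.eventually_sum_degreePart hy (q ^ 2) u] with N hN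
  rw [← hN]
  congr 1
  refine Finset.sum_congr rfl fun n _ => ?_
  -- The exponent -(q - q⁻¹) contributes (q⁻¹ - q)^n in degree n; the factor (2πi)^n n! of the
  -- integral cancels the normalization.
  rw [QuantumAffine.degreePart_smul hx, LinearMap.smul_apply, LinearMap.smul_apply, smul_smul,
    neg_sub]
  congr 1
  have h1 : (2 * (Real.pi : ℂ) * Complex.I) ^ n ≠ 0 := pow_ne_zero _ Complex.two_pi_I_ne_zero
  have h2 : (n.factorial : ℂ) ≠ 0 := Nat.cast_ne_zero.mpr n.factorial_ne_zero
  field_simp
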